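/- **Theorem ($U_{t,s}$ as operator limit of Dyson series).** Let $X$ and $Y$ be complex Banach spaces with $Y\subset X$ dense and continuously embedded, and let $(G_t)_{t\ge 0}$ be linear operators $G_t:D(G_t)\subset X\to X$. Assume: - **(B1) Kato quasi-stability.** There are $m\ge 1$ and a locally bounded, measurable $\beta_0:[0,\infty)\to\mathbb R$ such that $\lambda+iG_t$ has a bounded inverse $(\lambda+iG_t)^{-1}\in\mathcal B(X)$ for all $t\ge 0$ and real $\lambda>\beta_0(t)$, and $$\Big\|(\lambda_n+iG_{t_n})^{-1}\cdots(\lambda_1+iG_{t_1})^{-1}\Big\|\le m\prod_{j=1}^n\frac1{\lambda_j-\beta_0(t_j)}$$ whenever $0\le t_1\le\dots\le t_n$ and $\lambda_j>\beta_0(t_j)$ for all $j$ (time-ordered product: later times on the left). - **(B2) Domains and continuity.** $Y\subset D(G_t)$ for all $t\ge 0$, and $t\mapsto G_t|_Y$ is a norm-continuous map $[0,\infty)\to\mathcal B(Y,X)$. - **(B3) Intertwining condition.** There is a closed operator $\Theta$ in $X$ with domain $Y$ such that $\Theta-\mu:Y\to X$ is bijective for some $\mu\in\mathbb C$ (for instance,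 $\Theta$ invertible), and whose commutators with the $G_t$ are bounded from $Y$ to $X$, in the following sense: for each $t\ge 0$ there is $C_t=[\Theta,G_t]\in\mathcal B(Y,X)$ such that for every $y\in Y$ with $\Theta y\in D(G_t)$ one has $G_ty\in Y$ and $\Theta G_ty-G_t\Theta y=C_ty$. The function $t\mapsto\|C_t\|_{\mathcal B(Y,X)}$ is locally bounded on $[0,\infty)$, and $t\mapsto C_ty$ is strongly measurable (up to null sets) for each $y\in Y$. Then there is a family $(U_{t,s})_{t\ge s\ge 0}\subset\mathcal B(X)$ such that: 1. $U$ is a strong solution on $Y$ of both evolution equations: for $t\ge s\ge 0$ and $y\in Y$ one has $U_{t,s}y\in D(G_t)$ and $$\partial_tU_{t,s}y=-iG_tU_{t,s}y,\quad U_{s,s}=1;\qquad \partial_sU_{t,s}y=iU_{t,s}G_sy,\quad U_{t,t}=1,$$ with derivatives in the norm of $X$, one-sided at $t=s$ and at $s=0$. 2. $U$ is unique, even for the first equation alone: if $(V_{t,s})_{t\ge s\ge0}\subset\mathcal B(X)$ satisfies $V_{s,s}=1$, $V_{t,s}y\in D(G_t)$ and $\partial_tV_{t,s}y=-iG_tV_{t,s}y$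 for all $y\in Y$, $t\ge s\ge 0$, then $V_{t,s}=U_{t,s}$ for all $t\ge s\ge 0$. 3. $U_{t,s}Y\subset Y$ for all $t\ge s\ge 0$, and $U$ is an evolution operator: $U_{s,s}=1$, $U_{t,s}=U_{t,x}U_{x,s}$ for $t\ge x\ge s\ge 0$, and $(t,s)\mapsto U_{t,s}x$ is jointly continuous on $\{t\ge s\ge 0\}$ for each $x\in X$. 4. Let $G_{t,\lambda}:=\lambda G_t(\lambda+iG_t)^{-1}$. For every $T\ge 0$ and all sufficiently large $\lambda$ (depending on $T$), $t\mapsto G_{t,\lambda}\in\mathcal B(X)$ is strongly continuous on $[0,T]$, and for $0\le s\le t\le T$ the Dyson series $$U_{\lambda,t,s}:=1+\sum_{n\ge1}(-i)^n\int_s^t d\tau_1\cdots\int_s^{\tau_{n-1}}d\tau_n\,G_{\tau_1,\lambda}\cdots G_{\tau_n,\lambda}$$ (with integrals in the strong sense) consists of bounded operators and converges absolutely in operator norm. For all $t\ge s\ge0$, as $\lambda\to\infty$, $U_{\lambda,t,s}x\to U_{t,s}x$ for every $x\in X$, and $\|U_{\lambda,t,s}-U_{t,s}\|_{\mathcal B(Y,X)}\to0$.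 -/

import Mathlib

open Filter Topology MeasureTheory

namespace NonautonomousEvolution

variable {X Y : Type*} [NormedAddCommGroup X] [NormedSpace ℂ X]
  [NormedAddCommGroup Y] [NormedSpace ℂ Y]

/-- `R` is a bounded everywhere defined two-sided inverse of `l + i A : D(A) → X`. -/
def IsShiftedInverse (A : X →ₗ.[ℂ] X) (l : ℝ) (R : X →L[ℂ] X) : Prop :=
  (∀ x : X, ∃ h : R x ∈ A.domain, (l : ℂ) • R x + Complex.I • A ⟨R x, h⟩ = x) ∧
    ∀ x : A.domain, R ((l : ℂ) • (x : X) + Complex.I • A x) = x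

theorem IsShiftedInverse.unique {A : X →ₗ.[ℂ] X} {l : ℝ} {R S : X →L[ℂ] X}
    (hR : IsShiftedInverse A l R) (hS : IsShiftedInverse A l S) : R = S := by
  ext x
  obtain ⟨h, hx⟩ := hR.1 x
  have h2 := hS.2 ⟨R x, h⟩
  rw [hx] at h2
  exact h2.symm

open Classical in
/-- The operator `(l + i A)⁻¹`, when `l + i A` has a bounded inverse (and `0` otherwise). -/
noncomputable def shiftedResolvent (A : X →ₗ.[ℂ] X) (l : ℝ) : X →L[ℂ] X :=
  if h : ∃ R : X →L[ℂ] X, IsShiftedInverse A l R then h.choose else 0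

theorem shiftedResolvent_spec {A : X →ₗ.[ℂ] X} {l : ℝ}
    (h : ∃ R : X →L[ℂ] X, IsShiftedInverse A l R) :
    IsShiftedInverse A l (shiftedResolvent A l) := by
  unfold shiftedResolvent
  rw [dif_pos h]
  exact h.choose_spec

/-- The Yosida approximant `l A (l + i A)⁻¹`, written as `-i l (1 - l (l + i A)⁻¹)`;
see `yosida_apply`. -/
noncomputable def yosida (A : X →ₗ.[ℂ] X) (l : ℝ) : X →L[ℂ] X :=
  (-(Complex.I * (l : ℂ))) • (1 - (l : ℂ) • shiftedResolvent A l)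

theorem yosida_apply {A : X →ₗ.[ℂ] X} {l : ℝ}
    (h : ∃ R : X →L[ℂ] X, IsShiftedInverse A l R) (x : X) :
    ∃ hx : shiftedResolvent A l x ∈ A.domain,
      yosida A l x = (l : ℂ) • A ⟨shiftedResolvent A l x, hx⟩ := by
  obtain ⟨hx, e⟩ := (shiftedResolvent_spec h).1 x
  refine ⟨hx, ?_⟩
  have e2 : x - (l : ℂ) • shiftedResolvent A l x =
      Complex.I • A ⟨shiftedResolvent A l x, hx⟩ := by
    rw [sub_eq_iff_eq_add, add_comm]; exact e.symm
  simp only [yosida, FunLike.coe_smul, Pi.smul_apply, FunLike.coe_sub,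
    Pi.sub_apply, one_apply_eq_self]
  rw [e2, smul_smul]
  congr 1
  linear_combination (-(l : ℂ)) * Complex.I_mul_I

/-- Condition B1 (Kato quasi-stability): `l + i G_t` is boundedly invertible for `t ≥ 0` and
`l > β₀(t)`, with stability of the time-ordered products of resolvents.  For `t₁ ≤ … ≤ tₙ`, the
factor with the larger time stands to the left, whence `List.reverse`. -/
def KatoQuasiStable (G : ℝ → X →ₗ.[ℂ] X) : Prop :=
  ∃ (m : ℝ) (β₀ : ℝ → ℝ), 1 ≤ m ∧
    Measurable ((Set.Ici (0 : ℝ)).domRestrict β₀) ∧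
    (∀ T : ℝ, ∃ b : ℝ, ∀ t ∈ Set.Icc 0 T, |β₀ t| ≤ b) ∧
    (∀ t l : ℝ, 0 ≤ t → β₀ t < l → ∃ R : X →L[ℂ] X, IsShiftedInverse (G t) l R) ∧
    ∀ (n : ℕ) (t l : Fin n → ℝ), Monotone t → (∀ j, 0 ≤ t j) → (∀ j, β₀ (t j) < l j) →
      ‖((List.ofFn fun j => shiftedResolvent (G (t j)) (l j)).reverse).prod‖ ≤
        m * ∏ j, 1 / (l j - β₀ (t j))

/-- Condition B2: `Y ⊆ D(G_t)` for `t ≥ 0`, and `t ↦ G_t` is a norm continuous map from `[0, ∞)`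
to the bounded operators `Y → X`.  The inclusion of `Y` in `X` is `ι`. -/
def DomainsAndContinuity (ι : Y →L[ℂ] X) (G : ℝ → X →ₗ.[ℂ] X) : Prop :=
  ∃ g : ℝ → Y →L[ℂ] X,
    (∀ t : ℝ, 0 ≤ t → ∀ y : Y, ∃ h : ι y ∈ (G t).domain, g t y = G t ⟨ι y, h⟩) ∧
    ContinuousOn g (Set.Ici 0)

/-- `C : Y → X` is the commutator `[Θ, A]`: whenever `A Θ y` is defined, so is `Θ A y`, and
`Θ A y - A Θ y = C y`.  In other words `Θ A Θ⁻¹ = A + C Θ⁻¹` when `Θ` is invertible and `A` is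
(up to the factor `-i`) a generator.  The domain of `Θ` is the range of `ι`. -/
def IsCommutator (ι : Y →L[ℂ] X) (Θ A : X →ₗ.[ℂ] X) (C : Y →L[ℂ] X) : Prop :=
  ∀ (y : Y) (hΘ : ι y ∈ Θ.domain) (hA : ι y ∈ A.domain) (hAΘ : Θ ⟨ι y, hΘ⟩ ∈ A.domain),
    ∃ hΘA : A ⟨ι y, hA⟩ ∈ Θ.domain,
      Θ ⟨A ⟨ι y, hA⟩, hΘA⟩ - A ⟨Θ ⟨ι y, hΘ⟩, hAΘ⟩ = C y

/-- Condition B3 (intertwining condition): there is a closed operator `Θ` with domain `Y` and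
nonempty resolvent set, whose commutators with the `G_t` are bounded operators `Y → X`, locally
bounded in norm and strongly measurable in `t ≥ 0`. -/
def Intertwining (ι : Y →L[ℂ] X) (G : ℝ → X →ₗ.[ℂ] X) : Prop :=
  ∃ (Θ : X →ₗ.[ℂ] X) (C : ℝ → Y →L[ℂ] X),
    Θ.IsClosed ∧
    (Θ.domain : Set X) = Set.range ι ∧
    (∃ μ : ℂ, Function.Bijective fun x : Θ.domain => Θ x - μ • (x : X)) ∧
    (∀ t : ℝ, 0 ≤ t → IsCommutator ι Θ (G t) (C t)) ∧
    (∀ T : ℝ, ∃ b : ℝ, ∀ t ∈ Set.Icc 0 T, ‖C t‖ ≤ b) ∧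
    ∀ y : Y, AEStronglyMeasurable (fun t => C t y) (volume.restrict (Set.Ici 0))

/-- `U` solves `∂ₜ U_{t,s} = -i G_t U_{t,s}`, `U_{s,s} = 1`, strongly on `Y`, for `t ≥ s ≥ 0`
(right derivative at `t = s`). -/
def IsForwardSolution (ι : Y →L[ℂ] X) (G : ℝ → X →ₗ.[ℂ] X) (U : ℝ → ℝ → X →L[ℂ] X) : Prop :=
  (∀ s : ℝ, 0 ≤ s → U s s = 1) ∧
    ∀ s t : ℝ, 0 ≤ s → s ≤ t → ∀ y : Y, ∃ h : U t s (ι y) ∈ (G t).domain,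
      HasDerivWithinAt (fun r => U r s (ι y)) (-(Complex.I • G t ⟨U t s (ι y), h⟩))
        (Set.Ici s) t

/-- `U` solves `∂ₛ U_{t,s} = i U_{t,s} G_s`, `U_{t,t} = 1`, strongly on `Y`, for `t ≥ s ≥ 0`
(left derivative at `s = t`, right derivative at `s = 0`). -/
def IsBackwardSolution (ι : Y →L[ℂ] X) (G : ℝ → X →ₗ.[ℂ] X) (U : ℝ → ℝ → X →L[ℂ] X) : Prop :=
  (∀ t : ℝ, 0 ≤ t → U t t = 1) ∧
    ∀ s t : ℝ, 0 ≤ s → s ≤ t → ∀ y : Y, ∃ h : ι y ∈ (G s).domain,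
      HasDerivWithinAt (fun r => U t r (ι y)) (Complex.I • U t s (G s ⟨ι y, h⟩))
        (Set.Icc 0 t) s

/-- `U` is an evolution operator: jointly strongly continuous on `{t ≥ s ≥ 0}`, with
`U_{s,s} = 1` and `U_{t,s} = U_{t,x} U_{x,s}`. -/
def IsEvolutionOperator (U : ℝ → ℝ → X →L[ℂ] X) : Prop :=
  (∀ s : ℝ, 0 ≤ s → U s s = 1) ∧
    (∀ s x t : ℝ, 0 ≤ s → s ≤ x → x ≤ t → U t s = U t x * U x s) ∧
    ∀ v : X, ContinuousOn (fun p : ℝ × ℝ => U p.1 p.2 v) {p | 0 ≤ p.2 ∧ p.2 ≤ p.1}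

/-- The `n`-th term of the Dyson series of `A`, applied to `x`:
`(-i)ⁿ ∫ₛᵗ dτ₁ ⋯ ∫ₛ^{τₙ₋₁} dτₙ A_{τ₁} ⋯ A_{τₙ} x`. -/
noncomputable def dysonTerm (A : ℝ → X →L[ℂ] X) (s : ℝ) : ℕ → ℝ → X → X
  | 0, _, x => x
  | n + 1, t, x => (-Complex.I) • ∫ τ in s..t, A τ (dysonTerm A s n τ x)

/-- `W` is the sum of the Dyson series of `A` from `s` to `t`: the terms are bounded operators,
and the series converges absolutely in operator norm to `W`. -/
def IsDysonSum (A : ℝ → X →L[ℂ] X) (s t : ℝ) (W : X →L[ℂ] X) : Prop :=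
  ∃ D : ℕ → X →L[ℂ] X, (∀ n x, D n x = dysonTerm A s n t x) ∧
    (Summable fun n => ‖D n‖) ∧ HasSum D W

end NonautonomousEvolution

open NonautonomousEvolution

/-! ### Measurability and integrability of strongly measurable operator families. -/

section OperatorFamilies

variable {X : Type*} [NormedAddCommGroup X] [NormedSpace ℂ X]

/-! The evolution is built from bounded generators. Write `A_t = -i G_t` and replace it by its
Yosida approximants, whose Dyson series converge in norm to propagators `U_l`. What has to be shown
is that the `U_l` are bounded uniformly in `l`, that they converge, and that the limit solves the
equation on `Y`.

Stability. Kato's condition allows a decreasing family of equivalent norms `N_t` for which each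
resolvent is quasi-contractive (`exists_stable_seminorms`). The Yosida approximants are then
quasi-dissipative in `N_t`, and a Gronwall argument for merely semicontinuous functions gives a
bound on `U_l` that does not depend on `l` (`KatoSystem.U_norm_le`).

Regularity. With `S = (Θ - μ)⁻¹`, the commutator condition says that `A_t` is intertwined by `S`
with a bounded perturbation `A_t + B_t`, hence `R S = S Rh` for the resolvents and `U_l S = S Uh_l`
for the evolutions. The Yosida approximants of the two families differ by operators bounded
uniformly in `l`, so Duhamel's formula and the perturbation series bound `Uh_l` as well
(`KatoSystem.Uh_norm_le`). Thus `U_l` maps the range of `S`, which is `Y`, into itself with uniform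
bounds.

Convergence. On a short interval the generator is frozen at the left endpoint. Freezing costs little
because `t ↦ A_t S` is uniformly continuous, and for a frozen generator the classical Hille–Yosida
comparison of commuting approximants applies. Telescoping over a partition, with all intermediate
vectors in the range of `S`, gives the Cauchy estimate `KatoSystem.U_cauchy`; density extends it to
strong convergence.

Equations. `Uh_l` also converges strongly, term by term in its perturbation series. Letting `l → ∞`
in the integral equations of `U_l S` yields those of the limit, and continuity of the integrands
turns them into derivatives. Uniqueness follows from quasi-dissipativity alone.

All this is carried out on `[0, T]`, with times clamped to that interval and the data collected in a
`KatoSystem`. The limit is defined without reference to `T`, so the results for different `T` fit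
together. -/

theorem aestronglyMeasurable_clm_apply {α : Type*} [MeasurableSpace α] {μ : Measure α}
    {F : α → X →L[ℂ] X} (hF : ∀ x, AEStronglyMeasurable (fun r => F r x) μ)
    {v : α → X} (hv : AEStronglyMeasurable v μ) :
    AEStronglyMeasurable (fun r => F r (v r)) μ := by
  have key : ∀ f : SimpleFunc α X, AEStronglyMeasurable (fun r => F r (f r)) μ := by
    intro f
    induction f using SimpleFunc.induction with
    | const c hs =>
      rename_i s
      have : (fun r => F r ((SimpleFunc.piecewise s hs (SimpleFunc.const α c)
          (SimpleFunc.const α 0)) r)) = s.indicator (fun r => F r c) := by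
        funext r
        by_cases h : r ∈ s <;> simp [h]
      rw [this]
      exact (hF c).indicator hs
    | add _ hf hg =>
      simp only [SimpleFunc.coe_add, Pi.add_apply, map_add]
      exact hf.add hg
  have h1 : AEStronglyMeasurable (fun r => F r (hv.mk v r)) μ := by
    refine aestronglyMeasurable_of_tendsto_ae atTop
      (fun n => key (hv.stronglyMeasurable_mk.approx n)) (Eventually.of_forall fun r => ?_)
    exact ((F r).continuous.tendsto _).comp (hv.stronglyMeasurable_mk.tendsto_approx r)
  refine h1.congr ?_
  filter_upwards [hv.ae_eq_mk] with r hr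
  rw [hr]

theorem intervalIntegrable_of_norm_le {X : Type*} [NormedAddCommGroup X] {f : ℝ → X} {a b C : ℝ}
    (hf : AEStronglyMeasurable f volume) (hC : ∀ t ∈ Set.uIoc a b, ‖f t‖ ≤ C) :
    IntervalIntegrable f volume a b := by
  refine (intervalIntegrable_const (c := C)).mono_fun hf.restrict ?_
  refine (ae_restrict_mem measurableSet_uIoc).mono fun t ht => ?_
  exact (hC t ht).trans (le_abs_self C)

theorem intervalIntegrable_clm_apply {A : ℝ → X →L[ℂ] X} {K : ℝ}
    (hA : ∀ x, AEStronglyMeasurable (fun r => A r x) volume) (hK : ∀ t, ‖A t‖ ≤ K)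
    {v : ℝ → X} (hv : Continuous v) (a b : ℝ) :
    IntervalIntegrable (fun r => A r (v r)) volume a b := by
  obtain ⟨C, hC⟩ := isCompact_uIcc.exists_bound_of_continuousOn
    (hv.continuousOn (s := Set.uIcc a b))
  refine intervalIntegrable_of_norm_le (C := K * C)
    (aestronglyMeasurable_clm_apply hA hv.aestronglyMeasurable) fun t ht => ?_
  exact (A t).le_of_opNorm_le_of_le (hK t) (hC t (Set.uIoc_subset_uIcc ht))

end OperatorFamilies

/-! ### Dyson series of a bounded, strongly measurable generator. -/

section Dyson

variable {X : Type*} [NormedAddCommGroup X] [NormedSpace ℂ X]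
variable {A : ℝ → X →L[ℂ] X} {K : ℝ}

theorem continuous_dysonTerm [CompleteSpace X]
    (hA : ∀ x, AEStronglyMeasurable (fun r => A r x) volume)
    (hK : ∀ t, ‖A t‖ ≤ K) (s : ℝ) (n : ℕ) (x : X) :
    Continuous fun t => dysonTerm A s n t x := by
  induction n with
  | zero => exact continuous_const
  | succ n ih =>
    exact (intervalIntegral.continuous_primitive
      (fun a b => intervalIntegrable_clm_apply hA hK ih a b) s).const_smul _

theorem dysonTerm_add [CompleteSpace X]
    (hA : ∀ x, AEStronglyMeasurable (fun r => A r x) volume)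
    (hK : ∀ t, ‖A t‖ ≤ K) (s : ℝ) (n : ℕ) (t : ℝ) (x y : X) :
    dysonTerm A s n t (x + y) = dysonTerm A s n t x + dysonTerm A s n t y := by
  induction n generalizing t with
  | zero => rfl
  | succ n ih =>
    simp only [dysonTerm, ih, map_add]
    rw [intervalIntegral.integral_add
      (intervalIntegrable_clm_apply hA hK (continuous_dysonTerm hA hK s n x) _ _)
      (intervalIntegrable_clm_apply hA hK (continuous_dysonTerm hA hK s n y) _ _), smul_add]

theorem dysonTerm_smul (A : ℝ → X →L[ℂ] X) (s : ℝ) (n : ℕ) (t : ℝ) (c : ℂ) (x : X) :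
    dysonTerm A s n t (c • x) = c • dysonTerm A s n t x := by
  induction n generalizing t with
  | zero => rfl
  | succ n ih =>
    simp only [dysonTerm, ih, map_smul]
    rw [intervalIntegral.integral_smul, smul_comm]

theorem norm_dysonTerm_le (hK : ∀ t, ‖A t‖ ≤ K) (s : ℝ) (n : ℕ) (t : ℝ) (x : X) :
    ‖dysonTerm A s n t x‖ ≤ (K * |t - s|) ^ n / n.factorial * ‖x‖ := by
  have hK0 : 0 ≤ K := (norm_nonneg _).trans (hK 0)
  induction n generalizing t with
  | zero => simp [dysonTerm]
  | succ n ih =>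
    simp only [dysonTerm]
    rw [norm_smul, norm_neg, Complex.norm_I, one_mul]
    calc ‖∫ τ in s..t, A τ (dysonTerm A s n τ x)‖
        ≤ ∫ τ in Set.uIoc s t, ‖A τ (dysonTerm A s n τ x)‖ :=
          intervalIntegral.norm_integral_le_integral_norm_uIoc
      _ ≤ ∫ τ in Set.uIoc s t, |τ - s| ^ n * (K * (K ^ n / n.factorial * ‖x‖)) := by
          -- No measurability of the left integrand is needed: if it is not integrable, its integral
          -- is zero.
          refine integral_mono_of_nonneg (Eventually.of_forall fun τ => norm_nonneg _) ?_
            (Eventually.of_forall fun τ => ?_)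
          · have : Continuous fun τ : ℝ => |τ - s| ^ n * (K * (K ^ n / n.factorial * ‖x‖)) := by
              fun_prop
            exact (intervalIntegrable_iff.mp (this.intervalIntegrable s t))
          · refine ((A τ).le_of_opNorm_le_of_le (hK τ) (ih τ)).trans (le_of_eq ?_)
            rw [mul_pow]; ring
      _ = (K * |t - s|) ^ (n + 1) / (n + 1).factorial * ‖x‖ := by
          rw [integral_mul_const, integral_pow_abs_sub_uIoc, Nat.factorial_succ]
          push_cast
          have : (n.factorial : ℝ) ≠ 0 := by positivity
          have : (n + 1 : ℝ) ≠ 0 := by positivity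
          rw [mul_pow]
          field_simp
          ring

open Classical in
/-- The `n`-th Dyson term as a bounded operator (`0` if it is not one). -/
noncomputable def dysonOp (A : ℝ → X →L[ℂ] X) (s : ℝ) (n : ℕ) (t : ℝ) : X →L[ℂ] X :=
  if h : ∃ D : X →L[ℂ] X, ∀ x, D x = dysonTerm A s n t x then h.choose else 0

/-- The sum of the Dyson series of `A` from `s` to `t`. -/
noncomputable def evo (A : ℝ → X →L[ℂ] X) (t s : ℝ) : X →L[ℂ] X :=
  ∑' n, dysonOp A s n t

/-- Only the generator on `[s, t]` enters. This later allows `G` to be replaced by its version with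
clamped times. -/
theorem dysonTerm_congr {A' : ℝ → X →L[ℂ] X} {s t : ℝ} (hst : s ≤ t)
    (h : ∀ τ ∈ Set.Icc s t, A τ = A' τ) (n : ℕ) (x : X) :
    dysonTerm A s n t x = dysonTerm A' s n t x := by
  induction n generalizing t with
  | zero => rfl
  | succ n ih =>
    simp only [dysonTerm]
    congr 1
    refine intervalIntegral.integral_congr fun τ hτ => ?_
    rw [Set.uIcc_of_le hst] at hτ
    rw [h τ hτ, ih hτ.1 fun r hr => h r ⟨hr.1, hr.2.trans hτ.2⟩]

theorem evo_congr {A' : ℝ → X →L[ℂ] X} {s t : ℝ} (hst : s ≤ t)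
    (h : ∀ τ ∈ Set.Icc s t, A τ = A' τ) : evo A t s = evo A' t s := by
  refine tsum_congr fun n => ?_
  have h1 : dysonTerm A s n t = dysonTerm A' s n t := funext (dysonTerm_congr hst h n)
  unfold dysonOp
  rw [h1]

theorem isDysonSum_congr {A' : ℝ → X →L[ℂ] X} {s t : ℝ} (hst : s ≤ t)
    (h : ∀ τ ∈ Set.Icc s t, A τ = A' τ) {W : X →L[ℂ] X} (hW : IsDysonSum A s t W) :
    IsDysonSum A' s t W := by
  obtain ⟨D, h1, h2⟩ := hW
  exact ⟨D, fun n x => (h1 n x).trans (dysonTerm_congr hst h n x), h2⟩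

variable [CompleteSpace X]

theorem dysonOp_apply (hA : ∀ x, AEStronglyMeasurable (fun r => A r x) volume)
    (hK : ∀ t, ‖A t‖ ≤ K) (s : ℝ) (n : ℕ) (t : ℝ) (x : X) :
    dysonOp A s n t x = dysonTerm A s n t x := by
  have h : ∃ D : X →L[ℂ] X, ∀ x, D x = dysonTerm A s n t x :=
    ⟨LinearMap.mkContinuous
      { toFun := dysonTerm A s n t
        map_add' := dysonTerm_add hA hK s n t
        map_smul' := dysonTerm_smul A s n t } _ (norm_dysonTerm_le hK s n t), fun x => rfl⟩
  unfold dysonOp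
  rw [dif_pos h]
  exact h.choose_spec x

theorem norm_dysonOp_le (hA : ∀ x, AEStronglyMeasurable (fun r => A r x) volume)
    (hK : ∀ t, ‖A t‖ ≤ K) (s : ℝ) (n : ℕ) (t : ℝ) :
    ‖dysonOp A s n t‖ ≤ (K * |t - s|) ^ n / n.factorial := by
  have hK0 : 0 ≤ K := (norm_nonneg _).trans (hK 0)
  refine ContinuousLinearMap.opNorm_le_bound _ (by positivity) fun x => ?_
  rw [dysonOp_apply hA hK]
  exact norm_dysonTerm_le hK s n t x

theorem summable_norm_dysonOp (hA : ∀ x, AEStronglyMeasurable (fun r => A r x) volume)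
    (hK : ∀ t, ‖A t‖ ≤ K) (t s : ℝ) : Summable fun n => ‖dysonOp A s n t‖ :=
  Summable.of_nonneg_of_le (fun _ => norm_nonneg _) (fun n => norm_dysonOp_le hA hK s n t)
    (Real.summable_pow_div_factorial _)

theorem hasSum_evo (hA : ∀ x, AEStronglyMeasurable (fun r => A r x) volume)
    (hK : ∀ t, ‖A t‖ ≤ K) (t s : ℝ) : HasSum (fun n => dysonOp A s n t) (evo A t s) :=
  (summable_norm_dysonOp hA hK t s).of_norm.hasSum

theorem hasSum_evo_apply (hA : ∀ x, AEStronglyMeasurable (fun r => A r x) volume)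
    (hK : ∀ t, ‖A t‖ ≤ K) (t s : ℝ) (x : X) :
    HasSum (fun n => dysonTerm A s n t x) (evo A t s x) := by
  have := (hasSum_evo hA hK t s).mapL (ContinuousLinearMap.apply ℂ X x)
  simpa [dysonOp_apply hA hK] using this

theorem isDysonSum_evo (hA : ∀ x, AEStronglyMeasurable (fun r => A r x) volume)
    (hK : ∀ t, ‖A t‖ ≤ K) (t s : ℝ) : IsDysonSum A s t (evo A t s) :=
  ⟨fun n => dysonOp A s n t, fun n x => dysonOp_apply hA hK s n t x,
    summable_norm_dysonOp hA hK t s, hasSum_evo hA hK t s⟩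

theorem norm_evo_le (hA : ∀ x, AEStronglyMeasurable (fun r => A r x) volume)
    (hK : ∀ t, ‖A t‖ ≤ K) (t s : ℝ) : ‖evo A t s‖ ≤ Real.exp (K * |t - s|) := by
  have h : HasSum (fun n : ℕ => (K * |t - s|) ^ n / n.factorial) (Real.exp (K * |t - s|)) := by
    rw [Real.exp_eq_exp_ℝ]
    exact NormedSpace.expSeries_div_hasSum_exp _
  exact tsum_of_norm_bounded h fun n => norm_dysonOp_le hA hK s n t

theorem continuous_evo_left (hA : ∀ x, AEStronglyMeasurable (fun r => A r x) volume)
    (hK : ∀ t, ‖A t‖ ≤ K) (s : ℝ) (x : X) : Continuous fun t => evo A t s x := by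
  have hK0 : 0 ≤ K := (norm_nonneg _).trans (hK 0)
  rw [continuous_iff_continuousAt]
  intro t₀
  have h : ContinuousOn (fun t => ∑' n, dysonTerm A s n t x) (Metric.ball t₀ 1) := by
    refine continuousOn_tsum (u := fun n : ℕ => (K * (|t₀ - s| + 1)) ^ n / n.factorial * ‖x‖)
      (fun n => (continuous_dysonTerm hA hK s n x).continuousOn)
      ((Real.summable_pow_div_factorial _).mul_right _) fun n t ht => ?_
    refine (norm_dysonTerm_le hK s n t x).trans ?_
    have : |t - s| ≤ |t₀ - s| + 1 := by
      have h1 : |t - t₀| < 1 := by simpa [Real.dist_eq] using ht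
      calc |t - s| = |(t - t₀) + (t₀ - s)| := by ring_nf
        _ ≤ |t - t₀| + |t₀ - s| := abs_add_le _ _
        _ ≤ _ := by linarith
    gcongr
  have h2 := h.continuousAt (Metric.ball_mem_nhds t₀ one_pos)
  refine h2.congr (Eventually.of_forall fun t => ?_)
  exact (hasSum_evo_apply hA hK t s x).tsum_eq

/-- Applying the integral operator shifts the Dyson series by one term; dominated convergence
permits termwise integration. -/
theorem evo_apply_eq (hA : ∀ x, AEStronglyMeasurable (fun r => A r x) volume)
    (hK : ∀ t, ‖A t‖ ≤ K) (t s : ℝ) (x : X) :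
    evo A t s x = x + ∫ τ in s..t, (-Complex.I) • A τ (evo A τ s x) := by
  have hK0 : 0 ≤ K := (norm_nonneg _).trans (hK 0)
  have h1 : HasSum (fun n => dysonTerm A s (n + 1) t x) (evo A t s x - x) := by
    have := (hasSum_nat_add_iff' 1).mpr (hasSum_evo_apply hA hK t s x)
    simpa [dysonTerm] using this
  have h2 : HasSum (fun n => ∫ τ in s..t, (-Complex.I) • A τ (dysonTerm A s n τ x))
      (∫ τ in s..t, (-Complex.I) • A τ (evo A τ s x)) := by
    refine intervalIntegral.hasSum_integral_of_dominated_convergence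
      (fun n _ => K * ((K * |t - s|) ^ n / n.factorial * ‖x‖)) (fun n => ?_)
      (fun n => Eventually.of_forall fun τ hτ => ?_) (Eventually.of_forall fun τ hτ => ?_) ?_
      (Eventually.of_forall fun τ hτ => ?_)
    · exact ((aestronglyMeasurable_clm_apply hA
        (continuous_dysonTerm hA hK s n x).aestronglyMeasurable).const_smul _).restrict
    · rw [norm_smul, norm_neg, Complex.norm_I, one_mul]
      refine (A τ).le_of_opNorm_le_of_le (hK τ) ((norm_dysonTerm_le hK s n τ x).trans ?_)
      have : |τ - s| ≤ |t - s| := Set.abs_sub_left_of_mem_uIcc (Set.uIoc_subset_uIcc hτ)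
      gcongr
    · exact ((Real.summable_pow_div_factorial _).mul_right _).mul_left _
    · exact intervalIntegrable_const
    · exact ((hasSum_evo_apply hA hK τ s x).mapL (A τ)).const_smul _
  have h3 : ∀ n, dysonTerm A s (n + 1) t x =
      ∫ τ in s..t, (-Complex.I) • A τ (dysonTerm A s n τ x) := by
    intro n
    rw [intervalIntegral.integral_smul]
    rfl
  simp only [h3] at h1
  rw [← h1.unique h2]
  abel

theorem evo_self (hA : ∀ x, AEStronglyMeasurable (fun r => A r x) volume)
    (hK : ∀ t, ‖A t‖ ≤ K) (s : ℝ) : evo A s s = 1 := by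
  ext x
  rw [evo_apply_eq hA hK]
  simp

theorem dysonTerm_intertwine {Ah : ℝ → X →L[ℂ] X} {Kh : ℝ}
    (hAh : ∀ x, AEStronglyMeasurable (fun r => Ah r x) volume)
    (hKh : ∀ t, ‖Ah t‖ ≤ Kh) {S : X →L[ℂ] X} (hS : ∀ t x, S (Ah t x) = A t (S x))
    (s : ℝ) (n : ℕ) (t : ℝ) (x : X) :
    S (dysonTerm Ah s n t x) = dysonTerm A s n t (S x) := by
  induction n generalizing t with
  | zero => rfl
  | succ n ih =>
    simp only [dysonTerm, map_smul]
    rw [← ContinuousLinearMap.intervalIntegral_comp_comm S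
      (intervalIntegrable_clm_apply hAh hKh (continuous_dysonTerm hAh hKh s n x) s t)]
    simp only [hS, ih]

theorem evo_intertwine (hA : ∀ x, AEStronglyMeasurable (fun r => A r x) volume)
    (hK : ∀ t, ‖A t‖ ≤ K) {Ah : ℝ → X →L[ℂ] X} {Kh : ℝ}
    (hAh : ∀ x, AEStronglyMeasurable (fun r => Ah r x) volume)
    (hKh : ∀ t, ‖Ah t‖ ≤ Kh) {S : X →L[ℂ] X} (hS : ∀ t x, S (Ah t x) = A t (S x))
    (t s : ℝ) (x : X) : S (evo Ah t s x) = evo A t s (S x) := by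
  have h := (hasSum_evo_apply hAh hKh t s x).mapL S
  simp only [dysonTerm_intertwine hAh hKh hS] at h
  exact h.unique (hasSum_evo_apply hA hK t s (S x))

end Dyson

/-! ### Strongly continuous generators: differentiability and the propagator law. -/

section ContinuousGenerators

variable {X : Type*} [NormedAddCommGroup X] [NormedSpace ℂ X]
variable {A : ℝ → X →L[ℂ] X} {K : ℝ}

theorem continuous_clm_apply_of_bound {α : Type*} [TopologicalSpace α] {F : α → X →L[ℂ] X} {C : ℝ}
    (hF : ∀ x, Continuous fun t => F t x) (hC : ∀ t, ‖F t‖ ≤ C) {v : α → X}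
    (hv : Continuous v) : Continuous fun t => F t (v t) := by
  rw [continuous_iff_continuousAt]
  intro t₀
  have h1 : Tendsto (fun t => F t (v t - v t₀)) (𝓝 t₀) (𝓝 0) := by
    refine squeeze_zero_norm (fun t => (F t).le_of_opNorm_le (hC t) _) ?_
    have : Tendsto (fun t => C * ‖v t - v t₀‖) (𝓝 t₀) (𝓝 (C * ‖v t₀ - v t₀‖)) :=
      ((hv.tendsto t₀).sub_const _).norm.const_mul C
    simpa using this
  have h2 := h1.add ((hF (v t₀)).tendsto t₀)
  simpa [ContinuousAt] using h2

variable [CompleteSpace X]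

theorem hasDerivAt_evo_left (hA : ∀ x, Continuous fun r => A r x) (hK : ∀ t, ‖A t‖ ≤ K)
    (t s : ℝ) (x : X) :
    HasDerivAt (fun r => evo A r s x) ((-Complex.I) • A t (evo A t s x)) t := by
  have hm : ∀ x, AEStronglyMeasurable (fun r => A r x) volume :=
    fun x => (hA x).aestronglyMeasurable
  have hc : Continuous fun τ => (-Complex.I) • A τ (evo A τ s x) :=
    (continuous_clm_apply_of_bound hA hK (continuous_evo_left hm hK s x)).const_smul _
  have h := (intervalIntegral.integral_hasDerivAt_right (hc.intervalIntegrable s t)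
    (hc.stronglyMeasurableAtFilter _ _) hc.continuousAt).const_add x
  refine h.congr_of_eventuallyEq (Eventually.of_forall fun r => ?_)
  exact evo_apply_eq hm hK r s x

theorem eq_evo_of_hasDerivAt (hA : ∀ x, Continuous fun r => A r x) (hK : ∀ t, ‖A t‖ ≤ K)
    {s : ℝ} {v : ℝ → X} (hv : ∀ t, HasDerivAt v ((-Complex.I) • A t (v t)) t) (t : ℝ) :
    v t = evo A t s (v s) := by
  have hK0 : 0 ≤ K := (norm_nonneg _).trans (hK 0)
  have hm : ∀ x, AEStronglyMeasurable (fun r => A r x) volume :=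
    fun x => (hA x).aestronglyMeasurable
  have := ODE_solution_unique_univ (v := fun t x => (-Complex.I) • A t x)
    (s := fun _ => Set.univ) (K := K.toNNReal) (f := v) (g := fun t => evo A t s (v s)) (t₀ := s)
    (fun t => by
      refine LipschitzWith.lipschitzOnWith (LipschitzWith.of_dist_le_mul fun x y => ?_)
      rw [dist_eq_norm, ← smul_sub, ← map_sub, norm_smul, norm_neg, Complex.norm_I, one_mul,
        dist_eq_norm, Real.coe_toNNReal _ hK0]
      exact (A t).le_of_opNorm_le (hK t) _)
    (fun t => ⟨hv t, trivial⟩) (fun t => ⟨hasDerivAt_evo_left hA hK t s (v s), trivial⟩)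
    (by simp [evo_self hm hK])
  exact congrFun this t

/-- Both sides solve the same Lipschitz equation with the same value at `r`. The times need no
order, as bounded generators can also be solved backwards. -/
theorem evo_comp (hA : ∀ x, Continuous fun r => A r x) (hK : ∀ t, ‖A t‖ ≤ K)
    (t r s : ℝ) (x : X) : evo A t r (evo A r s x) = evo A t s x :=
  (eq_evo_of_hasDerivAt hA hK (v := fun t => evo A t s x)
    (fun t => hasDerivAt_evo_left hA hK t s x) t).symm

theorem norm_evo_sub_one_le (hA : ∀ x, AEStronglyMeasurable (fun r => A r x) volume)
    (hK : ∀ t, ‖A t‖ ≤ K) (t s : ℝ) (x : X) :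
    ‖evo A t s x - x‖ ≤ K * (Real.exp (K * |t - s|) * ‖x‖) * |t - s| := by
  have hK0 : 0 ≤ K := (norm_nonneg _).trans (hK 0)
  rw [evo_apply_eq hA hK, add_sub_cancel_left]
  refine intervalIntegral.norm_integral_le_of_norm_le_const fun τ hτ => ?_
  rw [norm_smul, norm_neg, Complex.norm_I, one_mul]
  refine (A τ).le_of_opNorm_le_of_le (hK τ)
    ((evo A τ s).le_of_opNorm_le ((norm_evo_le hA hK τ s).trans ?_) x)
  have : |τ - s| ≤ |t - s| := Set.abs_sub_left_of_mem_uIcc (Set.uIoc_subset_uIcc hτ)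
  gcongr

theorem continuous_evo (hA : ∀ x, Continuous fun r => A r x) (hK : ∀ t, ‖A t‖ ≤ K) (x : X) :
    Continuous fun p : ℝ × ℝ => evo A p.1 p.2 x := by
  have hm : ∀ x, AEStronglyMeasurable (fun r => A r x) volume :=
    fun x => (hA x).aestronglyMeasurable
  rw [continuous_iff_continuousAt]
  rintro ⟨t₀, s₀⟩
  have h0 : Continuous fun p : ℝ × ℝ => evo A p.1 s₀ x :=
    (continuous_evo_left hm hK s₀ x).comp continuous_fst
  have h1 : Tendsto (fun p : ℝ × ℝ => evo A p.1 p.2 (x - evo A p.2 s₀ x)) (𝓝 (t₀, s₀))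
      (𝓝 0) := by
    refine squeeze_zero_norm (fun p => (evo A p.1 p.2).le_of_opNorm_le
      (norm_evo_le hm hK p.1 p.2) _) ?_
    have hc : Continuous fun p : ℝ × ℝ =>
        Real.exp (K * |p.1 - p.2|) * ‖x - evo A p.2 s₀ x‖ := by
      have := (continuous_evo_left hm hK s₀ x).comp (continuous_snd (X := ℝ) (Y := ℝ))
      fun_prop
    have := hc.tendsto (t₀, s₀)
    simpa [evo_self hm hK] using this
  have h2 := h1.add (h0.tendsto (t₀, s₀))
  simp only [map_sub, evo_comp hA hK, sub_add_cancel, zero_add] at h2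
  exact h2

/-- By the propagator law, the difference quotient in the initial time equals minus `evo A t r`
applied to the quotient of `evo A r s x` at `r = s`, so the left derivative and a local bound on
`evo` suffice. -/
theorem hasDerivAt_evo_right (hA : ∀ x, Continuous fun r => A r x) (hK : ∀ t, ‖A t‖ ≤ K)
    (t s : ℝ) (x : X) :
    HasDerivAt (fun r => evo A t r x) (Complex.I • evo A t s (A s x)) s := by
  have hm : ∀ x, AEStronglyMeasurable (fun r => A r x) volume :=
    fun x => (hA x).aestronglyMeasurable
  have h := hasDerivAt_evo_left hA hK s s x
  rw [evo_self hm hK, hasDerivAt_iff_tendsto_slope] at h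
  rw [hasDerivAt_iff_tendsto_slope]
  have hc : ∀ x, Tendsto (fun r => evo A t r x) (𝓝[≠] s) (𝓝 (evo A t s x)) := fun x =>
    (((continuous_evo hA hK x).comp (Continuous.prodMk_right t)).tendsto s).mono_left
      nhdsWithin_le_nhds
  set d : X := (-Complex.I) • A s ((1 : X →L[ℂ] X) x) with hd
  have h1 : Tendsto (fun r => evo A t r (slope (fun r => evo A r s x) s r - d)) (𝓝[≠] s)
      (𝓝 0) := by
    refine squeeze_zero_norm (fun r => (evo A t r).le_of_opNorm_le (norm_evo_le hm hK t r) _) ?_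
    have hc2 : Tendsto (fun r => Real.exp (K * |t - r|)) (𝓝[≠] s)
        (𝓝 (Real.exp (K * |t - s|))) :=
      ((by fun_prop : Continuous fun r => Real.exp (K * |t - r|)).tendsto s).mono_left
        nhdsWithin_le_nhds
    have := hc2.mul (h.sub_const d).norm
    simpa using this
  have h2 := (h1.add (hc d)).neg
  have e1 : -(0 + evo A t s d) = Complex.I • evo A t s (A s x) := by
    rw [hd]; simp
  rw [e1] at h2
  refine h2.congr fun r => ?_
  rw [map_sub, sub_add_cancel, slope_def_module, slope_def_module,
    ContinuousLinearMap.map_smul_of_tower, map_sub, evo_comp hA hK, evo_self hm hK, ← smul_neg,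
    neg_sub]
  rfl

end ContinuousGenerators

/-- A Gronwall lemma without continuity: `n` may jump down, as norms that decrease in time do. It is
compared with a strict supersolution `φ`. At the last time up to which `n ≤ φ`, the left condition
makes the inequality strict, and the right condition carries it further. -/
theorem le_mul_exp_of_left_dini {n : ℝ → ℝ} {s t β c : ℝ} (hst : s ≤ t) (h0 : n s ≤ c)
    (hc : 0 ≤ c)
    (hright : ∀ r ∈ Set.Ico s t, ∀ ε > 0, ∀ᶠ q in 𝓝[>] r, n q ≤ n r + ε)
    (hleft : ∀ r ∈ Set.Ioc s t, ∀ ε > 0, ∀ᶠ h in 𝓝[>] (0 : ℝ),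
      n r ≤ n (r - h) + h * (β * n r + ε)) :
    n t ≤ c * Real.exp (β * (t - s)) := by
  have main : ∀ δ > 0, n t ≤ (c + δ) * Real.exp ((β + δ) * (t - s)) := by
    intro δ hδ
    set φ : ℝ → ℝ := fun q => (c + δ) * Real.exp ((β + δ) * (q - s)) with hφ
    have hφpos : ∀ q, 0 < φ q := fun q => by positivity
    have hφd : ∀ q, HasDerivAt φ ((β + δ) * φ q) q := by
      intro q
      have h1 : HasDerivAt (fun q => (β + δ) * (q - s)) (β + δ) q := by
        simpa using ((hasDerivAt_id q).sub_const s).const_mul (β + δ)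
      refine (h1.exp.const_mul (c + δ)).congr_deriv ?_
      simp only [hφ]; ring
    have hφc : Continuous φ := by fun_prop
    set F : Set ℝ := {q | q ∈ Set.Icc s t ∧ ∀ p ∈ Set.Icc s q, n p ≤ φ p} with hF
    have hsF : s ∈ F := by
      refine ⟨⟨le_rfl, hst⟩, fun p hp => ?_⟩
      obtain rfl : p = s := le_antisymm hp.2 hp.1
      simp only [hφ, sub_self, mul_zero, Real.exp_zero, mul_one]
      linarith
    have hbdd : BddAbove F := ⟨t, fun q hq => hq.1.2⟩
    set r := sSup F with hr
    have hsr : s ≤ r := le_csSup hbdd hsF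
    have hrt : r ≤ t := csSup_le ⟨s, hsF⟩ fun q hq => hq.1.2
    have hlt : ∀ p, s ≤ p → p < r → n p ≤ φ p := by
      intro p hp hpr
      obtain ⟨q, hq, hpq⟩ := exists_lt_of_lt_csSup ⟨s, hsF⟩ hpr
      exact hq.2 p ⟨hp, hpq.le⟩
    have hnr : n r < φ r := by
      rcases hsr.eq_or_lt with h | h
      · rw [← h]
        simp only [hφ, sub_self, mul_zero, Real.exp_zero, mul_one]
        linarith
      · by_contra! hcon
        have e1 := hleft r ⟨h, hrt⟩ (δ * φ r / 2) (by have := hφpos r; positivity)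
        have e2 : ∀ᶠ h in 𝓝[>] (0 : ℝ), h < r - s :=
          eventually_nhdsWithin_of_eventually_nhds (eventually_lt_nhds (by linarith))
        have e3 : ∀ᶠ h in 𝓝[>] (0 : ℝ), h * β < 1 := by
          refine eventually_nhdsWithin_of_eventually_nhds ?_
          have : Tendsto (fun h : ℝ => h * β) (𝓝 0) (𝓝 (0 * β)) :=
            (continuous_id.mul continuous_const).tendsto 0
          rw [zero_mul] at this
          exact this.eventually (eventually_lt_nhds one_pos)
        have e4 : ∀ᶠ h in 𝓝[>] (0 : ℝ), ‖φ (r - h) - φ r - (-h) * ((β + δ) * φ r)‖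
            ≤ δ * φ r / 4 * ‖-h‖ := by
          have := (hasDerivAt_iff_isLittleO_nhds_zero.mp (hφd r)).def
            (show 0 < δ * φ r / 4 by have := hφpos r; positivity)
          have ht : Tendsto (fun h : ℝ => -h) (𝓝[>] 0) (𝓝 0) := by
            have : Tendsto (fun h : ℝ => -h) (𝓝 0) (𝓝 (-0)) := continuous_neg.tendsto 0
            rw [neg_zero] at this
            exact this.mono_left nhdsWithin_le_nhds
          exact (ht.eventually this).mono fun h hh => by simpa [sub_eq_add_neg] using hh
        obtain ⟨h', ⟨⟨⟨f1, f2⟩, f3⟩, f4⟩, f5⟩ :=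
          ((((e1.and e2).and e3).and e4).and self_mem_nhdsWithin).exists
        have f5 : 0 < h' := f5
        have f6 := hlt (r - h') (by linarith) (by linarith)
        -- The slack `δ * φ r` in the growth of `φ` exceeds the two errors `δ * φ r / 2` and `δ * φ
        -- r / 4`; this contradicts `φ r ≤ n r` as `1 - h' * β` is positive.
        rw [norm_neg, Real.norm_of_nonneg f5.le, Real.norm_eq_abs, abs_le] at f4
        have g1 : 0 ≤ (n r - φ r) * (1 - h' * β) :=
          mul_nonneg (by linarith) (by linarith)
        have g2 : 0 < h' * (δ * φ r) := by have := hφpos r; positivity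
        nlinarith [f4.2]
    rcases hrt.eq_or_lt with h | h
    · rw [← h]; exact hnr.le
    · exfalso
      have e1 := hright r ⟨hsr, h⟩ ((φ r - n r) / 2) (by linarith)
      have e2 : ∀ᶠ q in 𝓝[>] r, n r + (φ r - n r) / 2 < φ q :=
        eventually_nhdsWithin_of_eventually_nhds
          ((hφc.tendsto r).eventually (eventually_gt_nhds (by linarith)))
      have e3 : ∀ᶠ q in 𝓝[>] r, q < t :=
        eventually_nhdsWithin_of_eventually_nhds (eventually_lt_nhds h)
      have e4 := ((e1.and e2).and e3)
      rw [eventually_nhdsWithin_iff, Metric.eventually_nhds_iff] at e4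
      obtain ⟨ε, hε, e4⟩ := e4
      have hmem : r + ε / 2 ∈ F ∨ ∃ p, r < p ∧ p ≤ r + ε / 2 ∧ t ≤ p := by
        by_contra! hcon
        refine hcon.1 ⟨⟨by linarith, (hcon.2 _ (by linarith) le_rfl).le⟩, fun p hp => ?_⟩
        rcases lt_trichotomy p r with hpr | hpr | hpr
        · exact hlt p hp.1 hpr
        · rw [hpr]; exact hnr.le
        · have := e4 (y := p) (by
            rw [Real.dist_eq, abs_of_pos (by linarith)]; linarith [hp.2]) hpr
          linarith [this.1.1, this.1.2]
      rcases hmem with hm | ⟨p, hp1, hp2, hp3⟩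
      · have := le_csSup hbdd hm
        linarith
      · have := e4 (y := p) (by
            rw [Real.dist_eq, abs_of_pos (by linarith)]; linarith) hp1
        linarith [this.2]
  have hlim : Tendsto (fun δ => (c + δ) * Real.exp ((β + δ) * (t - s))) (𝓝[>] 0)
      (𝓝 ((c + 0) * Real.exp ((β + 0) * (t - s)))) :=
    ((by fun_prop : Continuous fun δ => (c + δ) * Real.exp ((β + δ) * (t - s))).tendsto
      0).mono_left nhdsWithin_le_nhds
  simp only [add_zero] at hlim
  exact ge_of_tendsto hlim (eventually_nhdsWithin_of_forall fun δ hδ => main δ hδ)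

/-! ### Time dependent seminorms adapted to stable resolvents. -/

section Seminorms

variable {X : Type*} [NormedAddCommGroup X] [NormedSpace ℂ X]

/-- Since `N` decreases, passing to a later seminorm never costs anything. To the left of `r`, `u (r
- h)` agrees with `u r - h • u' r` up to `o(h)`, so the implicit Euler inequality `hdiss` becomes
the left condition of the Gronwall lemma. -/
theorem seminorm_le_mul_exp_of_dissipative {N : ℝ → Seminorm ℂ X} {m : ℝ} (hN : Antitone N)
    (hm : 0 < m) (hNm : ∀ t x, N t x ≤ m * ‖x‖) {u u' : ℝ → X} {s t β : ℝ} (hst : s ≤ t)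
    (hu : ∀ r ∈ Set.Icc s t, HasDerivWithinAt u (u' r) (Set.Icc s t) r)
    (hdiss : ∀ r ∈ Set.Ioc s t, ∀ᶠ h in 𝓝[>] (0 : ℝ),
      N r (u r) ≤ N r (u r - h • u' r) + h * β * N r (u r)) :
    N t (u t) ≤ N s (u s) * Real.exp (β * (t - s)) := by
  refine le_mul_exp_of_left_dini (n := fun r => N r (u r)) hst le_rfl (apply_nonneg _ _) ?_ ?_
  · intro r hr ε hε
    have hc : ContinuousWithinAt u (Set.Ioc r t) r :=
      (hu r ⟨hr.1, hr.2.le⟩).continuousWithinAt.mono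
        fun q hq => ⟨hr.1.trans hq.1.le, hq.2⟩
    have h1 : Tendsto (fun q => m * ‖u q - u r‖) (𝓝[>] r) (𝓝 0) := by
      rw [← nhdsWithin_Ioc_eq_nhdsGT hr.2]
      have := (hc.tendsto.sub_const (u r)).norm.const_mul m
      simpa using this
    filter_upwards [h1.eventually (eventually_le_nhds hε), self_mem_nhdsWithin] with q hq hrq
    have hrq : r < q := hrq
    calc N q (u q) ≤ N r (u q) := hN hrq.le (u q)
      _ = N r (u r + (u q - u r)) := by rw [add_sub_cancel]
      _ ≤ N r (u r) + N r (u q - u r) := map_add_le_add _ _ _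
      _ ≤ N r (u r) + ε := by gcongr; exact (hNm r _).trans hq
  · intro r hr ε hε
    have h1 := (hasDerivWithinAt_iff_isLittleO.mp (hu r ⟨hr.1.le, hr.2⟩)).def
      (show 0 < ε / m by positivity)
    have h2 : Tendsto (fun h : ℝ => r - h) (𝓝[>] 0) (𝓝[Set.Icc s t] r) := by
      refine tendsto_nhdsWithin_iff.mpr ⟨?_, ?_⟩
      · have : Tendsto (fun h : ℝ => r - h) (𝓝 0) (𝓝 (r - 0)) :=
          (continuous_const.sub continuous_id).tendsto 0
        rw [sub_zero] at this
        exact this.mono_left nhdsWithin_le_nhds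
      · filter_upwards [self_mem_nhdsWithin, eventually_nhdsWithin_of_eventually_nhds
          (eventually_lt_nhds (show (0 : ℝ) < r - s by linarith [hr.1]))] with h h3 h4
        have h3 : 0 < h := h3
        exact ⟨by linarith, by linarith [hr.2]⟩
    filter_upwards [h2.eventually h1, hdiss r hr, self_mem_nhdsWithin] with h h3 h4 h5
    have h5 : 0 < h := h5
    rw [sub_sub_cancel_left, norm_neg, Real.norm_of_nonneg h5.le] at h3
    have h6 : u r - h • u' r = u (r - h) - (u (r - h) - u r - (-h) • u' r) := by
      rw [neg_smul]; abel
    have h7 : N r (u r - h • u' r) ≤ N (r - h) (u (r - h)) + h * ε := by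
      rw [h6]
      refine (map_sub_le_add _ _ _).trans (add_le_add (hN (by linarith) _) ?_)
      refine (hNm r _).trans ((mul_le_mul_of_nonneg_left h3 hm.le).trans (le_of_eq ?_))
      field_simp
    linarith

/-- The product of the weighted operators `(l - b) R(l, t)` over a list of pairs `(t, l)`, the
first pair of the list acting first. -/
noncomputable def weightedProd (R : ℝ → ℝ → X →L[ℂ] X) (b : ℝ) (L : List (ℝ × ℝ)) : X →L[ℂ] X :=
  (L.map fun p => ((p.2 - b : ℝ) : ℂ) • R p.2 p.1).reverse.prod

/-- Kato's renorming: `N t x` is the supremum of `‖weightedProd R b L x‖` over ordered lists `L`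
with all times at least `t`. The empty list gives the lower bound, a later `t` admits fewer lists,
and prepending `(t, l)` to an admissible list keeps it admissible, which is the contraction
property. -/
theorem exists_stable_seminorms {R : ℝ → ℝ → X →L[ℂ] X} {b m : ℝ}
    (h : ∀ L : List (ℝ × ℝ), (L.Pairwise fun p q => p.1 ≤ q.1) → (∀ p ∈ L, b < p.2) →
      ‖weightedProd R b L‖ ≤ m) :
    ∃ N : ℝ → Seminorm ℂ X, Antitone N ∧ (∀ t x, ‖x‖ ≤ N t x) ∧ (∀ t x, N t x ≤ m * ‖x‖) ∧
      ∀ t l x, b < l → (l - b) * N t (R l t x) ≤ N t x := by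
  let I : ℝ → Type := fun t => {L : List (ℝ × ℝ) //
    (L.Pairwise fun p q => p.1 ≤ q.1) ∧ ∀ p ∈ L, b < p.2 ∧ t ≤ p.1}
  have hI : ∀ t, Nonempty (I t) := fun t => ⟨⟨[], by simp⟩⟩
  let q : ∀ t, I t → Seminorm ℂ X := fun t L =>
    (normSeminorm ℂ X).comp (weightedProd R b L.1).toLinearMap
  have hqa : ∀ t (L : I t) x, q t L x = ‖weightedProd R b L.1 x‖ := fun t L x => rfl
  have hq : ∀ t (L : I t) x, q t L x ≤ m * ‖x‖ := fun t L x =>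
    (weightedProd R b L.1).le_of_opNorm_le (h L.1 L.2.1 fun p hp => (L.2.2 p hp).1) x
  have hb : ∀ t x, BddAbove (Set.range fun L : I t => q t L x) := fun t x =>
    ⟨m * ‖x‖, by rintro _ ⟨L, rfl⟩; exact hq t L x⟩
  have hb' : ∀ t, BddAbove (Set.range (q t)) := fun t =>
    Seminorm.bddAbove_range_iff.mpr (hb t)
  have hN : ∀ t x, (⨆ L : I t, q t L) x = ⨆ L : I t, q t L x := fun t x =>
    Seminorm.iSup_apply (hb' t)
  refine ⟨fun t => ⨆ L : I t, q t L, ?_, ?_, ?_, ?_⟩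
  · intro t t' htt' x
    simp only [hN]
    have := hI t'
    refine ciSup_le fun L => ?_
    exact le_ciSup (hb t x) (⟨L.1, L.2.1, fun p hp => ⟨(L.2.2 p hp).1,
      htt'.trans (L.2.2 p hp).2⟩⟩ : I t)
  · intro t x
    simp only [hN]
    have := le_ciSup (hb t x) (⟨[], by simp⟩ : I t)
    simpa [hqa, weightedProd] using this
  · intro t x
    simp only [hN]
    have := hI t
    exact ciSup_le fun L => hq t L x
  · intro t l x hl
    have h1 : (l - b) * (⨆ L : I t, q t L) (R l t x) =
        (⨆ L : I t, q t L) (((l - b : ℝ) : ℂ) • R l t x) := by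
      rw [map_smul_eq_mul, Complex.norm_real, Real.norm_of_nonneg (by linarith)]
    change (l - b) * (⨆ L : I t, q t L) (R l t x) ≤ (⨆ L : I t, q t L) x
    rw [h1, hN, hN]
    have := hI t
    refine ciSup_le fun L => ?_
    have := le_ciSup (hb t x) (⟨(t, l) :: L.1, by
        refine ⟨List.pairwise_cons.mpr ⟨fun p hp => (L.2.2 p hp).2, L.2.1⟩, ?_⟩
        intro p hp
        rcases List.mem_cons.mp hp with rfl | hp
        · exact ⟨hl, le_rfl⟩
        · exact L.2.2 p hp⟩ : I t)
    refine le_trans (le_of_eq ?_) this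
    simp [hqa, weightedProd]

end Seminorms

/-! ### Duhamel's formula with a measurable inhomogeneity. -/

section Duhamel

variable {X : Type*} [NormedAddCommGroup X] [NormedSpace ℂ X]

/-- A product rule for strongly differentiable families: `F` is differentiated only at the vector `v
r`, and a local bound absorbs the error in `v`. -/
theorem hasDerivAt_clm_apply_of_bound {F : ℝ → X →L[ℂ] X} {C r : ℝ} {v : ℝ → X} {z v' : X}
    (hC : ∀ᶠ q in 𝓝 r, ‖F q‖ ≤ C) (hF : HasDerivAt (fun q => F q (v r)) z r)
    (hFc : Tendsto (fun q => F q v') (𝓝 r) (𝓝 (F r v'))) (hv : HasDerivAt v v' r) :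
    HasDerivAt (fun q => F q (v q)) (z + F r v') r := by
  rw [hasDerivAt_iff_tendsto_slope] at hF hv ⊢
  have h1 : Tendsto (fun q => F q (slope v r q - v')) (𝓝[≠] r) (𝓝 0) := by
    refine squeeze_zero_norm' (a := fun q => C * ‖slope v r q - v'‖) ?_ ?_
    · exact (hC.filter_mono nhdsWithin_le_nhds).mono fun q hq => (F q).le_of_opNorm_le hq _
    · simpa using (hv.sub_const v').norm.const_mul C
  have h2 := (hF.add h1).add (hFc.mono_left nhdsWithin_le_nhds)
  rw [add_zero] at h2
  refine h2.congr fun q => ?_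
  simp only [slope_def_module, map_sub, ContinuousLinearMap.map_smul_of_tower]
  rw [add_assoc, sub_add_cancel, ← smul_add]
  congr 1
  abel

variable {A : ℝ → X →L[ℂ] X} {K : ℝ}

theorem lipschitzOnWith_intervalIntegral {f : ℝ → X} {s t C : ℝ} (hC0 : 0 ≤ C)
    (hf : AEStronglyMeasurable f volume) (hC : ∀ r ∈ Set.Icc s t, ‖f r‖ ≤ C) :
    LipschitzOnWith C.toNNReal (fun r => ∫ τ in s..r, f τ) (Set.Icc s t) := by
  have hint : ∀ r ∈ Set.Icc s t, IntervalIntegrable f volume s r := fun r hr =>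
    intervalIntegrable_of_norm_le hf fun q hq => hC q (by
      rw [Set.uIoc_of_le hr.1] at hq
      exact ⟨hq.1.le, hq.2.trans hr.2⟩)
  refine LipschitzOnWith.of_dist_le_mul fun r hr q hq => ?_
  rw [dist_eq_norm, Real.coe_toNNReal _ hC0,
    intervalIntegral.integral_interval_sub_left (hint r hr) (hint q hq), Real.dist_eq]
  refine intervalIntegral.norm_integral_le_of_norm_le_const fun p hp => hC p ?_
  have := Set.uIoc_subset_uIcc hp
  exact (Set.ordConnected_Icc.uIcc_subset hq hr) this

variable [CompleteSpace X]

/-- Formally `evo A t r (v r)` has derivative `evo A t r (p r)` in `r`. As `p` is only measurable,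
this holds almost everywhere; the difference of `evo A t r (v r)` and the primitive is Lipschitz,
hence absolutely continuous, and so constant. -/
theorem duhamel_formula (hA : ∀ x, Continuous fun r => A r x) (hK : ∀ t, ‖A t‖ ≤ K)
    {v p : ℝ → X} {s t C : ℝ} (hst : s ≤ t) (hv : Continuous v)
    (hp : AEStronglyMeasurable p volume) (hpC : ∀ r ∈ Set.Icc s t, ‖p r‖ ≤ C)
    (hvp : ∀ r ∈ Set.Icc s t, v r = v s + ∫ τ in s..r, ((-Complex.I) • A τ (v τ) + p τ)) :
    v t = evo A t s (v s) + ∫ r in s..t, evo A t r (p r) := by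
  have hK0 : 0 ≤ K := (norm_nonneg _).trans (hK 0)
  have hC0 : 0 ≤ C := (norm_nonneg _).trans (hpC s ⟨le_rfl, hst⟩)
  have hm : ∀ x, AEStronglyMeasurable (fun r => A r x) volume :=
    fun x => (hA x).aestronglyMeasurable
  obtain ⟨D, hD⟩ := isCompact_Icc.exists_bound_of_continuousOn
    (hv.continuousOn (s := Set.Icc s t))
  have hD0 : 0 ≤ D := (norm_nonneg _).trans (hD s ⟨le_rfl, hst⟩)
  set f : ℝ → X := fun τ => (-Complex.I) • A τ (v τ) + p τ with hf
  have hfm : AEStronglyMeasurable f volume :=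
    ((aestronglyMeasurable_clm_apply hm hv.aestronglyMeasurable).const_smul _).add hp
  have hfC : ∀ r ∈ Set.Icc s t, ‖f r‖ ≤ K * D + C := fun r hr => by
    refine (norm_add_le _ _).trans (add_le_add ?_ (hpC r hr))
    rw [norm_smul, norm_neg, Complex.norm_I, one_mul]
    exact (A r).le_of_opNorm_le_of_le (hK r) (hD r hr)
  have hfL := lipschitzOnWith_intervalIntegral (by positivity) hfm hfC
  have hfi : IntervalIntegrable f volume s t := intervalIntegrable_of_norm_le hfm fun q hq =>
    hfC q (by rw [Set.uIoc_of_le hst] at hq; exact ⟨hq.1.le, hq.2⟩)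
  set E := Real.exp (K * (t - s)) with hE
  have hevo : ∀ r ∈ Set.Icc s t, ∀ q ∈ Set.Icc s t, ‖evo A r q‖ ≤ E := by
    intro r hr q hq
    refine (norm_evo_le hm hK r q).trans (Real.exp_le_exp.mpr ?_)
    have : |r - q| ≤ t - s := abs_sub_le_iff.mpr ⟨by linarith [hr.2, hq.1], by linarith [hr.1, hq.2]⟩
    gcongr
  have hcr : ∀ x, Continuous fun r => evo A t r x := fun x =>
    (continuous_evo hA hK x).comp (Continuous.prodMk_right t)
  set k : ℝ → X := fun r => evo A t r (p r) with hk
  have hkm : AEStronglyMeasurable k volume :=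
    aestronglyMeasurable_clm_apply (fun x => (hcr x).aestronglyMeasurable) hp
  have hkC : ∀ r ∈ Set.Icc s t, ‖k r‖ ≤ E * C := fun r hr =>
    (evo A t r).le_of_opNorm_le_of_le (hevo t ⟨hst, le_rfl⟩ r hr) (hpC r hr)
  have hki : IntervalIntegrable k volume s t := intervalIntegrable_of_norm_le hkm fun q hq =>
    hkC q (by rw [Set.uIoc_of_le hst] at hq; exact ⟨hq.1.le, hq.2⟩)
  have hkL := lipschitzOnWith_intervalIntegral (by positivity) hkm hkC
  set g : ℝ → X := fun r => evo A t r (v r) with hg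
  have hgL : LipschitzOnWith (E * (K * D + C) + E * (K * (E * D))).toNNReal g (Set.Icc s t) := by
    refine LipschitzOnWith.of_dist_le_mul fun r hr q hq => ?_
    rw [Real.coe_toNNReal _ (by positivity), dist_eq_norm]
    -- The propagator law moves both values to the same operator `evo A t r`, so that no Lipschitz
    -- estimate for `evo` in its second argument is needed.
    have h1 : g r - g q = evo A t r (v r - v q) - evo A t r (evo A r q (v q) - v q) := by
      simp only [hg, map_sub, evo_comp hA hK]; abel
    have h2 : ‖v r - v q‖ ≤ (K * D + C) * dist r q := by
      have := hfL.dist_le_mul r hr q hq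
      rw [dist_eq_norm, Real.coe_toNNReal _ (by positivity)] at this
      rwa [hvp r hr, hvp q hq, add_sub_add_left_eq_sub]
    have h3 : ‖evo A r q (v q) - v q‖ ≤ K * (E * D) * dist r q := by
      refine (norm_evo_sub_one_le hm hK r q (v q)).trans ?_
      rw [Real.dist_eq]
      have : Real.exp (K * |r - q|) ≤ E := by
        have : |r - q| ≤ t - s :=
          abs_sub_le_iff.mpr ⟨by linarith [hr.2, hq.1], by linarith [hr.1, hq.2]⟩
        refine Real.exp_le_exp.mpr ?_
        gcongr
      have := hD q hq
      gcongr
    have h4 := (evo A t r).le_of_opNorm_le_of_le (hevo t ⟨hst, le_rfl⟩ r hr) h2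
    have h5 := (evo A t r).le_of_opNorm_le_of_le (hevo t ⟨hst, le_rfl⟩ r hr) h3
    rw [h1]
    refine (norm_sub_le _ _).trans ?_
    linarith
  have hae : ∀ᵐ r, r ∈ Set.uIcc s t →
      HasDerivAt (fun r => g r - ∫ τ in s..r, k τ) 0 r := by
    have hne : ∀ c : ℝ, ∀ᵐ r : ℝ, r ≠ c := fun c => by simp [ae_iff, measure_singleton]
    filter_upwards [hfi.ae_hasDerivAt_integral, hki.ae_hasDerivAt_integral, hne s, hne t] with
      r h1 h2 h3 h4 hr
    have hr' : r ∈ Set.Ioo s t := by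
      rw [Set.uIcc_of_le hst] at hr
      exact ⟨lt_of_le_of_ne hr.1 (Ne.symm h3), lt_of_le_of_ne hr.2 h4⟩
    have hnb : Set.Icc s t ∈ 𝓝 r := Icc_mem_nhds hr'.1 hr'.2
    have hvd : HasDerivAt v (f r) r := by
      refine ((h1 hr s Set.left_mem_uIcc).const_add (v s)).congr_of_eventuallyEq ?_
      filter_upwards [hnb] with q hq
      exact hvp q hq
    have hgd : HasDerivAt g _ r := hasDerivAt_clm_apply_of_bound (C := E)
      (Filter.mem_of_superset hnb fun q hq => hevo t ⟨hst, le_rfl⟩ q hq) (hasDerivAt_evo_right hA hK t r (v r))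
      ((hcr (f r)).tendsto r) hvd
    refine (hgd.sub (h2 hr s Set.left_mem_uIcc)).congr_deriv ?_
    simp only [hf, hk, map_add, map_smul]
    rw [neg_smul]
    abel
  have hac : AbsolutelyContinuousOnInterval (fun r => g r - ∫ τ in s..r, k τ) s t := by
    rw [← Set.uIcc_of_le hst] at hgL hkL
    exact hgL.absolutelyContinuousOnInterval.sub hkL.absolutelyContinuousOnInterval
  obtain ⟨c, hc⟩ := hac.const_of_ae_hasDerivAt_zero hae
  have h1 := hc s Set.left_mem_uIcc
  have h2 := hc t Set.right_mem_uIcc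
  simp only [hg, intervalIntegral.integral_same, sub_zero, evo_self hm hK,
    one_apply_eq_self] at h1 h2
  rw [h1, ← h2]
  abel

end Duhamel

/-! ### Strong convergence from a dense range and uniform bounds. -/

section Density

variable {X : Type*} [NormedAddCommGroup X] [NormedSpace ℂ X]

theorem exists_norm_sub_le_of_denseRange {X : Type*} [NormedAddCommGroup X] {Z : Type*} {S : Z → X} (hS : DenseRange S) (x : X)
    {ε : ℝ} (hε : 0 < ε) : ∃ z, ‖x - S z‖ < ε := by
  obtain ⟨z, hz⟩ := hS.exists_dist_lt x hε
  exact ⟨z, by rwa [dist_eq_norm] at hz⟩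

theorem norm_apply_sub_apply_lt_of_dense {Z : Type*} {S : Z → X} {F F' : X →L[ℂ] X} {C ε : ℝ}
    (hC0 : 0 ≤ C) (hF : ‖F‖ ≤ C) (hF' : ‖F'‖ ≤ C) {x : X} {z : Z}
    (hz : ‖x - S z‖ < ε / (4 * (C + 1))) (h : ‖F (S z) - F' (S z)‖ < ε / 2) :
    ‖F x - F' x‖ < ε := by
  have e : F x - F' x = F (x - S z) + (F (S z) - F' (S z)) - F' (x - S z) := by
    simp only [map_sub]; abel
  have h1 := F.le_of_opNorm_le_of_le hF hz.le
  have h2 := F'.le_of_opNorm_le_of_le hF' hz.le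
  have hε : 0 < ε := by
    have := (norm_nonneg _).trans_lt h
    linarith
  have h3 : C * (ε / (4 * (C + 1))) ≤ ε / 4 := by
    rw [mul_div_assoc', div_le_div_iff₀ (by positivity) (by positivity)]
    nlinarith
  rw [e]
  have := norm_sub_le (F (x - S z) + (F (S z) - F' (S z))) (F' (x - S z))
  have := norm_add_le (F (x - S z)) (F (S z) - F' (S z))
  linarith

theorem tendsto_clm_apply_of_dense {α Z : Type*} {l : Filter α} {S : Z → X}
    (hS : DenseRange S) {F : α → X →L[ℂ] X} {F₀ : X →L[ℂ] X} {C : ℝ} (hF : ∀ᶠ i in l, ‖F i‖ ≤ C)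
    (hF₀ : ‖F₀‖ ≤ C) (h : ∀ z, Tendsto (fun i => F i (S z)) l (𝓝 (F₀ (S z)))) (x : X) :
    Tendsto (fun i => F i x) l (𝓝 (F₀ x)) := by
  have hC0 : 0 ≤ C := (norm_nonneg _).trans hF₀
  rw [Metric.tendsto_nhds]
  intro ε hε
  obtain ⟨z, hz⟩ := exists_norm_sub_le_of_denseRange hS x
    (show 0 < ε / (4 * (C + 1)) by positivity)
  filter_upwards [hF, Metric.tendsto_nhds.mp (h z) (ε / 2) (by positivity)] with i h1 h2
  rw [dist_eq_norm] at h2 ⊢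
  exact norm_apply_sub_apply_lt_of_dense hC0 h1 hF₀ hz h2

theorem tendsto_clm_apply_apply {α : Type*} {l : Filter α} {F : α → X →L[ℂ] X}
    {F₀ : X →L[ℂ] X} {C : ℝ} (hF : ∀ᶠ i in l, ‖F i‖ ≤ C)
    (h : ∀ x, Tendsto (fun i => F i x) l (𝓝 (F₀ x))) {v : α → X} {v₀ : X}
    (hv : Tendsto v l (𝓝 v₀)) : Tendsto (fun i => F i (v i)) l (𝓝 (F₀ v₀)) := by
  have h1 : Tendsto (fun i => F i (v i - v₀)) l (𝓝 0) := by
    refine squeeze_zero_norm' (hF.mono fun i hi => (F i).le_of_opNorm_le hi _) ?_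
    simpa using (hv.sub_const v₀).norm.const_mul C
  have h2 := h1.add (h v₀)
  simpa using h2

end Density

/-- On the range of `S` the difference of two resolvents contains the difference of the `a`'s at a
fixed vector, which is small; the uniform bound and density do the rest. -/
theorem continuous_resolvent_apply {X : Type*} [NormedAddCommGroup X] [NormedSpace ℂ X]
    {R Rh a : ℝ → X →L[ℂ] X} {S : X →L[ℂ] X} {C : ℝ} (hR : ∀ t, ‖R t‖ ≤ C) (hS : DenseRange S)
    (ha : Continuous a)
    (h : ∀ t s x, R t (S x) - R s (S x) = R t (a t (Rh s x) - a s (Rh s x))) (x : X) :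
    Continuous fun t => R t x := by
  rw [continuous_iff_continuousAt]
  intro t₀
  refine tendsto_clm_apply_of_dense hS (Eventually.of_forall hR) (hR t₀) (fun z => ?_) x
  rw [tendsto_iff_norm_sub_tendsto_zero]
  simp only [h]
  refine squeeze_zero (fun t => norm_nonneg _) (fun t => (R t).le_of_opNorm_le (hR t) _) ?_
  have hc : Continuous fun t => a t (Rh t₀ z) := ha.clm_apply continuous_const
  simpa using ((hc.tendsto t₀).sub_const (a t₀ (Rh t₀ z))).norm.const_mul C

/-- A quasi-stable family of resolvents `R l t`, together with a bounded injection-like operator `S`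
intertwining it with the resolvents `Rh l t` of a bounded perturbation.  The operator `a t` is the
generator composed with `S`, and `B t` is the perturbation. -/
structure KatoSystem (X : Type*) [NormedAddCommGroup X] [NormedSpace ℂ X] where
  /-- time dependent seminorms -/
  N : ℝ → Seminorm ℂ X
  /-- stability constant -/
  m : ℝ
  /-- growth rate -/
  b : ℝ
  /-- threshold of the spectral parameter -/
  L : ℝ
  /-- bound of the rescaled resolvents -/
  c : ℝ
  /-- bound of the perturbation -/
  K : ℝ
  /-- resolvents -/
  R : ℝ → ℝ → X →L[ℂ] X
  /-- resolvents of the perturbation -/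
  Rh : ℝ → ℝ → X →L[ℂ] X
  /-- intertwining operator -/
  S : X →L[ℂ] X
  /-- generator composed with the intertwining operator -/
  a : ℝ → X →L[ℂ] X
  /-- perturbation -/
  B : ℝ → X →L[ℂ] X
  one_le_m : 1 ≤ m
  b_nonneg : 0 ≤ b
  L_pos : 0 < L
  two_b_le : 2 * b ≤ L
  c_nonneg : 0 ≤ c
  N_anti : Antitone N
  norm_le_N : ∀ t x, ‖x‖ ≤ N t x
  N_le : ∀ t x, N t x ≤ m * ‖x‖
  N_R : ∀ l t x, L ≤ l → (l - b) * N t (R l t x) ≤ N t x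
  norm_R : ∀ l t, L ≤ l → ‖R l t‖ ≤ c / l
  norm_Rh : ∀ l t, L ≤ l → ‖Rh l t‖ ≤ c / l
  R_sub : ∀ l l' t x, L ≤ l → L ≤ l' →
    R l t x - R l' t x = ((l' - l : ℝ) : ℂ) • R l t (R l' t x)
  denseRange_S : DenseRange S
  a_cont : UniformContinuous a
  a_bdd : ∃ D, ∀ t, ‖a t‖ ≤ D
  -- With `A = -i G`, `a = A S` and `R = (l - A)⁻¹`, this is `R (l - A) S = S`.
  R_S_sub : ∀ l t x, L ≤ l → R l t ((l : ℂ) • S x - a t x) = S x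
  R_S : ∀ l t x, L ≤ l → R l t (S x) = S (Rh l t x)
  -- The commutator condition in resolvent form: `(l - A) S Rh = S` with `Rh = (l - A - B)⁻¹`.
  S_Rh_sub : ∀ l t x, L ≤ l → (l : ℂ) • S (Rh l t x) - a t (Rh l t x) = S x
  Rh_eq : ∀ l t x, L ≤ l → Rh l t x = R l t x + R l t (B t (Rh l t x))
  norm_B : ∀ t, ‖B t‖ ≤ K
  Rh_meas : ∀ l x, L ≤ l → AEStronglyMeasurable (fun t => Rh l t x) volume

/-! ### Yosida approximants and bounds uniform in the spectral parameter. -/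

namespace KatoSystem

variable {X : Type*} [NormedAddCommGroup X] [NormedSpace ℂ X] (Q : KatoSystem X) {l t s : ℝ}

/-- Yosida approximants. -/
noncomputable def Y (l t : ℝ) : X →L[ℂ] X := (-(Complex.I * (l : ℂ))) • (1 - (l : ℂ) • Q.R l t)

/-- Yosida approximants of the perturbed family. -/
noncomputable def Yh (l t : ℝ) : X →L[ℂ] X := (-(Complex.I * (l : ℂ))) • (1 - (l : ℂ) • Q.Rh l t)

/-- Evolution generated by the Yosida approximants. -/
noncomputable def U (l t s : ℝ) : X →L[ℂ] X := evo (Q.Y l) t s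

/-- Evolution generated by the Yosida approximants of the perturbed family. -/
noncomputable def Uh (l t s : ℝ) : X →L[ℂ] X := evo (Q.Yh l) t s

/-- Difference of the generators `-i Yh` and `-i Y`. -/
noncomputable def P (l t : ℝ) : X →L[ℂ] X := ((l : ℂ) ^ 2) • (Q.Rh l t - Q.R l t)

/-- Bound of the evolution on time intervals of length at most `T`. -/
noncomputable def M (T : ℝ) : ℝ := Q.m * Real.exp (2 * Q.b * T)

theorem pos_of_le (hl : Q.L ≤ l) : 0 < l := Q.L_pos.trans_le hl

theorem neg_I_Y (l t : ℝ) (x : X) :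
    (-Complex.I) • Q.Y l t x = (l : ℂ) • ((l : ℂ) • Q.R l t x - x) := by
  simp only [Y, FunLike.coe_smul, Pi.smul_apply, FunLike.coe_sub,
    Pi.sub_apply, one_apply_eq_self]
  rw [smul_smul]
  have : -Complex.I * -(Complex.I * (l : ℂ)) = -(l : ℂ) := by
    linear_combination (l : ℂ) * Complex.I_mul_I
  rw [this, neg_smul, ← smul_neg, neg_sub]

theorem neg_I_Yh (l t : ℝ) (x : X) :
    (-Complex.I) • Q.Yh l t x = (-Complex.I) • Q.Y l t x + Q.P l t x := by
  rw [neg_I_Y]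
  simp only [Yh, P, FunLike.coe_smul, Pi.smul_apply, FunLike.coe_sub,
    Pi.sub_apply, one_apply_eq_self]
  rw [smul_smul]
  have : -Complex.I * -(Complex.I * (l : ℂ)) = -(l : ℂ) := by
    linear_combination (l : ℂ) * Complex.I_mul_I
  rw [this]
  module

theorem norm_lR_le (hl : Q.L ≤ l) (t : ℝ) (x : X) : ‖(l : ℂ) • Q.R l t x‖ ≤ Q.c * ‖x‖ := by
  have hl0 := Q.pos_of_le hl
  rw [norm_smul, Complex.norm_real, Real.norm_of_nonneg hl0.le]
  have := (Q.R l t).le_of_opNorm_le (Q.norm_R l t hl) x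
  calc l * ‖Q.R l t x‖ ≤ l * (Q.c / l * ‖x‖) := by gcongr
    _ = Q.c * ‖x‖ := by field_simp

theorem norm_lRh_le (hl : Q.L ≤ l) (t : ℝ) (x : X) : ‖(l : ℂ) • Q.Rh l t x‖ ≤ Q.c * ‖x‖ := by
  have hl0 := Q.pos_of_le hl
  rw [norm_smul, Complex.norm_real, Real.norm_of_nonneg hl0.le]
  have := (Q.Rh l t).le_of_opNorm_le (Q.norm_Rh l t hl) x
  calc l * ‖Q.Rh l t x‖ ≤ l * (Q.c / l * ‖x‖) := by gcongr
    _ = Q.c * ‖x‖ := by field_simp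

theorem norm_Y_le (hl : Q.L ≤ l) (t : ℝ) : ‖Q.Y l t‖ ≤ l * (1 + Q.c) := by
  have hl0 := Q.pos_of_le hl
  have := Q.c_nonneg
  refine ContinuousLinearMap.opNorm_le_bound _ (by positivity) fun x => ?_
  simp only [Y, FunLike.coe_smul, Pi.smul_apply, FunLike.coe_sub,
    Pi.sub_apply, one_apply_eq_self]
  rw [norm_smul, norm_neg, norm_mul, Complex.norm_I, one_mul, Complex.norm_real,
    Real.norm_of_nonneg hl0.le, mul_assoc]
  gcongr
  refine (norm_sub_le _ _).trans ?_
  have := Q.norm_lR_le hl t x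
  linarith

theorem norm_Yh_le (hl : Q.L ≤ l) (t : ℝ) : ‖Q.Yh l t‖ ≤ l * (1 + Q.c) := by
  have hl0 := Q.pos_of_le hl
  have := Q.c_nonneg
  refine ContinuousLinearMap.opNorm_le_bound _ (by positivity) fun x => ?_
  simp only [Yh, FunLike.coe_smul, Pi.smul_apply, FunLike.coe_sub,
    Pi.sub_apply, one_apply_eq_self]
  rw [norm_smul, norm_neg, norm_mul, Complex.norm_I, one_mul, Complex.norm_real,
    Real.norm_of_nonneg hl0.le, mul_assoc]
  gcongr
  refine (norm_sub_le _ _).trans ?_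
  have := Q.norm_lRh_le hl t x
  linarith

/-- The second resolvent identity distributes the factor `l²` over the two resolvents. Hence `P`
stays bounded as `l → ∞`, although the available bounds on `Y` and `Yh` grow like `l`. -/
theorem P_apply (hl : Q.L ≤ l) (t : ℝ) (x : X) :
    Q.P l t x = (l : ℂ) • Q.R l t (Q.B t ((l : ℂ) • Q.Rh l t x)) := by
  simp only [P, FunLike.coe_smul, Pi.smul_apply, FunLike.coe_sub, Pi.sub_apply, map_smul]
  rw [sub_eq_iff_eq_add'.mpr (Q.Rh_eq l t x hl), smul_smul, pow_two]

theorem K_nonneg : 0 ≤ Q.K := (norm_nonneg _).trans (Q.norm_B 0)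

theorem norm_P_le (hl : Q.L ≤ l) (t : ℝ) : ‖Q.P l t‖ ≤ Q.c * (Q.K * Q.c) := by
  have := Q.c_nonneg
  have := Q.K_nonneg
  refine ContinuousLinearMap.opNorm_le_bound _ (by positivity) fun x => ?_
  rw [Q.P_apply hl]
  refine (Q.norm_lR_le hl _ _).trans ?_
  have := (Q.B t).le_of_opNorm_le_of_le (Q.norm_B t) (Q.norm_lRh_le hl t x)
  calc _ ≤ Q.c * (Q.K * (Q.c * ‖x‖)) := by gcongr
    _ = _ := by ring

theorem R_sub_R_S (hl : Q.L ≤ l) (t s : ℝ) (x : X) :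
    Q.R l t (Q.S x) - Q.R l s (Q.S x) = Q.R l t (Q.a t (Q.Rh l s x) - Q.a s (Q.Rh l s x)) := by
  have h1 := Q.R_S_sub l t (Q.Rh l s x) hl
  have h2 := Q.S_Rh_sub l s x hl
  rw [Q.R_S l s x hl, ← h1, ← map_sub, ← h2]
  congr 1
  abel

theorem a_continuous : Continuous Q.a := Q.a_cont.continuous

theorem R_continuous (hl : Q.L ≤ l) (x : X) : Continuous fun t => Q.R l t x :=
  continuous_resolvent_apply (fun t => Q.norm_R l t hl) Q.denseRange_S Q.a_continuous
    (fun t s x => Q.R_sub_R_S hl t s x) x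

theorem Y_continuous (hl : Q.L ≤ l) (x : X) : Continuous fun t => Q.Y l t x := by
  simp only [Y, FunLike.coe_smul, Pi.smul_apply, FunLike.coe_sub,
    Pi.sub_apply, one_apply_eq_self]
  exact (continuous_const.sub ((Q.R_continuous hl x).const_smul _)).const_smul _

theorem Y_meas (hl : Q.L ≤ l) (x : X) : AEStronglyMeasurable (fun t => Q.Y l t x) volume :=
  (Q.Y_continuous hl x).aestronglyMeasurable

theorem Yh_meas (hl : Q.L ≤ l) (x : X) : AEStronglyMeasurable (fun t => Q.Yh l t x) volume := by
  simp only [Yh, FunLike.coe_smul, Pi.smul_apply, FunLike.coe_sub,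
    Pi.sub_apply, one_apply_eq_self]
  exact (aestronglyMeasurable_const.sub ((Q.Rh_meas l x hl).const_smul _)).const_smul _

theorem P_meas (hl : Q.L ≤ l) (x : X) : AEStronglyMeasurable (fun t => Q.P l t x) volume := by
  simp only [P, FunLike.coe_smul, Pi.smul_apply, FunLike.coe_sub, Pi.sub_apply]
  exact ((Q.Rh_meas l x hl).sub (Q.R_continuous hl x).aestronglyMeasurable).const_smul _

theorem S_Yh (hl : Q.L ≤ l) (t : ℝ) (x : X) : Q.S (Q.Yh l t x) = Q.Y l t (Q.S x) := by
  simp only [Y, Yh, FunLike.coe_smul, Pi.smul_apply, FunLike.coe_sub,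
    Pi.sub_apply, one_apply_eq_self, map_smul, map_sub, Q.R_S l t x hl]

/-- A consequence of dissipativity in the seminorms `N r`. -/
theorem dissipative_Y (hl : Q.L ≤ l) (r h : ℝ) (hh : 0 ≤ h) (x : X) :
    Q.N r x ≤ Q.N r (x - h • ((-Complex.I) • Q.Y l r x)) + h * (2 * Q.b) * Q.N r x := by
  have hl0 := Q.pos_of_le hl
  have hb := Q.b_nonneg
  have hlb : 2 * Q.b ≤ l := Q.two_b_le.trans hl
  -- Here `-i Y x = l (l R x - x)`; moving the multiple of `x` to the left leaves only the
  -- resolvent, to which `N_R` applies.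
  have h1 : ((1 + h * l : ℝ) : ℂ) • x =
      (x - h • ((-Complex.I) • Q.Y l r x)) + ((h * l ^ 2 : ℝ) : ℂ) • Q.R l r x := by
    rw [neg_I_Y, ← Complex.coe_smul]
    push_cast
    module
  have h2 : (1 + h * l) * Q.N r x ≤
      Q.N r (x - h • ((-Complex.I) • Q.Y l r x)) + h * l ^ 2 * Q.N r (Q.R l r x) := by
    have := map_add_le_add (Q.N r) (x - h • ((-Complex.I) • Q.Y l r x))
      (((h * l ^ 2 : ℝ) : ℂ) • Q.R l r x)
    rwa [← h1, map_smul_eq_mul, map_smul_eq_mul, Complex.norm_real, Complex.norm_real,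
      Real.norm_of_nonneg (by positivity), Real.norm_of_nonneg (by positivity)] at this
  have h3 := Q.N_R l r x hl
  have h4 : 0 < l - Q.b := by linarith
  have h5 : l ^ 2 * Q.N r (Q.R l r x) ≤ (l + 2 * Q.b) * Q.N r x := by
    have h6 : l ^ 2 ≤ (l + 2 * Q.b) * (l - Q.b) := by nlinarith
    calc l ^ 2 * Q.N r (Q.R l r x) ≤ (l + 2 * Q.b) * (l - Q.b) * Q.N r (Q.R l r x) := by
          gcongr
      _ = (l + 2 * Q.b) * ((l - Q.b) * Q.N r (Q.R l r x)) := by ring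
      _ ≤ _ := by gcongr
  nlinarith [mul_le_mul_of_nonneg_left h5 hh]

theorem M_mono : Monotone Q.M := fun T T' h => by
  have := Q.one_le_m
  have := Q.b_nonneg
  unfold M
  gcongr

theorem M_pos (T : ℝ) : 0 < Q.M T := by
  have := Q.one_le_m
  unfold M
  positivity

variable [CompleteSpace X]

/-- The bound does not involve `l`: it comes from dissipativity in `N`, at the price of the growth
rate `2 * b` in place of `b`, and not from the norm of the generator. -/
theorem U_norm_le (hl : Q.L ≤ l) (hst : s ≤ t) : ‖Q.U l t s‖ ≤ Q.M (t - s) := by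
  have hm := Q.one_le_m
  refine ContinuousLinearMap.opNorm_le_bound _ (by unfold M; positivity) fun x => ?_
  have h := seminorm_le_mul_exp_of_dissipative Q.N_anti (by linarith) Q.N_le
    (u := fun r => Q.U l r s x) (u' := fun r => (-Complex.I) • Q.Y l r (Q.U l r s x))
    (β := 2 * Q.b) hst
    (fun r _ => (hasDerivAt_evo_left (Q.Y_continuous hl) (Q.norm_Y_le hl) r s x).hasDerivWithinAt)
    (fun r _ => eventually_nhdsWithin_of_forall fun h hh =>
      Q.dissipative_Y hl r h (le_of_lt hh) _)
  refine (Q.norm_le_N t _).trans (h.trans ?_)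
  rw [show Q.U l s s = 1 from evo_self (Q.Y_meas hl) (Q.norm_Y_le hl) s, one_apply_eq_self, M]
  have := Q.N_le s x
  calc _ ≤ Q.m * ‖x‖ * Real.exp (2 * Q.b * (t - s)) := by gcongr
    _ = _ := by ring

theorem U_norm_le_of_le {T : ℝ} (hl : Q.L ≤ l) (hst : s ≤ t) (htT : t - s ≤ T) :
    ‖Q.U l t s‖ ≤ Q.M T := (Q.U_norm_le hl hst).trans (Q.M_mono htT)

theorem S_Uh (hl : Q.L ≤ l) (t s : ℝ) (x : X) : Q.S (Q.Uh l t s x) = Q.U l t s (Q.S x) :=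
  evo_intertwine (Q.Y_meas hl) (Q.norm_Y_le hl) (Q.Yh_meas hl) (Q.norm_Yh_le hl)
    (Q.S_Yh hl) t s x

theorem Uh_eq (hl : Q.L ≤ l) (hst : s ≤ t) (x : X) :
    Q.Uh l t s x = Q.U l t s x + ∫ r in s..t, Q.U l t r (Q.P l r (Q.Uh l r s x)) := by
  have hc := continuous_evo_left (Q.Yh_meas hl) (Q.norm_Yh_le hl) s x
  obtain ⟨D, hD⟩ := isCompact_Icc.exists_bound_of_continuousOn
    (hc.continuousOn (s := Set.Icc s t))
  have h := duhamel_formula (Q.Y_continuous hl) (Q.norm_Y_le hl) (v := fun r => Q.Uh l r s x)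
    (p := fun r => Q.P l r (Q.Uh l r s x)) (C := Q.c * (Q.K * Q.c) * D) hst hc
    (aestronglyMeasurable_clm_apply (Q.P_meas hl) hc.aestronglyMeasurable)
    (fun r hr => (Q.P l r).le_of_opNorm_le_of_le (Q.norm_P_le hl r) (hD r hr))
    (fun r _ => by
      simp only [← neg_I_Yh]
      rw [show Q.Uh l s s = 1 from evo_self (Q.Yh_meas hl) (Q.norm_Yh_le hl) s]
      exact evo_apply_eq (Q.Yh_meas hl) (Q.norm_Yh_le hl) r s x)
  rwa [show Q.Uh l s s = 1 from evo_self (Q.Yh_meas hl) (Q.norm_Yh_le hl) s,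
    one_apply_eq_self] at h

end KatoSystem

/-! ### Perturbation series of the intertwined evolution. -/

namespace KatoSystem

variable {X : Type*} [NormedAddCommGroup X] [NormedSpace ℂ X] (Q : KatoSystem X) {l t s : ℝ}

/-- Bound of the perturbations `P l t`. -/
noncomputable def J : ℝ := Q.c * (Q.K * Q.c)

/-- Bound of the perturbed evolution on time intervals of length at most `T`. -/
noncomputable def Mh (T : ℝ) : ℝ := Q.M T * Real.exp (Q.M T * Q.J * T)

/-- The terms of the perturbation series of `Uh`. -/
noncomputable def pert (l s : ℝ) (x : X) : ℕ → ℝ → X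
  | 0, t => Q.U l t s x
  | n + 1, t => ∫ r in s..t, Q.U l t r (Q.P l r (pert l s x n r))

theorem J_nonneg : 0 ≤ Q.J := by
  have := Q.c_nonneg
  have := Q.K_nonneg
  unfold J
  positivity

theorem Mh_pos (T : ℝ) : 0 < Q.Mh T := mul_pos (Q.M_pos T) (Real.exp_pos _)

variable [CompleteSpace X]

theorem U_continuous (hl : Q.L ≤ l) (x : X) : Continuous fun p : ℝ × ℝ => Q.U l p.1 p.2 x :=
  continuous_evo (Q.Y_continuous hl) (Q.norm_Y_le hl) x

theorem U_comp (hl : Q.L ≤ l) (t r s : ℝ) (x : X) : Q.U l t r (Q.U l r s x) = Q.U l t s x :=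
  evo_comp (Q.Y_continuous hl) (Q.norm_Y_le hl) t r s x

theorem U_self (hl : Q.L ≤ l) (s : ℝ) : Q.U l s s = 1 := evo_self (Q.Y_meas hl) (Q.norm_Y_le hl) s

theorem Uh_continuous (hl : Q.L ≤ l) (s : ℝ) (x : X) : Continuous fun t => Q.Uh l t s x :=
  continuous_evo_left (Q.Yh_meas hl) (Q.norm_Yh_le hl) s x

theorem U_meas_right (hl : Q.L ≤ l) (t : ℝ) (x : X) :
    AEStronglyMeasurable (fun r => Q.U l t r x) volume :=
  ((Q.U_continuous hl x).comp (Continuous.prodMk_right t)).aestronglyMeasurable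

theorem U_P_meas (hl : Q.L ≤ l) (t : ℝ) {v : ℝ → X} (hv : AEStronglyMeasurable v volume) :
    AEStronglyMeasurable (fun r => Q.U l t r (Q.P l r (v r))) volume :=
  aestronglyMeasurable_clm_apply (Q.U_meas_right hl t)
    (aestronglyMeasurable_clm_apply (Q.P_meas hl) hv)

theorem intervalIntegrable_U_P (hl : Q.L ≤ l) (t u w : ℝ) {v : ℝ → X} (hv : Continuous v) :
    IntervalIntegrable (fun r => Q.U l t r (Q.P l r (v r))) volume u w := by
  have hb : Continuous fun r => Real.exp (l * (1 + Q.c) * |t - r|) * (Q.J * ‖v r‖) := by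
    fun_prop
  refine (hb.intervalIntegrable u w).mono_fun
    (Q.U_P_meas hl t hv.aestronglyMeasurable).restrict (Eventually.of_forall fun r => ?_)
  refine le_trans ?_ (le_abs_self _)
  refine (Q.U l t r).le_of_opNorm_le_of_le
    (norm_evo_le (Q.Y_meas hl) (Q.norm_Y_le hl) t r) ?_
  exact (Q.P l r).le_of_opNorm_le (Q.norm_P_le hl r) _

theorem pert_continuous (hl : Q.L ≤ l) (s : ℝ) (x : X) (n : ℕ) :
    Continuous (Q.pert l s x n) := by
  induction n with
  | zero => exact (Q.U_continuous hl x).comp (Continuous.prodMk_left s)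
  | succ n ih =>
    -- Factoring `U l t r` through time `s` takes `t` out of the integrand; this uses the backward
    -- evolution from `r` to `s`.
    have h1 : Q.pert l s x (n + 1) =
        fun t => Q.U l t s (∫ r in s..t, Q.U l s r (Q.P l r (Q.pert l s x n r))) := by
      funext t
      rw [← ContinuousLinearMap.intervalIntegral_comp_comm _
        (Q.intervalIntegrable_U_P hl s s t ih)]
      simp only [Q.U_comp hl]
      rfl
    have h2 : Continuous fun t => ∫ r in s..t, Q.U l s r (Q.P l r (Q.pert l s x n r)) :=
      intervalIntegral.continuous_primitive (fun u w => Q.intervalIntegrable_U_P hl s u w ih) s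
    rw [h1, continuous_iff_continuousAt]
    intro t₀
    refine tendsto_clm_apply_apply (C := Real.exp (l * (1 + Q.c) * (|t₀ - s| + 1))) ?_
      (fun z => ((Q.U_continuous hl z).comp (Continuous.prodMk_left s)).tendsto t₀)
      (h2.tendsto t₀)
    filter_upwards [Metric.ball_mem_nhds t₀ one_pos] with t ht
    refine (norm_evo_le (Q.Y_meas hl) (Q.norm_Y_le hl) t s).trans (Real.exp_le_exp.mpr ?_)
    have h3 : |t - s| ≤ |t₀ - s| + 1 := by
      have h1 : |t - t₀| < 1 := by simpa [Real.dist_eq] using ht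
      calc |t - s| = |(t - t₀) + (t₀ - s)| := by ring_nf
        _ ≤ |t - t₀| + |t₀ - s| := abs_add_le _ _
        _ ≤ _ := by linarith
    have := Q.c_nonneg
    have := Q.pos_of_le hl
    gcongr

theorem norm_integral_U_P_le {T D : ℝ} (hl : Q.L ≤ l) (hst : s ≤ t) (htT : t - s ≤ T) (n : ℕ)
    {v : ℝ → X} (hv : ∀ r ∈ Set.Icc s t, ‖v r‖ ≤ D * ((Q.M T * Q.J * (r - s)) ^ n / n.factorial)) :
    ‖∫ r in s..t, Q.U l t r (Q.P l r (v r))‖ ≤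
      D * ((Q.M T * Q.J * (t - s)) ^ (n + 1) / (n + 1).factorial) := by
  have hM := Q.M_pos T
  have hJ := Q.J_nonneg
  have h1 : ∀ r ∈ Set.Ioc s t, ‖Q.U l t r (Q.P l r (v r))‖ ≤
      (r - s) ^ n * (Q.M T * Q.J * D * ((Q.M T * Q.J) ^ n / n.factorial)) := by
    intro r hr
    have h2 := (Q.P l r).le_of_opNorm_le_of_le (Q.norm_P_le hl r) (hv r ⟨hr.1.le, hr.2⟩)
    refine ((Q.U l t r).le_of_opNorm_le_of_le (Q.U_norm_le_of_le hl hr.2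
      (by linarith [hr.1] : t - r ≤ T)) h2).trans (le_of_eq ?_)
    rw [mul_pow, show Q.c * (Q.K * Q.c) = Q.J from rfl]
    ring
  have h3 : IntervalIntegrable
      (fun r : ℝ => (r - s) ^ n * (Q.M T * Q.J * D * ((Q.M T * Q.J) ^ n / n.factorial)))
      volume s t := by
    apply Continuous.intervalIntegrable
    fun_prop
  refine (intervalIntegral.norm_integral_le_of_norm_le hst (Eventually.of_forall h1) h3).trans
    (le_of_eq ?_)
  rw [intervalIntegral.integral_mul_const, intervalIntegral.integral_comp_sub_right (fun x => x ^ n),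
    integral_pow, Nat.factorial_succ, sub_self, zero_pow (Nat.succ_ne_zero n), sub_zero, mul_pow (Q.M T * Q.J) (t - s) (n + 1)]
  push_cast
  have : (n.factorial : ℝ) ≠ 0 := by positivity
  have : (n + 1 : ℝ) ≠ 0 := by positivity
  field_simp
  ring

theorem norm_pert_le {T : ℝ} (hl : Q.L ≤ l) (x : X) (n : ℕ) (hst : s ≤ t) (htT : t - s ≤ T) :
    ‖Q.pert l s x n t‖ ≤ Q.M T * ‖x‖ * ((Q.M T * Q.J * (t - s)) ^ n / n.factorial) := by
  induction n generalizing t with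
  | zero =>
    simpa [pert] using (Q.U l t s).le_of_opNorm_le (Q.U_norm_le_of_le hl hst htT) x
  | succ n ih =>
    exact Q.norm_integral_U_P_le hl hst htT n fun r hr => ih hr.1 (by linarith [hr.2])

/-- Iterating Duhamel's formula on the remainder. The constant `D` may depend on `l`, so this only
identifies the sum of the series; the bounds uniform in `l` come from `norm_pert_le`. -/
theorem exists_norm_Uh_sub_sum_le {T : ℝ} (hl : Q.L ≤ l) (s : ℝ) (x : X) :
    ∃ D, ∀ n t, s ≤ t → t - s ≤ T → ‖Q.Uh l t s x - ∑ k ∈ Finset.range n, Q.pert l s x k t‖ ≤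
      D * ((Q.M T * Q.J * (t - s)) ^ n / n.factorial) := by
  obtain ⟨D, hD⟩ := isCompact_Icc.exists_bound_of_continuousOn
    ((Q.Uh_continuous hl s x).continuousOn (s := Set.Icc s (s + T)))
  refine ⟨D, fun n => ?_⟩
  induction n with
  | zero =>
    intro t hst htT
    simpa using hD t ⟨hst, by linarith⟩
  | succ n ih =>
    intro t hst htT
    have hc : Continuous fun r => Q.Uh l r s x - ∑ k ∈ Finset.range n, Q.pert l s x k r :=
      (Q.Uh_continuous hl s x).sub
        (continuous_finsetSum _ fun k _ => Q.pert_continuous hl s x k)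
    have h1 : Q.Uh l t s x - ∑ k ∈ Finset.range (n + 1), Q.pert l s x k t =
        ∫ r in s..t, Q.U l t r (Q.P l r
          (Q.Uh l r s x - ∑ k ∈ Finset.range n, Q.pert l s x k r)) := by
      simp only [map_sub, map_sum]
      rw [intervalIntegral.integral_sub
        (Q.intervalIntegrable_U_P hl t s t (Q.Uh_continuous hl s x)),
        intervalIntegral.integral_finsetSum, Finset.sum_range_succ', Q.Uh_eq hl hst]
      · simp only [pert]
        abel
      · exact fun k _ => Q.intervalIntegrable_U_P hl t s t (Q.pert_continuous hl s x k)
      · rw [← Finset.sum_fn]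
        exact IntervalIntegrable.sum _ fun k _ =>
          Q.intervalIntegrable_U_P hl t s t (Q.pert_continuous hl s x k)
    rw [h1]
    exact Q.norm_integral_U_P_le hl hst htT n fun r hr => ih r hr.1 (by linarith [hr.2])

theorem hasSum_pert (hl : Q.L ≤ l) (hst : s ≤ t) (x : X) :
    HasSum (fun n => Q.pert l s x n t) (Q.Uh l t s x) := by
  have hs : Summable fun n => Q.pert l s x n t :=
    Summable.of_norm_bounded ((Real.summable_pow_div_factorial _).mul_left _)
      fun n => Q.norm_pert_le hl x n hst le_rfl
  obtain ⟨D, hD⟩ := Q.exists_norm_Uh_sub_sum_le (T := t - s) hl s x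
  have h1 : Tendsto (fun n => ∑ k ∈ Finset.range n, Q.pert l s x k t) atTop
      (𝓝 (Q.Uh l t s x)) := by
    rw [tendsto_iff_norm_sub_tendsto_zero]
    refine squeeze_zero (g := fun n : ℕ =>
      D * ((Q.M (t - s) * Q.J * (t - s)) ^ n / n.factorial)) (fun n => norm_nonneg _)
      (fun n => by rw [norm_sub_rev]; exact hD n t hst le_rfl) ?_
    simpa using (FloorSemiring.tendsto_pow_div_factorial_atTop
      (Q.M (t - s) * Q.J * (t - s))).const_mul D
  rw [← tendsto_nhds_unique hs.hasSum.tendsto_sum_nat h1]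
  exact hs.hasSum

theorem Uh_norm_le {T : ℝ} (hl : Q.L ≤ l) (hst : s ≤ t) (htT : t - s ≤ T) :
    ‖Q.Uh l t s‖ ≤ Q.Mh T := by
  have hJ := Q.J_nonneg
  have hM := Q.M_pos T
  refine ContinuousLinearMap.opNorm_le_bound _ (Q.Mh_pos T).le fun x => ?_
  have h0 : HasSum (fun n : ℕ => (Q.M T * Q.J * T) ^ n / n.factorial)
      (Real.exp (Q.M T * Q.J * T)) := by
    rw [Real.exp_eq_exp_ℝ]
    exact NormedSpace.expSeries_div_hasSum_exp _
  have h := h0.mul_left (Q.M T * ‖x‖)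
  rw [← (Q.hasSum_pert hl hst x).tsum_eq]
  refine (tsum_of_norm_bounded h fun n => (Q.norm_pert_le hl x n hst htT).trans ?_).trans
    (le_of_eq (by unfold Mh; ring))
  have : 0 ≤ t - s := by linarith
  gcongr

end KatoSystem

/-! ### Frozen generators and the Cauchy estimate. -/

namespace KatoSystem

variable {X : Type*} [NormedAddCommGroup X] [NormedSpace ℂ X] (Q : KatoSystem X) {l t s : ℝ}

/-- The autonomous system obtained by freezing the time at `r`. -/
noncomputable def freeze (r : ℝ) : KatoSystem X where
  N _ := Q.N r
  m := Q.m
  b := Q.b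
  L := Q.L
  c := Q.c
  K := Q.K
  R l _ := Q.R l r
  Rh l _ := Q.Rh l r
  S := Q.S
  a _ := Q.a r
  B _ := Q.B r
  one_le_m := Q.one_le_m
  b_nonneg := Q.b_nonneg
  L_pos := Q.L_pos
  two_b_le := Q.two_b_le
  c_nonneg := Q.c_nonneg
  N_anti := antitone_const
  norm_le_N _ := Q.norm_le_N r
  N_le _ := Q.N_le r
  N_R l _ := Q.N_R l r
  norm_R l _ := Q.norm_R l r
  norm_Rh l _ := Q.norm_Rh l r
  R_sub l l' _ := Q.R_sub l l' r
  denseRange_S := Q.denseRange_S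
  a_cont := uniformContinuous_const
  a_bdd := Q.a_bdd.imp fun _ h _ => h r
  R_S_sub l _ := Q.R_S_sub l r
  R_S l _ := Q.R_S l r
  S_Rh_sub l _ := Q.S_Rh_sub l r
  Rh_eq l _ := Q.Rh_eq l r
  norm_B _ := Q.norm_B r
  Rh_meas _ _ _ := aestronglyMeasurable_const

theorem R_comm {l l' : ℝ} (hl : Q.L ≤ l) (hl' : Q.L ≤ l') (t : ℝ) (x : X) :
    Q.R l t (Q.R l' t x) = Q.R l' t (Q.R l t x) := by
  rcases eq_or_ne l l' with rfl | h
  · rfl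
  have h1 := Q.R_sub l l' t x hl hl'
  have h2 := Q.R_sub l' l t x hl' hl
  have h3 : ((l' - l : ℝ) : ℂ) ≠ 0 := by
    exact_mod_cast sub_ne_zero.mpr h.symm
  refine smul_right_injective X h3 ?_
  simp only
  rw [← h1, ← neg_sub, h2, ← neg_smul]
  congr 1
  push_cast
  ring

theorem Y_R_comm {l l' : ℝ} (hl : Q.L ≤ l) (hl' : Q.L ≤ l') (t : ℝ) (x : X) :
    Q.R l' t (Q.Y l t x) = Q.Y l t (Q.R l' t x) := by
  simp only [Y, FunLike.coe_smul, Pi.smul_apply, FunLike.coe_sub,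
    Pi.sub_apply, one_apply_eq_self, map_smul, map_sub, Q.R_comm hl hl']

theorem lR_S_sub (hl : Q.L ≤ l) (t : ℝ) (x : X) :
    (l : ℂ) • Q.R l t (Q.S x) - Q.S x = Q.R l t (Q.a t x) := by
  have h := Q.R_S_sub l t x hl
  rw [map_sub, map_smul] at h
  nth_rw 2 [← h]
  abel

theorem neg_I_Y_S (hl : Q.L ≤ l) (t : ℝ) (x : X) :
    (-Complex.I) • Q.Y l t (Q.S x) = (l : ℂ) • Q.R l t (Q.a t x) := by
  rw [neg_I_Y, Q.lR_S_sub hl]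

/-- The Yosida approximants converge with a rate on regularised vectors. -/
theorem norm_Y_regularised_le {k : ℝ} (hl : Q.L ≤ l) (hk : Q.L ≤ k) (t : ℝ) (x : X) :
    ‖(-Complex.I) • Q.Y l t ((k : ℂ) • Q.R k t (Q.S x)) - (k : ℂ) • Q.R k t (Q.a t x)‖ ≤
      k * (Q.c / l) * ((Q.c + 1) * ‖Q.a t x‖) := by
  have hk0 := Q.pos_of_le hk
  have e1 : (-Complex.I) • Q.Y l t ((k : ℂ) • Q.R k t (Q.S x)) =
      (k : ℂ) • (l : ℂ) • Q.R l t (Q.R k t (Q.a t x)) := by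
    rw [map_smul, smul_comm, ← Q.Y_R_comm hl hk, ← map_smul, Q.neg_I_Y_S hl, map_smul,
      Q.R_comm hk hl]
  have e2 : (k : ℂ) • (l : ℂ) • Q.R l t (Q.R k t (Q.a t x)) - (k : ℂ) • Q.R k t (Q.a t x) =
      (k : ℂ) • Q.R l t ((k : ℂ) • Q.R k t (Q.a t x) - Q.a t x) := by
    have h := Q.R_sub l k t (Q.a t x) hl hk
    rw [map_sub, map_smul, ← smul_sub]
    congr 1
    have h2 : Q.R k t (Q.a t x) =
        Q.R l t (Q.a t x) - ((k - l : ℝ) : ℂ) • Q.R l t (Q.R k t (Q.a t x)) := by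
      rw [← h]; abel
    nth_rw 2 [h2]
    push_cast
    module
  rw [e1, e2, norm_smul, Complex.norm_real, Real.norm_of_nonneg hk0.le, mul_assoc]
  refine mul_le_mul_of_nonneg_left ?_ hk0.le
  refine (Q.R l t).le_of_opNorm_le_of_le (Q.norm_R l t hl) ((norm_sub_le _ _).trans ?_)
  have := Q.norm_lR_le hk t (Q.a t x)
  linarith

theorem freeze_Y (r l t : ℝ) : (Q.freeze r).Y l t = Q.Y l r := rfl

variable [CompleteSpace X]

/-- The Hille–Yosida comparison: frozen approximants commute, so in Duhamel's formula the difference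
of the generators can be moved past the evolution onto `x`. -/
theorem freeze_sub_le {T : ℝ} {μ : ℝ} (r : ℝ) (hl : Q.L ≤ l) (hμ : Q.L ≤ μ) (hst : s ≤ t)
    (htT : t - s ≤ T) (x : X) :
    ‖(Q.freeze r).U μ t s x - (Q.freeze r).U l t s x‖ ≤
      Q.M T * (Q.M T * ‖(-Complex.I) • Q.Y μ r x - (-Complex.I) • Q.Y l r x‖) * (t - s) := by
  set F := Q.freeze r with hF
  have hFl : F.L ≤ l := hl
  have hFμ : F.L ≤ μ := hμ
  have hcomm : ∀ q x, Q.R l r (F.U μ q s x) = F.U μ q s (Q.R l r x) := fun q x =>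
    evo_intertwine (F.Y_meas hFμ) (F.norm_Y_le hFμ) (F.Y_meas hFμ) (F.norm_Y_le hFμ)
      (fun _ z => Q.Y_R_comm hμ hl r z) q s x
  have hcomm' : ∀ q x, Q.R μ r (F.U μ q s x) = F.U μ q s (Q.R μ r x) := fun q x =>
    evo_intertwine (F.Y_meas hFμ) (F.norm_Y_le hFμ) (F.Y_meas hFμ) (F.norm_Y_le hFμ)
      (fun _ z => Q.Y_R_comm hμ hμ r z) q s x
  have hc : Continuous fun q => F.U μ q s x :=
    (F.U_continuous hFμ x).comp (Continuous.prodMk_left s)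
  set z := (-Complex.I) • Q.Y μ r x - (-Complex.I) • Q.Y l r x with hz
  have hp : ∀ q, (-Complex.I) • F.Y μ q (F.U μ q s x) =
      (-Complex.I) • F.Y l q (F.U μ q s x) + F.U μ q s z := by
    intro q
    change (-Complex.I) • Q.Y μ r _ = (-Complex.I) • Q.Y l r _ + _
    rw [neg_I_Y, neg_I_Y, hcomm, hcomm', hz, neg_I_Y, neg_I_Y]
    simp only [map_sub, map_smul]
    abel
  have hpc : Continuous fun q => F.U μ q s z :=
    (F.U_continuous hFμ z).comp (Continuous.prodMk_left s)
  have hpb : ∀ q ∈ Set.Icc s t, ‖F.U μ q s z‖ ≤ Q.M T * ‖z‖ := fun q hq =>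
    (F.U μ q s).le_of_opNorm_le (F.U_norm_le_of_le hFμ hq.1 (by linarith [hq.2])) z
  have h := duhamel_formula (F.Y_continuous hFl) (F.norm_Y_le hFl) (v := fun q => F.U μ q s x)
    (p := fun q => F.U μ q s z) hst hc hpc.aestronglyMeasurable hpb (fun q _ => by
      simp only [← hp]
      rw [F.U_self hFμ]
      exact evo_apply_eq (F.Y_meas hFμ) (F.norm_Y_le hFμ) q s x)
  rw [F.U_self hFμ, one_apply_eq_self] at h
  rw [h, show evo (F.Y l) t s x = F.U l t s x from rfl, add_sub_cancel_left,
    ← abs_of_nonneg (sub_nonneg.mpr hst)]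
  refine intervalIntegral.norm_integral_le_of_norm_le_const fun q hq => ?_
  rw [Set.uIoc_of_le hst] at hq
  exact (F.U l t q).le_of_opNorm_le_of_le
    (F.U_norm_le_of_le hFl hq.2 (by linarith [hq.1])) (hpb q ⟨hq.1.le, hq.2⟩)

/-- The vector `S x` is replaced by `k R_k S x`, on which the Yosida approximants converge at rate
`1 / l`. The replacement costs a term of order `1 / k`, where `k` is independent of `l` and `μ`. -/
theorem freeze_sub_S_le {T k μ D : ℝ} (hD : ∀ t, ‖Q.a t‖ ≤ D) (r : ℝ) (hl : Q.L ≤ l)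
    (hμ : Q.L ≤ μ) (hk : Q.L ≤ k) (hst : s ≤ t) (htT : t - s ≤ T) (x : X) :
    ‖(Q.freeze r).U μ t s (Q.S x) - (Q.freeze r).U l t s (Q.S x)‖ ≤
      (Q.M T ^ 2 * k * Q.c * (Q.c + 1) * D * (1 / l + 1 / μ) * (t - s) +
        2 * Q.M T * Q.c * D / k) * ‖x‖ := by
  set F := Q.freeze r with hF
  have hM := Q.M_pos T
  have hk0 := Q.pos_of_le hk
  have hax : ‖Q.a r x‖ ≤ D * ‖x‖ := (Q.a r).le_of_opNorm_le (hD r) x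
  have hc := Q.c_nonneg
  set y := (k : ℂ) • Q.R k r (Q.S x) with hy
  have h1 : ‖y - Q.S x‖ ≤ Q.c / k * (D * ‖x‖) := by
    rw [hy, Q.lR_S_sub hk]
    exact (Q.R k r).le_of_opNorm_le_of_le (Q.norm_R k r hk) hax
  have h2 : ‖(-Complex.I) • Q.Y μ r y - (-Complex.I) • Q.Y l r y‖ ≤
      k * (Q.c / μ) * ((Q.c + 1) * (D * ‖x‖)) + k * (Q.c / l) * ((Q.c + 1) * (D * ‖x‖)) := by
    have e : (-Complex.I) • Q.Y μ r y - (-Complex.I) • Q.Y l r y =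
      ((-Complex.I) • Q.Y μ r y - (k : ℂ) • Q.R k r (Q.a r x)) -
        ((-Complex.I) • Q.Y l r y - (k : ℂ) • Q.R k r (Q.a r x)) := by abel
    have hl0 := Q.pos_of_le hl
    have hμ0 := Q.pos_of_le hμ
    rw [e]
    refine (norm_sub_le _ _).trans (add_le_add ?_ ?_)
    · refine (Q.norm_Y_regularised_le hμ hk r x).trans ?_
      gcongr
    · refine (Q.norm_Y_regularised_le hl hk r x).trans ?_
      gcongr
  have h3 := Q.freeze_sub_le r hl hμ hst htT y
  have h4 : ∀ ν, Q.L ≤ ν → ‖F.U ν t s (y - Q.S x)‖ ≤ Q.M T * (Q.c / k * (D * ‖x‖)) :=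
    fun ν hν => (F.U ν t s).le_of_opNorm_le_of_le (F.U_norm_le_of_le hν hst htT) h1
  have e : F.U μ t s (Q.S x) - F.U l t s (Q.S x) =
      (F.U μ t s y - F.U l t s y) - F.U μ t s (y - Q.S x) + F.U l t s (y - Q.S x) := by
    simp only [map_sub]; abel
  have h5 : Q.M T * (Q.M T * ‖(-Complex.I) • Q.Y μ r y - (-Complex.I) • Q.Y l r y‖) * (t - s) ≤
      Q.M T * (Q.M T * (k * (Q.c / μ) * ((Q.c + 1) * (D * ‖x‖)) +
        k * (Q.c / l) * ((Q.c + 1) * (D * ‖x‖)))) * (t - s) := by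
    have : 0 ≤ t - s := by linarith
    gcongr
  rw [e]
  calc _ ≤ _ := norm_add_le _ _
    _ ≤ _ := add_le_add (norm_sub_le _ _) le_rfl
    _ ≤ Q.M T * (Q.M T * (k * (Q.c / μ) * ((Q.c + 1) * (D * ‖x‖)) +
        k * (Q.c / l) * ((Q.c + 1) * (D * ‖x‖)))) * (t - s) + Q.M T * (Q.c / k * (D * ‖x‖)) +
        Q.M T * (Q.c / k * (D * ‖x‖)) :=
      add_le_add (add_le_add (h3.trans h5) (h4 μ hμ)) (h4 l hl)
    _ = _ := by ring

/-- Comparison with the frozen system on a short interval. -/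
theorem U_sub_freeze_le {T ω : ℝ} (hl : Q.L ≤ l) (hst : s ≤ t) (htT : t - s ≤ T)
    (hω : ∀ q ∈ Set.Icc s t, ‖Q.a q - Q.a s‖ ≤ ω) (x : X) :
    ‖Q.U l t s (Q.S x) - (Q.freeze s).U l t s (Q.S x)‖ ≤
      Q.M T * (Q.c ^ 2 * ω * Q.Mh T) * (t - s) * ‖x‖ := by
  set F := Q.freeze s with hF
  have hFl : F.L ≤ l := hl
  have hl0 := Q.pos_of_le hl
  have hc := Q.c_nonneg
  have hc1 : Continuous fun q => Q.U l q s (Q.S x) :=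
    (Q.U_continuous hl _).comp (Continuous.prodMk_left s)
  set p : ℝ → X := fun q => (-Complex.I) • Q.Y l q (Q.U l q s (Q.S x)) -
    (-Complex.I) • F.Y l q (Q.U l q s (Q.S x)) with hp
  have hpc : Continuous p :=
    ((continuous_clm_apply_of_bound (Q.Y_continuous hl) (Q.norm_Y_le hl) hc1).const_smul _).sub
      ((continuous_clm_apply_of_bound (F.Y_continuous hFl) (F.norm_Y_le hFl) hc1).const_smul _)
  have hpb : ∀ q ∈ Set.Icc s t, ‖p q‖ ≤ Q.c ^ 2 * ω * Q.Mh T * ‖x‖ := by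
    intro q hq
    -- Since `U S = S Uh`, the difference of the generators acts on the range of `S`, where
    -- `R_sub_R_S` absorbs the factor `l²` into two rescaled resolvents.
    have e : p q = (l : ℂ) • Q.R l q ((Q.a q - Q.a s) ((l : ℂ) • Q.Rh l s (Q.Uh l q s x))) := by
      simp only [hp, hF, freeze_Y, neg_I_Y, ← Q.S_Uh hl]
      rw [FunLike.coe_sub, Pi.sub_apply, map_smul, map_smul,
        ← smul_sub (l : ℂ) (Q.a q _) (Q.a s _), map_smul, ← Q.R_sub_R_S hl]
      module
    have h0 : 0 ≤ ω := (norm_nonneg _).trans (hω q hq)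
    have h1 := (Q.Uh l q s).le_of_opNorm_le
      (Q.Uh_norm_le (T := T) hl hq.1 (by linarith [hq.2])) x
    rw [e]
    refine (Q.norm_lR_le hl _ _).trans ?_
    have h2 := (Q.a q - Q.a s).le_of_opNorm_le_of_le (hω q hq)
      (Q.norm_lRh_le hl s (Q.Uh l q s x))
    calc _ ≤ Q.c * (ω * (Q.c * (Q.Mh T * ‖x‖))) := by
          refine mul_le_mul_of_nonneg_left (h2.trans ?_) hc
          gcongr
      _ = _ := by ring
  have h := duhamel_formula (F.Y_continuous hFl) (F.norm_Y_le hFl)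
    (v := fun q => Q.U l q s (Q.S x)) (p := p) hst hc1 hpc.aestronglyMeasurable hpb (fun q _ => by
      simp only [hp, add_sub_cancel]
      rw [Q.U_self hl]
      exact evo_apply_eq (Q.Y_meas hl) (Q.norm_Y_le hl) q s _)
  rw [Q.U_self hl, one_apply_eq_self] at h
  have h2 : ‖∫ r in s..t, F.U l t r (p r)‖ ≤
      Q.M T * (Q.c ^ 2 * ω * Q.Mh T * ‖x‖) * |t - s| :=
    intervalIntegral.norm_integral_le_of_norm_le_const fun q hq => by
      rw [Set.uIoc_of_le hst] at hq
      exact (F.U l t q).le_of_opNorm_le_of_le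
        (F.U_norm_le_of_le hFl hq.2 (by linarith [hq.1])) (hpb q ⟨hq.1.le, hq.2⟩)
  rw [h, show evo (F.Y l) t s (Q.S x) = F.U l t s (Q.S x) from rfl, add_sub_cancel_left]
  refine h2.trans (le_of_eq ?_)
  rw [abs_of_nonneg (sub_nonneg.mpr hst)]
  ring

theorem U_step_le {T ω k μ D h r : ℝ} (hD : ∀ t, ‖Q.a t‖ ≤ D) (hl : Q.L ≤ l) (hμ : Q.L ≤ μ)
    (hk : Q.L ≤ k) (hh : 0 ≤ h) (hhT : h ≤ T)
    (hω : ∀ q ∈ Set.Icc r (r + h), ‖Q.a q - Q.a r‖ ≤ ω) (z : X) :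
    ‖Q.U l (r + h) r (Q.S z) - Q.U μ (r + h) r (Q.S z)‖ ≤
      (2 * (Q.M T * (Q.c ^ 2 * ω * Q.Mh T) * h) +
        (Q.M T ^ 2 * k * Q.c * (Q.c + 1) * D * (1 / l + 1 / μ) * h +
          2 * Q.M T * Q.c * D / k)) * ‖z‖ := by
  have hr : r ≤ r + h := by linarith
  have hrT : r + h - r ≤ T := by linarith
  have h1 := Q.U_sub_freeze_le hl hr hrT hω z
  have h2 := Q.U_sub_freeze_le hμ hr hrT hω z
  have h3 := Q.freeze_sub_S_le (k := k) hD r hμ hl hk hr hrT z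
  have e : Q.U l (r + h) r (Q.S z) - Q.U μ (r + h) r (Q.S z) =
    (Q.U l (r + h) r (Q.S z) - (Q.freeze r).U l (r + h) r (Q.S z)) +
    ((Q.freeze r).U l (r + h) r (Q.S z) - (Q.freeze r).U μ (r + h) r (Q.S z)) -
    (Q.U μ (r + h) r (Q.S z) - (Q.freeze r).U μ (r + h) r (Q.S z)) := by abel
  rw [e]
  refine (norm_sub_le _ _).trans ?_
  have h4 := norm_add_le (Q.U l (r + h) r (Q.S z) - (Q.freeze r).U l (r + h) r (Q.S z))
    ((Q.freeze r).U l (r + h) r (Q.S z) - (Q.freeze r).U μ (r + h) r (Q.S z))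
  rw [add_sub_cancel_left] at h1 h2 h3
  rw [add_comm (1 / l)]
  linarith

/-- The partition points are passed one at a time from `U l` to `U μ`. Each intermediate vector is
`S` applied to `Uh μ (τ i) s x`, whose norm is controlled by `Mh`; this is where stability on `Y`
enters. -/
theorem U_telescope {T μ h σ : ℝ} {n : ℕ} (hl : Q.L ≤ l) (hμ : Q.L ≤ μ) (hh : 0 ≤ h)
    (hnh : n * h = t - s) (htT : t - s ≤ T) (hσ : 0 ≤ σ)
    (hstep : ∀ r z, ‖Q.U l (r + h) r (Q.S z) - Q.U μ (r + h) r (Q.S z)‖ ≤ σ * ‖z‖) (x : X) :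
    ‖Q.U l t s (Q.S x) - Q.U μ t s (Q.S x)‖ ≤ n * (σ * (Q.M T * Q.Mh T)) * ‖x‖ := by
  have hM := Q.M_pos T
  set τ : ℕ → ℝ := fun i => s + i * h with hτ
  have hτ0 : τ 0 = s := by simp [hτ]
  have hτn : τ n = t := by simp [hτ, hnh]
  have hτs : ∀ i, s ≤ τ i := fun i => by
    have : 0 ≤ (i : ℝ) * h := by positivity
    simp only [hτ]; linarith
  have hτ1 : ∀ i, τ (i + 1) = τ i + h := fun i => by simp only [hτ]; push_cast; ring
  have hτt : ∀ i ≤ n, τ i ≤ t := fun i hi => by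
    rw [← hτn]
    simp only [hτ]
    gcongr
  set f : ℕ → X := fun i => Q.U l t (τ i) (Q.U μ (τ i) s (Q.S x)) with hf
  have hd : ∀ i < n, dist (f i) (f (i + 1)) ≤ σ * (Q.M T * Q.Mh T) * ‖x‖ := by
    intro i hi
    have hi1 := hτt (i + 1) hi
    have h1 : f i - f (i + 1) = Q.U l t (τ (i + 1))
        (Q.U l (τ i + h) (τ i) (Q.S (Q.Uh μ (τ i) s x)) -
          Q.U μ (τ i + h) (τ i) (Q.S (Q.Uh μ (τ i) s x))) := by
      rw [Q.S_Uh hμ, ← hτ1, map_sub, Q.U_comp hl, Q.U_comp hμ]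
    have h2 := (Q.Uh μ (τ i) s).le_of_opNorm_le
      (Q.Uh_norm_le (T := T) hμ (hτs i) (by linarith [hτt i hi.le])) x
    rw [dist_eq_norm, h1]
    refine ((Q.U l t (τ (i + 1))).le_of_opNorm_le_of_le
      (Q.U_norm_le_of_le (T := T) hl hi1 (by linarith [hτs (i + 1)])) (hstep _ _)).trans ?_
    calc _ ≤ Q.M T * (σ * (Q.Mh T * ‖x‖)) := by gcongr
      _ = _ := by ring
  have h1 := dist_le_range_sum_of_dist_le (f := f) n
    (d := fun _ => σ * (Q.M T * Q.Mh T) * ‖x‖) (fun hk => hd _ hk)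
  rw [Finset.sum_const, Finset.card_range, nsmul_eq_mul, dist_eq_norm] at h1
  simp only [hf, hτ0, hτn, Q.U_self hl, Q.U_self hμ, one_apply_eq_self] at h1
  refine h1.trans (le_of_eq ?_)
  ring

/-- The approximating evolutions are Cauchy on the range of `S`, with uniform bounds. -/
theorem U_cauchy (T : ℝ) {ε : ℝ} (hε : 0 < ε) : ∃ Λ, Q.L ≤ Λ ∧ ∀ l μ, Λ ≤ l → Λ ≤ μ →
    ∀ s t, s ≤ t → t - s ≤ T → ∀ x,
      ‖Q.U l t s (Q.S x) - Q.U μ t s (Q.S x)‖ ≤ ε * ‖x‖ := by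
  obtain ⟨D, hD⟩ := Q.a_bdd
  have hD0 : 0 ≤ D := (norm_nonneg _).trans (hD 0)
  have hM := Q.M_pos T
  have hMh := Q.Mh_pos T
  have hc := Q.c_nonneg
  -- For negative `T` the claim is vacuous, but the constants below must still make sense.
  set T' := max T 0 with hT'
  have hT'0 : 0 ≤ T' := le_max_right _ _
  set Z := Q.M T * Q.Mh T with hZ
  have hZ0 : 0 < Z := by positivity
  -- The parameters are chosen in the order `ω`, `δ`, `n`, `k`, `Λ`, each depending on the earlier
  -- ones. Freezing, regularisation and the Yosida approximation then contribute `ε / 3` each. The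
  -- summand `1` keeps `C₁` positive.
  set C₁ := 2 * (Q.M T * (Q.c ^ 2 * Q.Mh T)) * T' * Z + 1 with hC₁
  have hC₁0 : 0 < C₁ := by positivity
  set ω := ε / (3 * C₁) with hω
  have hω0 : 0 < ω := by positivity
  obtain ⟨δ, hδ, hδa⟩ := Metric.uniformContinuous_iff.mp Q.a_cont ω hω0
  obtain ⟨n, hn⟩ := exists_nat_gt (T' / δ)
  have hn0 : (0 : ℝ) < n := lt_of_le_of_lt (by positivity) hn
  -- The regularisation error does not shrink with the step length, so it is multiplied by `n`; `k`
  -- is chosen afterwards to compensate.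
  set C₂ := 2 * n * Q.M T * Q.c * D * Z with hC₂
  have hC₂0 : 0 ≤ C₂ := by positivity
  obtain ⟨k, hkL, hkC⟩ : ∃ k, Q.L ≤ k ∧ C₂ / k ≤ ε / 3 := by
    refine ⟨max Q.L (3 * C₂ / ε), le_max_left _ _, ?_⟩
    have h1 : 3 * C₂ / ε ≤ max Q.L (3 * C₂ / ε) := le_max_right _ _
    rw [div_le_iff₀ hε] at h1
    rw [div_le_div_iff₀ (Q.L_pos.trans_le (le_max_left _ _)) (by norm_num)]
    linarith
  have hk0 := Q.pos_of_le hkL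
  set C₃ := Q.M T ^ 2 * k * Q.c * (Q.c + 1) * D * T' * Z with hC₃
  have hC₃0 : 0 ≤ C₃ := by positivity
  refine ⟨max Q.L (6 * C₃ / ε), le_max_left _ _, fun l μ hl hμ s t hst htT x => ?_⟩
  have hΛl : ∀ ν, max Q.L (6 * C₃ / ε) ≤ ν → C₃ * (1 / ν) ≤ ε / 6 := by
    intro ν hν
    have h1 : 6 * C₃ / ε ≤ ν := (le_max_right _ _).trans hν
    have h2 := Q.pos_of_le ((le_max_left _ _).trans hν)
    rw [div_le_iff₀ hε] at h1
    rw [mul_one_div, div_le_div_iff₀ h2 (by norm_num)]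
    linarith
  have hl' : Q.L ≤ l := (le_max_left _ _).trans hl
  have hμ' : Q.L ≤ μ := (le_max_left _ _).trans hμ
  have hl0 := Q.pos_of_le hl'
  have hμ0 := Q.pos_of_le hμ'
  have hts : 0 ≤ t - s := by linarith
  have htT' : t - s ≤ T' := htT.trans (le_max_left _ _)
  set h := (t - s) / n with hh
  have hh0 : 0 ≤ h := by positivity
  have hnh : n * h = t - s := by rw [hh]; field_simp
  have hhδ : h < δ := by
    rw [hh, div_lt_iff₀ hn0]
    rw [div_lt_iff₀ hδ] at hn
    linarith
  have hhT : h ≤ T := by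
    have : (1 : ℝ) ≤ n := by
      have : 0 < n := by exact_mod_cast hn0
      exact_mod_cast this
    nlinarith
  have h1 := Q.U_telescope (T := T) hl' hμ' hh0 hnh htT (by positivity)
    (fun r z => Q.U_step_le (r := r) (T := T) (ω := ω) (k := k) hD hl' hμ' hkL hh0 hhT
      (fun q hq => by
        have := hδa (a := q) (b := r) (by
          rw [Real.dist_eq, abs_of_nonneg (by linarith [hq.1])]; linarith [hq.2])
        rw [dist_eq_norm] at this
        exact this.le) z) x
  refine h1.trans (mul_le_mul_of_nonneg_right ?_ (norm_nonneg _))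
  rw [← hZ]
  have h2 : 2 * (Q.M T * (Q.c ^ 2 * Q.Mh T)) * (t - s) * Z * ω ≤ ε / 3 := by
    calc _ ≤ C₁ * ω := by
          refine mul_le_mul_of_nonneg_right ?_ hω0.le
          rw [hC₁]
          have : 2 * (Q.M T * (Q.c ^ 2 * Q.Mh T)) * (t - s) * Z ≤
            2 * (Q.M T * (Q.c ^ 2 * Q.Mh T)) * T' * Z := by gcongr
          linarith
      _ = ε / 3 := by rw [hω]; field_simp
  have h3 : Q.M T ^ 2 * k * Q.c * (Q.c + 1) * D * (t - s) * Z * (1 / l + 1 / μ) ≤ ε / 3 := by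
    calc _ ≤ C₃ * (1 / l + 1 / μ) := by
          refine mul_le_mul_of_nonneg_right ?_ (by positivity)
          rw [hC₃]
          gcongr
      _ ≤ ε / 3 := by
          have := hΛl l hl
          have := hΛl μ hμ
          linarith
  have e : n * ((2 * (Q.M T * (Q.c ^ 2 * ω * Q.Mh T) * h) +
      (Q.M T ^ 2 * k * Q.c * (Q.c + 1) * D * (1 / l + 1 / μ) * h + 2 * Q.M T * Q.c * D / k)) * Z) =
      2 * (Q.M T * (Q.c ^ 2 * Q.Mh T)) * (n * h) * Z * ω +
      Q.M T ^ 2 * k * Q.c * (Q.c + 1) * D * (n * h) * Z * (1 / l + 1 / μ) + C₂ / k := by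
    rw [hC₂]; ring
  rw [e, hnh]
  linarith

end KatoSystem

/-! ### Strong limits of operators and one-sided primitives. -/

section StrongLimits

variable {X : Type*} [NormedAddCommGroup X] [NormedSpace ℂ X]

open Classical in
/-- The strong limit of a family of bounded operators at infinity (`0` if there is none). -/
noncomputable def strongLimit (F : ℝ → X →L[ℂ] X) : X →L[ℂ] X :=
  if h : ∃ V : X →L[ℂ] X, ∀ x, Tendsto (fun l => F l x) atTop (𝓝 (V x)) then h.choose else 0

/-- Boundedness of the pointwise limit is the uniform boundedness principle. -/
theorem tendsto_strongLimit [CompleteSpace X] {F : ℝ → X →L[ℂ] X}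
    (hF : ∀ x, ∃ z, Tendsto (fun l => F l x) atTop (𝓝 z)) (x : X) :
    Tendsto (fun l => F l x) atTop (𝓝 (strongLimit F x)) := by
  choose f hf using hF
  have h : ∃ V : X →L[ℂ] X, ∀ x, Tendsto (fun l => F l x) atTop (𝓝 (V x)) :=
    ⟨continuousLinearMapOfTendsto F (f := f) (tendsto_pi_nhds.mpr hf), hf⟩
  unfold strongLimit
  rw [dif_pos h]
  exact h.choose_spec x

theorem strongLimit_eq {F : ℝ → X →L[ℂ] X} {V : X →L[ℂ] X}
    (hV : ∀ x, Tendsto (fun l => F l x) atTop (𝓝 (V x))) : strongLimit F = V := by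
  have h : ∃ V : X →L[ℂ] X, ∀ x, Tendsto (fun l => F l x) atTop (𝓝 (V x)) := ⟨V, hV⟩
  unfold strongLimit
  rw [dif_pos h]
  ext x
  exact tendsto_nhds_unique (h.choose_spec x) (hV x)

variable [CompleteSpace X]

theorem hasDerivWithinAt_integral_Ici {f : ℝ → X} {s t : ℝ} (hf : ContinuousOn f (Set.Ici s))
    (hst : s ≤ t) :
    HasDerivWithinAt (fun r => ∫ τ in s..r, f τ) (f t) (Set.Ici s) t := by
  -- Extending the integrand by its value at `s` reduces the one-sided claim to the usual
  -- fundamental theorem.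
  have hc : Continuous fun r => f (max r s) :=
    hf.comp_continuous (by fun_prop) fun r => le_max_right r s
  have h := (hc.integral_hasStrictDerivAt s t).hasDerivAt.hasDerivWithinAt (s := Set.Ici s)
  rw [max_eq_left hst] at h
  have e : ∀ r ∈ Set.Ici s, (∫ τ in s..r, f τ) = ∫ τ in s..r, f (max τ s) := fun r hr => by
    refine intervalIntegral.integral_congr fun τ hτ => ?_
    rw [Set.uIcc_of_le hr] at hτ
    rw [max_eq_left hτ.1]
  exact h.congr e (e t hst)

theorem hasDerivWithinAt_integral_Iic {f : ℝ → X} {s t : ℝ} (hf : ContinuousOn f (Set.Iic t))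
    (hst : s ≤ t) :
    HasDerivWithinAt (fun r => ∫ τ in r..t, f τ) (-f s) (Set.Iic t) s := by
  have hc : Continuous fun r => f (min r t) :=
    hf.comp_continuous (by fun_prop) fun r => min_le_right r t
  have h := (intervalIntegral.integral_hasDerivAt_left (hc.intervalIntegrable s t)
    (hc.stronglyMeasurableAtFilter _ _) hc.continuousAt).hasDerivWithinAt (s := Set.Iic t)
  rw [min_eq_left hst] at h
  have e : ∀ r ∈ Set.Iic t, (∫ τ in r..t, f τ) = ∫ τ in r..t, f (min τ t) := fun r hr => by
    refine intervalIntegral.integral_congr fun τ hτ => ?_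
    rw [Set.uIcc_of_le hr] at hτ
    rw [min_eq_left hτ.2]
  exact h.congr e (e s hst)

end StrongLimits

/-! ### The limit evolution and its integral equations. -/

namespace KatoSystem

variable {X : Type*} [NormedAddCommGroup X] [NormedSpace ℂ X] (Q : KatoSystem X) {l t s : ℝ}

theorem eventually_L_le : ∀ᶠ l in atTop, Q.L ≤ l := eventually_ge_atTop Q.L

theorem tendsto_c_div_mul (D : ℝ) : Tendsto (fun l : ℝ => Q.c / l * D) atTop (𝓝 0) := by
  simpa using (tendsto_const_nhds.div_atTop tendsto_id).mul_const D

theorem lR_tendsto (t : ℝ) (x : X) :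
    Tendsto (fun l : ℝ => (l : ℂ) • Q.R l t x) atTop (𝓝 x) := by
  have hc := Q.c_nonneg
  refine tendsto_clm_apply_of_dense (F := fun l : ℝ => (l : ℂ) • Q.R l t) (F₀ := 1)
    (C := Q.c + 1) Q.denseRange_S ?_ ?_ (fun z => ?_) x
  · filter_upwards [Q.eventually_L_le] with l hl
    refine (ContinuousLinearMap.opNorm_le_bound _ hc (Q.norm_lR_le hl t)).trans (by linarith)
  · exact ContinuousLinearMap.norm_id_le.trans (by linarith)
  · rw [tendsto_iff_norm_sub_tendsto_zero]
    refine squeeze_zero' (Eventually.of_forall fun l => norm_nonneg _) ?_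
      (Q.tendsto_c_div_mul ‖Q.a t z‖)
    filter_upwards [Q.eventually_L_le] with l hl
    have := Q.lR_S_sub hl t z
    rw [FunLike.coe_smul, Pi.smul_apply, one_apply_eq_self, this]
    exact (Q.R l t).le_of_opNorm_le (Q.norm_R l t hl) _

theorem lRh_tendsto (t : ℝ) (x : X) :
    Tendsto (fun l : ℝ => (l : ℂ) • Q.Rh l t x) atTop (𝓝 x) := by
  have hc := Q.c_nonneg
  have hK := Q.K_nonneg
  have h1 : Tendsto (fun l : ℝ => (l : ℂ) • Q.R l t (Q.B t (Q.Rh l t x))) atTop (𝓝 0) := by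
    refine squeeze_zero_norm' ?_ (by simpa using (Q.tendsto_c_div_mul ‖x‖).const_mul (Q.c * Q.K))
    filter_upwards [Q.eventually_L_le] with l hl
    refine (Q.norm_lR_le hl t _).trans ?_
    have h2 := (Q.B t).le_of_opNorm_le_of_le (Q.norm_B t)
      ((Q.Rh l t).le_of_opNorm_le (Q.norm_Rh l t hl) x)
    calc _ ≤ Q.c * (Q.K * (Q.c / l * ‖x‖)) := by gcongr
      _ = _ := by ring
  have h2 := (Q.lR_tendsto t x).add h1
  rw [add_zero] at h2
  refine h2.congr' ?_
  filter_upwards [Q.eventually_L_le] with l hl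
  rw [← smul_add, ← Q.Rh_eq l t x hl]

theorem P_tendsto (t : ℝ) (x : X) : Tendsto (fun l => Q.P l t x) atTop (𝓝 (Q.B t x)) := by
  have hc := Q.c_nonneg
  have h1 := ((Q.B t).continuous.tendsto _).comp (Q.lRh_tendsto t x)
  have h2 := tendsto_clm_apply_apply (F := fun l : ℝ => (l : ℂ) • Q.R l t) (F₀ := 1)
    (C := Q.c) (l := atTop) (by
      filter_upwards [Q.eventually_L_le] with l hl
      exact ContinuousLinearMap.opNorm_le_bound _ hc (Q.norm_lR_le hl t))
    (fun x => by simpa using Q.lR_tendsto t x) h1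
  rw [one_apply_eq_self] at h2
  refine h2.congr' ?_
  filter_upwards [Q.eventually_L_le] with l hl
  rw [Q.P_apply hl]
  rfl

variable [CompleteSpace X]

theorem U_cauchy_strong (T : ℝ) (x : X) {ε : ℝ} (hε : 0 < ε) : ∃ Λ, Q.L ≤ Λ ∧
    ∀ l μ, Λ ≤ l → Λ ≤ μ → ∀ s t, s ≤ t → t - s ≤ T → ‖Q.U l t s x - Q.U μ t s x‖ < ε := by
  have hM := Q.M_pos T
  obtain ⟨z, hz⟩ := exists_norm_sub_le_of_denseRange Q.denseRange_S x
    (show 0 < ε / (4 * (Q.M T + 1)) by positivity)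
  obtain ⟨Λ, hΛ, h⟩ := Q.U_cauchy T (show 0 < ε / (2 * (‖z‖ + 1)) by positivity)
  refine ⟨Λ, hΛ, fun l μ hl hμ s t hst htT => ?_⟩
  refine norm_apply_sub_apply_lt_of_dense hM.le (Q.U_norm_le_of_le (hΛ.trans hl) hst htT)
    (Q.U_norm_le_of_le (hΛ.trans hμ) hst htT) hz ((h l μ hl hμ s t hst htT z).trans_lt ?_)
  rw [div_mul_eq_mul_div, div_lt_div_iff₀ (by positivity) (by norm_num)]
  nlinarith

/-- The limit evolution. -/
noncomputable def V (t s : ℝ) : X →L[ℂ] X := strongLimit fun l => Q.U l t s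

theorem V_tendsto (hst : s ≤ t) (x : X) :
    Tendsto (fun l => Q.U l t s x) atTop (𝓝 (Q.V t s x)) := by
  refine tendsto_strongLimit (fun x => cauchySeq_tendsto_of_complete ?_) x
  rw [Metric.cauchySeq_iff]
  intro ε hε
  obtain ⟨Λ, -, h⟩ := Q.U_cauchy_strong (t - s) x hε
  exact ⟨Λ, fun l hl μ hμ => by rw [dist_eq_norm]; exact h l μ hl hμ s t hst le_rfl⟩

theorem V_norm_le {T : ℝ} (hst : s ≤ t) (htT : t - s ≤ T) : ‖Q.V t s‖ ≤ Q.M T := by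
  refine ContinuousLinearMap.opNorm_le_bound _ (Q.M_pos T).le fun x => ?_
  refine le_of_tendsto (Q.V_tendsto hst x).norm ?_
  filter_upwards [Q.eventually_L_le] with l hl
  exact (Q.U l t s).le_of_opNorm_le (Q.U_norm_le_of_le hl hst htT) x

theorem V_uniform (T : ℝ) (x : X) {ε : ℝ} (hε : 0 < ε) : ∃ Λ, Q.L ≤ Λ ∧
    ∀ l, Λ ≤ l → ∀ s t, s ≤ t → t - s ≤ T → ‖Q.V t s x - Q.U l t s x‖ ≤ ε := by
  obtain ⟨Λ, hΛ, h⟩ := Q.U_cauchy_strong T x hε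
  refine ⟨Λ, hΛ, fun l hl s t hst htT => ?_⟩
  refine le_of_tendsto ((Q.V_tendsto hst x).sub_const _).norm ?_
  filter_upwards [eventually_ge_atTop Λ] with μ hμ
  exact (h μ l hμ hl s t hst htT).le

theorem V_rate (T : ℝ) {ε : ℝ} (hε : 0 < ε) : ∃ Λ, Q.L ≤ Λ ∧
    ∀ l, Λ ≤ l → ∀ s t, s ≤ t → t - s ≤ T → ∀ x,
      ‖Q.U l t s (Q.S x) - Q.V t s (Q.S x)‖ ≤ ε * ‖x‖ := by
  obtain ⟨Λ, hΛ, h⟩ := Q.U_cauchy T hε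
  refine ⟨Λ, hΛ, fun l hl s t hst htT x => ?_⟩
  refine le_of_tendsto ((Q.V_tendsto hst _).const_sub _).norm ?_
  filter_upwards [eventually_ge_atTop Λ] with μ hμ
  exact h l μ hl hμ s t hst htT x

theorem V_self (s : ℝ) : Q.V s s = 1 := by
  refine strongLimit_eq fun x => ?_
  refine tendsto_const_nhds.congr' ?_
  filter_upwards [Q.eventually_L_le] with l hl
  rw [Q.U_self hl]

theorem V_comp {r : ℝ} (hsr : s ≤ r) (hrt : r ≤ t) : Q.V t s = Q.V t r * Q.V r s := by
  refine strongLimit_eq fun x => ?_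
  refine (tendsto_clm_apply_apply (C := Q.M (t - r)) (l := atTop) (by
    filter_upwards [Q.eventually_L_le] with l hl
    exact Q.U_norm_le hl hrt) (Q.V_tendsto hrt) (Q.V_tendsto hsr x)).congr' ?_
  filter_upwards [Q.eventually_L_le] with l hl
  exact Q.U_comp hl t r s x

theorem V_continuousOn (x : X) :
    ContinuousOn (fun p : ℝ × ℝ => Q.V p.1 p.2 x) {p | p.2 ≤ p.1} := by
  refine continuousOn_of_locally_uniform_approx_of_continuousWithinAt fun p _ u hu => ?_
  obtain ⟨ε, hε, hεu⟩ := Metric.mem_uniformity_dist.mp hu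
  obtain ⟨Λ, hΛ, h⟩ := Q.V_uniform (p.1 - p.2 + 1) x (half_pos hε)
  refine ⟨{q | q.2 ≤ q.1 ∧ q.1 - q.2 ≤ p.1 - p.2 + 1}, ?_, fun q => Q.U Λ q.1 q.2 x,
    (Q.U_continuous hΛ x).continuousWithinAt, fun q hq => hεu ?_⟩
  · have hc : Continuous fun q : ℝ × ℝ => q.1 - q.2 := by fun_prop
    filter_upwards [self_mem_nhdsWithin, nhdsWithin_le_nhds ((hc.tendsto p).eventually
      (eventually_lt_nhds (show p.1 - p.2 < p.1 - p.2 + 1 by linarith)))] with q h1 h2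
    exact ⟨h1, h2.le⟩
  · rw [dist_eq_norm]
    linarith [h Λ le_rfl q.2 q.1 hq.1 hq.2]

/-- The Cauchy estimate concerns `U`, not `Uh`. But each term of the perturbation series involves
only `U` and `P`, which converge strongly, so dominated convergence applies inductively. Uniform
factorial bounds then allow the limit of the whole series. -/
theorem pert_tendsto (s : ℝ) (x : X) (n : ℕ) :
    ∃ z : ℝ → X, ∀ t, s ≤ t → Tendsto (fun l => Q.pert l s x n t) atTop (𝓝 (z t)) := by
  induction n with
  | zero => exact ⟨fun t => Q.V t s x, fun t hst => Q.V_tendsto hst x⟩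
  | succ n ih =>
    obtain ⟨z, hz⟩ := ih
    refine ⟨fun t => ∫ r in s..t, Q.V t r (Q.B r (z r)), fun t hst => ?_⟩
    have hM := Q.M_pos (t - s)
    have hJ := Q.J_nonneg
    refine intervalIntegral.tendsto_integral_filter_of_dominated_convergence
      (fun r => Q.M (t - s) * (Q.J * (Q.M (t - s) * ‖x‖ *
        ((Q.M (t - s) * Q.J * (t - s)) ^ n / n.factorial)))) ?_ ?_ intervalIntegrable_const ?_
    · filter_upwards [Q.eventually_L_le] with l hl
      exact (Q.U_P_meas hl t (Q.pert_continuous hl s x n).aestronglyMeasurable).restrict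
    · filter_upwards [Q.eventually_L_le] with l hl
      refine Eventually.of_forall fun r hr => ?_
      rw [Set.uIoc_of_le hst] at hr
      have h1 := Q.norm_pert_le (T := t - s) hl x n hr.1.le (by linarith [hr.2])
      have h2 : (Q.M (t - s) * Q.J * (r - s)) ^ n ≤ (Q.M (t - s) * Q.J * (t - s)) ^ n := by
        have : 0 ≤ r - s := by linarith [hr.1]
        have := hr.2
        gcongr
      refine (Q.U l t r).le_of_opNorm_le_of_le
        (Q.U_norm_le_of_le (T := t - s) hl hr.2 (by linarith [hr.1]))
        ((Q.P l r).le_of_opNorm_le_of_le (Q.norm_P_le hl r) (h1.trans ?_))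
      gcongr
    · refine Eventually.of_forall fun r hr => ?_
      rw [Set.uIoc_of_le hst] at hr
      refine tendsto_clm_apply_apply (C := Q.M (t - r)) ?_ (Q.V_tendsto hr.2) ?_
      · filter_upwards [Q.eventually_L_le] with l hl
        exact Q.U_norm_le hl hr.2
      · refine tendsto_clm_apply_apply (C := Q.J) ?_ (Q.P_tendsto r) (hz r hr.1.le)
        filter_upwards [Q.eventually_L_le] with l hl
        exact Q.norm_P_le hl r

/-- The limit of the perturbed evolutions. -/
noncomputable def Vh (t s : ℝ) : X →L[ℂ] X := strongLimit fun l => Q.Uh l t s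

theorem Vh_tendsto (hst : s ≤ t) (x : X) :
    Tendsto (fun l => Q.Uh l t s x) atTop (𝓝 (Q.Vh t s x)) := by
  refine tendsto_strongLimit (fun x => ?_) x
  choose z hz using Q.pert_tendsto s x
  refine ⟨∑' n, z n t, ?_⟩
  have h := tendsto_tsum_of_dominated_convergence
    (f := fun l n => Q.pert l s x n t) (𝓕 := atTop)
    ((Real.summable_pow_div_factorial (Q.M (t - s) * Q.J * (t - s))).mul_left
      (Q.M (t - s) * ‖x‖)) (fun n => hz n t hst) (by
      filter_upwards [Q.eventually_L_le] with l hl n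
      exact Q.norm_pert_le hl x n hst le_rfl)
  refine h.congr' ?_
  filter_upwards [Q.eventually_L_le] with l hl
  exact (Q.hasSum_pert hl hst x).tsum_eq

theorem Vh_norm_le {T : ℝ} (hst : s ≤ t) (htT : t - s ≤ T) : ‖Q.Vh t s‖ ≤ Q.Mh T := by
  refine ContinuousLinearMap.opNorm_le_bound _ (Q.Mh_pos T).le fun x => ?_
  refine le_of_tendsto (Q.Vh_tendsto hst x).norm ?_
  filter_upwards [Q.eventually_L_le] with l hl
  exact (Q.Uh l t s).le_of_opNorm_le (Q.Uh_norm_le hl hst htT) x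

theorem S_Vh (hst : s ≤ t) (x : X) : Q.S (Q.Vh t s x) = Q.V t s (Q.S x) := by
  have h := (Q.S.continuous.tendsto _).comp (Q.Vh_tendsto hst x)
  refine tendsto_nhds_unique (h.congr' ?_) (Q.V_tendsto hst (Q.S x))
  filter_upwards [Q.eventually_L_le] with l hl
  exact Q.S_Uh hl t s x

theorem U_P_Uh_tendsto {r : ℝ} (hsr : s ≤ r) (hrt : r ≤ t) (x : X) :
    Tendsto (fun l => Q.U l t r (Q.P l r (Q.Uh l r s x))) atTop
      (𝓝 (Q.V t r (Q.B r (Q.Vh r s x)))) := by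
  refine tendsto_clm_apply_apply (C := Q.M (t - r)) ?_ (Q.V_tendsto hrt) ?_
  · filter_upwards [Q.eventually_L_le] with l hl
    exact Q.U_norm_le hl hrt
  · refine tendsto_clm_apply_apply (C := Q.J) ?_ (Q.P_tendsto r) (Q.Vh_tendsto hsr x)
    filter_upwards [Q.eventually_L_le] with l hl
    exact Q.norm_P_le hl r

theorem norm_V_B_Vh_le {r T : ℝ} (hsr : s ≤ r) (hrt : r ≤ t) (htT : t - s ≤ T) (x : X) :
    ‖Q.V t r (Q.B r (Q.Vh r s x))‖ ≤ Q.M T * (Q.K * (Q.Mh T * ‖x‖)) :=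
  (Q.V t r).le_of_opNorm_le_of_le (Q.V_norm_le hrt (by linarith))
    ((Q.B r).le_of_opNorm_le_of_le (Q.norm_B r)
      ((Q.Vh r s).le_of_opNorm_le (Q.Vh_norm_le hsr (by linarith)) x))

theorem V_B_Vh_meas (s t : ℝ) (x : X) :
    AEStronglyMeasurable (fun r => Q.V t r (Q.B r (Q.Vh r s x)))
      (volume.restrict (Set.Ioc s t)) := by
  have h0 : Tendsto (fun n : ℕ => Q.L + n) atTop atTop :=
    tendsto_atTop_add_const_left _ _ tendsto_natCast_atTop_atTop
  refine aestronglyMeasurable_of_tendsto_ae atTop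
    (f := fun (n : ℕ) r => Q.U (Q.L + n) t r (Q.P (Q.L + n) r (Q.Uh (Q.L + n) r s x)))
    (fun n => ?_) ?_
  · have hl : Q.L ≤ Q.L + n := by simp
    exact (Q.U_P_meas hl t (Q.Uh_continuous hl s x).aestronglyMeasurable).restrict
  · refine (ae_restrict_mem measurableSet_Ioc).mono fun r hr => ?_
    exact (Q.U_P_Uh_tendsto hr.1.le hr.2 x).comp h0

theorem Vh_eq (hst : s ≤ t) (x : X) :
    Q.Vh t s x = Q.V t s x + ∫ r in s..t, Q.V t r (Q.B r (Q.Vh r s x)) := by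
  have hM := Q.M_pos (t - s)
  have h1 : Tendsto (fun l => ∫ r in s..t, Q.U l t r (Q.P l r (Q.Uh l r s x))) atTop
      (𝓝 (∫ r in s..t, Q.V t r (Q.B r (Q.Vh r s x)))) := by
    refine intervalIntegral.tendsto_integral_filter_of_dominated_convergence
      (fun r => Q.M (t - s) * (Q.J * (Q.Mh (t - s) * ‖x‖))) ?_ ?_ intervalIntegrable_const ?_
    · filter_upwards [Q.eventually_L_le] with l hl
      exact (Q.U_P_meas hl t (Q.Uh_continuous hl s x).aestronglyMeasurable).restrict
    · filter_upwards [Q.eventually_L_le] with l hl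
      refine Eventually.of_forall fun r hr => ?_
      rw [Set.uIoc_of_le hst] at hr
      exact (Q.U l t r).le_of_opNorm_le_of_le
        (Q.U_norm_le_of_le (T := t - s) hl hr.2 (by linarith [hr.1]))
        ((Q.P l r).le_of_opNorm_le_of_le (Q.norm_P_le hl r)
          ((Q.Uh l r s).le_of_opNorm_le
            (Q.Uh_norm_le (T := t - s) hl hr.1.le (by linarith [hr.2])) x))
    · refine Eventually.of_forall fun r hr => ?_
      rw [Set.uIoc_of_le hst] at hr
      exact Q.U_P_Uh_tendsto hr.1.le hr.2 x
  refine tendsto_nhds_unique (Q.Vh_tendsto hst x) (((Q.V_tendsto hst x).add h1).congr' ?_)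
  filter_upwards [Q.eventually_L_le] with l hl
  exact (Q.Uh_eq hl hst x).symm

/-- Needed to differentiate the forward integral equation. Here `t` occurs both in the integrand and
as an endpoint; an indicator fixes the domain of integration, and the integrand is then continuous
at `t₀` for every `r ≠ t₀`. -/
theorem Vh_continuousOn (s : ℝ) (x : X) : ContinuousOn (fun t => Q.Vh t s x) (Set.Ici s) := by
  have hV : ∀ r z, ContinuousOn (fun t => Q.V t r z) (Set.Ici r) := fun r z =>
    (Q.V_continuousOn z).comp (f := fun t : ℝ => (t, r)) (by fun_prop) fun t ht => ht
  suffices h : ContinuousOn (fun t => ∫ r in s..t, Q.V t r (Q.B r (Q.Vh r s x))) (Set.Ici s) from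
    ((hV s x).add h).congr fun t ht => Q.Vh_eq ht x
  intro t₀ ht₀
  have ht₀ : s ≤ t₀ := ht₀
  set T := t₀ - s + 1 with hT
  set F : ℝ → ℝ → X := fun t => (Set.Ioc s t).indicator fun r => Q.V t r (Q.B r (Q.Vh r s x))
    with hF
  have hFmem : ∀ t r, r ∈ Set.Ioc s t → F t r = Q.V t r (Q.B r (Q.Vh r s x)) :=
    fun t r h => Set.indicator_of_mem h fun r => Q.V t r (Q.B r (Q.Vh r s x))
  have hFnot : ∀ t r, r ∉ Set.Ioc s t → F t r = 0 :=
    fun t r h => Set.indicator_of_notMem h fun r => Q.V t r (Q.B r (Q.Vh r s x))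
  have hev : ∀ᶠ t in 𝓝[Set.Ici s] t₀, s ≤ t ∧ t < s + T := by
    filter_upwards [self_mem_nhdsWithin, nhdsWithin_le_nhds (eventually_lt_nhds
      (show t₀ < s + T by linarith))] with t h1 h2
    exact ⟨h1, h2⟩
  have hsT : s ≤ s + T := by linarith
  have hint : ∀ t, s ≤ t ∧ t < s + T →
      (∫ r in s..t, Q.V t r (Q.B r (Q.Vh r s x))) = ∫ r in s..(s + T), F t r := by
    intro t ht
    rw [intervalIntegral.integral_of_le ht.1, intervalIntegral.integral_of_le hsT, hF,
      setIntegral_indicator measurableSet_Ioc,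
      Set.inter_eq_self_of_subset_right (Set.Ioc_subset_Ioc_right ht.2.le)]
  have key : ContinuousWithinAt (fun t => ∫ r in s..(s + T), F t r) (Set.Ici s) t₀ := by
    refine intervalIntegral.continuousWithinAt_of_dominated_interval
      (bound := fun _ => Q.M T * (Q.K * (Q.Mh T * ‖x‖))) ?_ ?_ intervalIntegrable_const ?_
    · filter_upwards with t
      rw [hF, aestronglyMeasurable_indicator_iff measurableSet_Ioc]
      exact (Q.V_B_Vh_meas s t x).mono_measure
        (Measure.restrict_mono le_rfl Measure.restrict_le_self)
    · filter_upwards [hev] with t ht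
      refine Eventually.of_forall fun r hr => ?_
      have hpos : 0 ≤ Q.M T * (Q.K * (Q.Mh T * ‖x‖)) := by
        have := Q.M_pos T
        have := Q.K_nonneg
        have := Q.Mh_pos T
        positivity
      by_cases h : r ∈ Set.Ioc s t
      · rw [hFmem t r h]
        exact Q.norm_V_B_Vh_le h.1.le h.2 (by linarith [ht.2]) x
      · rw [hFnot t r h, norm_zero]
        exact hpos
    · have hne : ∀ᵐ r : ℝ, r ≠ t₀ := by simp [ae_iff, measure_singleton]
      filter_upwards [hne] with r hr hrs
      rw [Set.uIoc_of_le hsT] at hrs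
      rcases lt_or_gt_of_ne hr with h | h
      · have h1 : ContinuousWithinAt (fun t => Q.V t r (Q.B r (Q.Vh r s x))) (Set.Ici s) t₀ :=
          ((hV r _).continuousAt (Ici_mem_nhds h)).continuousWithinAt
        refine h1.congr_of_eventuallyEq ?_ ?_
        · filter_upwards [nhdsWithin_le_nhds (eventually_gt_nhds h)] with t ht
          exact hFmem t r ⟨hrs.1, ht.le⟩
        · exact hFmem t₀ r ⟨hrs.1, h.le⟩
      · refine (continuousWithinAt_const (b := (0 : X))).congr_of_eventuallyEq ?_ ?_
        · filter_upwards [nhdsWithin_le_nhds (eventually_lt_nhds h)] with t ht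
          exact hFnot t r fun h' => absurd h'.2 (not_le.mpr ht)
        · exact hFnot t₀ r fun h' => absurd h'.2 (not_le.mpr h)
  refine key.congr_of_eventuallyEq ?_ (hint t₀ ⟨ht₀, by linarith⟩)
  filter_upwards [hev] with t ht
  exact hint t ht

/-- On the range of `S`, the generator term equals `l R (a (Uh x))`, which is bounded uniformly in
`l` and tends to `a (Vh x)`. -/
theorem V_S_forward_eq (hst : s ≤ t) (x : X) :
    Q.V t s (Q.S x) = Q.S x + ∫ r in s..t, Q.a r (Q.Vh r s x) := by
  obtain ⟨D, hD⟩ := Q.a_bdd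
  have hc := Q.c_nonneg
  have h1 : Tendsto (fun l : ℝ => ∫ r in s..t, (-Complex.I) • Q.Y l r (Q.U l r s (Q.S x))) atTop
      (𝓝 (∫ r in s..t, Q.a r (Q.Vh r s x))) := by
    refine intervalIntegral.tendsto_integral_filter_of_dominated_convergence
      (fun r => Q.c * (D * (Q.Mh (t - s) * ‖x‖))) ?_ ?_ intervalIntegrable_const ?_
    · filter_upwards [Q.eventually_L_le] with l hl
      exact ((continuous_clm_apply_of_bound (Q.Y_continuous hl) (Q.norm_Y_le hl)
        ((Q.U_continuous hl _).comp (Continuous.prodMk_left s))).const_smul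
          _).aestronglyMeasurable
    · filter_upwards [Q.eventually_L_le] with l hl
      refine Eventually.of_forall fun r hr => ?_
      rw [Set.uIoc_of_le hst] at hr
      rw [← Q.S_Uh hl, Q.neg_I_Y_S hl]
      refine (Q.norm_lR_le hl _ _).trans ?_
      have := (Q.a r).le_of_opNorm_le_of_le (hD r) ((Q.Uh l r s).le_of_opNorm_le
        (Q.Uh_norm_le (T := t - s) hl hr.1.le (by linarith [hr.2])) x)
      gcongr
    · refine Eventually.of_forall fun r hr => ?_
      rw [Set.uIoc_of_le hst] at hr
      have h2 := ((Q.a r).continuous.tendsto _).comp (Q.Vh_tendsto hr.1.le x)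
      have h3 := tendsto_clm_apply_apply (F := fun l : ℝ => (l : ℂ) • Q.R l r) (F₀ := 1)
        (C := Q.c) (l := atTop) (by
          filter_upwards [Q.eventually_L_le] with l hl
          exact ContinuousLinearMap.opNorm_le_bound _ hc (Q.norm_lR_le hl r))
        (fun x => by simpa using Q.lR_tendsto r x) h2
      rw [one_apply_eq_self] at h3
      refine h3.congr' ?_
      filter_upwards [Q.eventually_L_le] with l hl
      rw [← Q.S_Uh hl, Q.neg_I_Y_S hl]
      rfl
  refine tendsto_nhds_unique (Q.V_tendsto hst (Q.S x)) ((h1.const_add (Q.S x)).congr' ?_)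
  filter_upwards [Q.eventually_L_le] with l hl
  exact (evo_apply_eq (Q.Y_meas hl) (Q.norm_Y_le hl) t s (Q.S x)).symm

/-- Here the generator acts on the fixed vector `S x`, so only the convergence of `U` is needed and
not that of `Uh`. -/
theorem V_S_backward_eq (hst : s ≤ t) (x : X) :
    Q.V t s (Q.S x) = Q.S x + ∫ r in s..t, Q.V t r (Q.a r x) := by
  obtain ⟨D, hD⟩ := Q.a_bdd
  have hc := Q.c_nonneg
  have hcont : ∀ l, Q.L ≤ l → Continuous fun r => Q.U l t r ((-Complex.I) • Q.Y l r (Q.S x)) := by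
    intro l hl
    rw [continuous_iff_continuousAt]
    intro r₀
    refine tendsto_clm_apply_apply (C := Real.exp (l * (1 + Q.c) * (|t - r₀| + 1))) ?_
      (fun z => ((Q.U_continuous hl z).comp (Continuous.prodMk_right t)).tendsto r₀)
      (((Q.Y_continuous hl (Q.S x)).const_smul _).tendsto r₀)
    filter_upwards [Metric.ball_mem_nhds r₀ one_pos] with r hr
    refine (norm_evo_le (Q.Y_meas hl) (Q.norm_Y_le hl) t r).trans (Real.exp_le_exp.mpr ?_)
    have h3 : |t - r| ≤ |t - r₀| + 1 := by
      have h1 : |r - r₀| < 1 := by simpa [Real.dist_eq] using hr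
      calc |t - r| = |(t - r₀) + (r₀ - r)| := by ring_nf
        _ ≤ |t - r₀| + |r₀ - r| := abs_add_le _ _
        _ ≤ _ := by rw [abs_sub_comm r₀]; linarith
    have := Q.pos_of_le hl
    gcongr
  have h1 : Tendsto (fun l : ℝ => ∫ r in s..t, Q.U l t r ((-Complex.I) • Q.Y l r (Q.S x))) atTop
      (𝓝 (∫ r in s..t, Q.V t r (Q.a r x))) := by
    refine intervalIntegral.tendsto_integral_filter_of_dominated_convergence
      (fun r => Q.M (t - s) * (Q.c * (D * ‖x‖))) ?_ ?_ intervalIntegrable_const ?_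
    · filter_upwards [Q.eventually_L_le] with l hl
      exact (hcont l hl).aestronglyMeasurable
    · filter_upwards [Q.eventually_L_le] with l hl
      refine Eventually.of_forall fun r hr => ?_
      rw [Set.uIoc_of_le hst] at hr
      refine (Q.U l t r).le_of_opNorm_le_of_le
        (Q.U_norm_le_of_le (T := t - s) hl hr.2 (by linarith [hr.1])) ?_
      rw [Q.neg_I_Y_S hl]
      refine (Q.norm_lR_le hl _ _).trans ?_
      have := (Q.a r).le_of_opNorm_le (hD r) x
      gcongr
    · refine Eventually.of_forall fun r hr => ?_
      rw [Set.uIoc_of_le hst] at hr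
      refine tendsto_clm_apply_apply (C := Q.M (t - r)) ?_ (Q.V_tendsto hr.2) ?_
      · filter_upwards [Q.eventually_L_le] with l hl
        exact Q.U_norm_le hl hr.2
      · refine (Q.lR_tendsto r (Q.a r x)).congr' ?_
        filter_upwards [Q.eventually_L_le] with l hl
        rw [Q.neg_I_Y_S hl]
  refine tendsto_nhds_unique (Q.V_tendsto hst (Q.S x)) ((h1.const_add (Q.S x)).congr' ?_)
  filter_upwards [Q.eventually_L_le] with l hl
  have h2 := intervalIntegral.integral_eq_sub_of_hasDerivAt (a := s) (b := t)
    (f := fun r => -Q.U l t r (Q.S x))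
    (f' := fun r => Q.U l t r ((-Complex.I) • Q.Y l r (Q.S x)))
    (fun r _ => by
      refine (hasDerivAt_evo_right (Q.Y_continuous hl) (Q.norm_Y_le hl) t r
        (Q.S x)).neg.congr_deriv ?_
      rw [map_smul, neg_smul]
      rfl) ((hcont l hl).intervalIntegrable s t)
  rw [h2, Q.U_self hl, one_apply_eq_self]
  abel

theorem V_hasDerivWithinAt_left (hst : s ≤ t) (x : X) :
    HasDerivWithinAt (fun r => Q.V r s (Q.S x)) (Q.a t (Q.Vh t s x)) (Set.Ici s) t := by
  have hc : ContinuousOn (fun r => Q.a r (Q.Vh r s x)) (Set.Ici s) :=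
    Q.a_continuous.continuousOn.clm_apply (Q.Vh_continuousOn s x)
  exact ((hasDerivWithinAt_integral_Ici hc hst).const_add (Q.S x)).congr
    (fun r hr => Q.V_S_forward_eq hr x) (Q.V_S_forward_eq hst x)

theorem V_hasDerivWithinAt_right (hst : s ≤ t) (x : X) :
    HasDerivWithinAt (fun r => Q.V t r (Q.S x)) (-Q.V t s (Q.a s x)) (Set.Iic t) s := by
  have hc : ContinuousOn (fun r => Q.V t r (Q.a r x)) (Set.Iic t) := by
    intro r₀ hr₀
    refine tendsto_clm_apply_apply (C := Q.M (t - r₀ + 1)) ?_ (fun z => ?_)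
      ((Q.a_continuous.clm_apply continuous_const).tendsto r₀ |>.mono_left nhdsWithin_le_nhds)
    · filter_upwards [self_mem_nhdsWithin, nhdsWithin_le_nhds (eventually_gt_nhds
        (show r₀ - 1 < r₀ by linarith))] with r h1 h2
      exact Q.V_norm_le h1 (by linarith)
    · exact ((Q.V_continuousOn z).comp (f := fun r : ℝ => (t, r)) (s := Set.Iic t)
        (by fun_prop) fun r hr => hr) r₀ hr₀
  exact ((hasDerivWithinAt_integral_Iic hc hst).const_add (Q.S x)).congr
    (fun r hr => Q.V_S_backward_eq hr x) (Q.V_S_backward_eq hst x)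

end KatoSystem

/-! ### Uniqueness by dissipativity. -/

section Uniqueness

variable {X : Type*} [NormedAddCommGroup X] [NormedSpace ℂ X]

/-- A solution of the evolution equation with values in the domains vanishes if it does so
initially. -/
theorem KatoSystem.eq_zero_of_hasDerivWithinAt (Q : KatoSystem X) {s t : ℝ} (hst : s ≤ t)
    {v v' : ℝ → X}
    (hv : ∀ r ∈ Set.Icc s t, HasDerivWithinAt v (v' r) (Set.Icc s t) r)
    (hR : ∀ r ∈ Set.Icc s t, ∀ l, Q.L ≤ l → Q.R l r ((l : ℂ) • v r - v' r) = v r)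
    (h0 : v s = 0) : v t = 0 := by
  have hm := Q.one_le_m
  have h := seminorm_le_mul_exp_of_dissipative Q.N_anti (by linarith) Q.N_le (β := Q.b) hst hv ?_
  · rw [h0, map_zero, zero_mul] at h
    exact norm_le_zero_iff.mp ((Q.norm_le_N t _).trans h)
  · intro r hr
    have hL := Q.L_pos
    -- The spectral parameter is `h⁻¹`: then `v r - h • v' r` is `h` times a vector that the
    -- resolvent maps to `v r`, one step of the implicit Euler scheme.
    filter_upwards [Ioc_mem_nhdsGT (inv_pos.mpr hL)] with h hh
    have hh0 := hh.1
    have hl : Q.L ≤ h⁻¹ := by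
      rw [le_inv_comm₀ hL hh0]
      exact hh.2
    have h1 := Q.N_R h⁻¹ r (((h⁻¹ : ℝ) : ℂ) • v r - v' r) hl
    rw [hR r ⟨hr.1.le, hr.2⟩ _ hl] at h1
    have h2 : v r - h • v' r = (h : ℂ) • (((h⁻¹ : ℝ) : ℂ) • v r - v' r) := by
      rw [smul_sub, smul_smul, ← Complex.ofReal_mul, mul_inv_cancel₀ hh0.ne', Complex.ofReal_one,
        one_smul, Complex.coe_smul]
    rw [h2, map_smul_eq_mul, Complex.norm_real, Real.norm_of_nonneg hh0.le]
    have h3 := mul_le_mul_of_nonneg_left h1 hh0.le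
    have h4 : h * ((h⁻¹ - Q.b) * Q.N r (v r)) = Q.N r (v r) - h * Q.b * Q.N r (v r) := by
      field_simp
    linarith

end Uniqueness

/-! ### Resolvent identities, stability constants and bounded perturbations. -/

section Resolvents

variable {X : Type*} [NormedAddCommGroup X] [NormedSpace ℂ X]

theorem resolvent_identity {A : X →ₗ.[ℂ] X} {l l' : ℝ} {R R' : X →L[ℂ] X}
    (hR : IsShiftedInverse A l R) (hR' : IsShiftedInverse A l' R') (x : X) :
    R x - R' x = ((l' - l : ℝ) : ℂ) • R (R' x) := by
  obtain ⟨h, e⟩ := hR'.1 x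
  have h2 : R ((l : ℂ) • R' x + Complex.I • A ⟨R' x, h⟩) = R' x := hR.2 ⟨R' x, h⟩
  calc R x - R' x = R ((l' : ℂ) • R' x + Complex.I • A ⟨R' x, h⟩) -
        R ((l : ℂ) • R' x + Complex.I • A ⟨R' x, h⟩) := by rw [e, h2]
    _ = ((l' - l : ℝ) : ℂ) • R (R' x) := by
      rw [← map_sub, add_sub_add_right_eq_sub, map_sub, map_smul, map_smul, Complex.ofReal_sub,
        sub_smul]

theorem weightedProd_eq (R : ℝ → ℝ → X →L[ℂ] X) (b : ℝ) (L : List (ℝ × ℝ)) :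
    weightedProd R b L =
      ((L.map fun p => p.2 - b).prod : ℂ) • (L.map fun p => R p.2 p.1).reverse.prod := by
  induction L with
  | nil => simp [weightedProd]
  | cons p L ih =>
    have : weightedProd R b (p :: L) =
        weightedProd R b L * (((p.2 - b : ℝ) : ℂ) • R p.2 p.1) := by simp [weightedProd]
    rw [this, ih]
    simp only [smul_mul_smul_comm, List.map_cons, List.prod_cons, List.reverse_cons,
      List.prod_append, List.prod_nil, mul_one]
    rw [← Complex.ofReal_mul, mul_comm]

/-- Replacing `β₀` by its upper bound `b` only weakens the stability estimate, and the monotone time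
change `φ` keeps the products time-ordered. -/
theorem norm_weightedProd_le {G : ℝ → X →ₗ.[ℂ] X} {m b T : ℝ} {β₀ φ : ℝ → ℝ} (hm : 0 ≤ m)
    (hstab : ∀ (n : ℕ) (t l : Fin n → ℝ), Monotone t → (∀ j, 0 ≤ t j) →
      (∀ j, β₀ (t j) < l j) →
      ‖((List.ofFn fun j => shiftedResolvent (G (t j)) (l j)).reverse).prod‖ ≤
        m * ∏ j, 1 / (l j - β₀ (t j)))
    (hb : ∀ t ∈ Set.Icc 0 T, β₀ t ≤ b) (hφ : Monotone φ) (hφT : ∀ t, φ t ∈ Set.Icc 0 T)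
    (L : List (ℝ × ℝ)) (hL : L.Pairwise fun p q => p.1 ≤ q.1) (hLb : ∀ p ∈ L, b < p.2) :
    ‖weightedProd (fun l t => shiftedResolvent (G (φ t)) l) b L‖ ≤ m := by
  have hpos : ∀ j : Fin L.length, 0 < (L.get j).2 - b := fun j =>
    sub_pos.mpr (hLb _ (List.get_mem L j))
  have hle : ∀ j : Fin L.length, (L.get j).2 - b ≤ (L.get j).2 - β₀ (φ (L.get j).1) := fun j => by
    have := hb _ (hφT (L.get j).1)
    linarith
  have h1 := hstab L.length (fun j => φ (L.get j).1) (fun j => (L.get j).2)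
    (fun i j hij => hφ (by
      rcases hij.eq_or_lt with rfl | h
      · exact le_rfl
      · exact List.pairwise_iff_get.mp hL i j h))
    (fun j => (hφT _).1) (fun j => by linarith [hpos j, hle j])
  have e1 : (List.ofFn fun j : Fin L.length =>
      shiftedResolvent (G (φ (L.get j).1)) (L.get j).2) =
      L.map fun p => shiftedResolvent (G (φ p.1)) p.2 :=
    List.ofFn_getElem_eq_map L fun p => shiftedResolvent (G (φ p.1)) p.2
  have e2 : (L.map fun p => p.2 - b).prod = ∏ j : Fin L.length, ((L.get j).2 - b) := by
    rw [← List.prod_ofFn]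
    congr 1
    exact (List.ofFn_getElem_eq_map L fun p => p.2 - b).symm
  rw [e1] at h1
  rw [weightedProd_eq, norm_smul, Complex.norm_real, e2,
    Real.norm_of_nonneg (Finset.prod_nonneg fun j _ => (hpos j).le)]
  have hP : 0 < ∏ j : Fin L.length, ((L.get j).2 - b) := Finset.prod_pos fun j _ => hpos j
  calc _ ≤ (∏ j : Fin L.length, ((L.get j).2 - b)) *
        (m * ∏ j : Fin L.length, 1 / ((L.get j).2 - β₀ (φ (L.get j).1))) := by gcongr
    _ ≤ (∏ j : Fin L.length, ((L.get j).2 - b)) *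
        (m * ∏ j : Fin L.length, 1 / ((L.get j).2 - b)) := by
      gcongr with j
      · intro j _
        have := hpos j
        have := hle j
        exact one_div_nonneg.mpr (by linarith)
      · exact hpos j
      · exact hb _ (hφT _)
    _ = m := by
      rw [mul_left_comm, ← Finset.prod_mul_distrib, Finset.prod_congr rfl fun j _ =>
        mul_one_div_cancel (hpos j).ne']
      simp

variable [CompleteSpace X]

/-- The resolvent of the perturbation by `B` in terms of the resolvent `R`. -/
noncomputable def perturbedResolvent (R B : X →L[ℂ] X) : X →L[ℂ] X := (∑' n : ℕ, (R * B) ^ n) * R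

theorem perturbedResolvent_eq {R B : X →L[ℂ] X} (h : ‖R * B‖ < 1) (x : X) :
    perturbedResolvent R B x = R x + R (B (perturbedResolvent R B x)) := by
  have h1 := congrArg (fun D : X →L[ℂ] X => (D * R) x) (mul_neg_geom_series (R * B) h)
  simp only [one_mul, sub_mul, FunLike.coe_sub, Pi.sub_apply] at h1
  exact sub_eq_iff_eq_add.mp h1

theorem norm_perturbedResolvent_le {R B : X →L[ℂ] X} (h : ‖R * B‖ ≤ 1 / 2) :
    ‖perturbedResolvent R B‖ ≤ 2 * ‖R‖ := by
  refine ContinuousLinearMap.opNorm_le_bound _ (by positivity) fun x => ?_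
  have h1 := perturbedResolvent_eq (h.trans_lt (by norm_num)) x
  have h2 : ‖R (B (perturbedResolvent R B x))‖ ≤ 1 / 2 * ‖perturbedResolvent R B x‖ :=
    (R * B).le_of_opNorm_le h _
  have h3 := norm_add_le (R x) (R (B (perturbedResolvent R B x)))
  rw [← h1] at h3
  linarith [R.le_opNorm x]

theorem aestronglyMeasurable_perturbedResolvent {R B : ℝ → X →L[ℂ] X}
    (hR : ∀ x, AEStronglyMeasurable (fun t => R t x) volume)
    (hB : ∀ x, AEStronglyMeasurable (fun t => B t x) volume)
    (h : ∀ t, ‖R t * B t‖ < 1) (x : X) :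
    AEStronglyMeasurable (fun t => perturbedResolvent (R t) (B t) x) volume := by
  have hn : ∀ n : ℕ, AEStronglyMeasurable (fun t => ((R t * B t) ^ n) (R t x)) volume := by
    intro n
    induction n with
    | zero => simpa using hR x
    | succ n ih =>
      simp only [pow_succ', mul_assoc]
      exact aestronglyMeasurable_clm_apply hR (aestronglyMeasurable_clm_apply hB ih)
  refine aestronglyMeasurable_of_tendsto_ae atTop
    (f := fun N t => ∑ n ∈ Finset.range N, ((R t * B t) ^ n) (R t x))
    (fun N => Finset.aestronglyMeasurable_fun_sum _ fun n _ => hn n)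
    (Eventually.of_forall fun t => ?_)
  exact (((summable_geometric_of_norm_lt_one (h t)).hasSum.mapL
    (ContinuousLinearMap.apply ℂ X (R t x))).tendsto_sum_nat)

end Resolvents

/-- Clamping sends half-lines to single points, so null sets are not pulled back to null sets. The
line is therefore split into three pieces, with constant functions on the outer two. -/
theorem aestronglyMeasurable_comp_projIcc {Z : Type*} [NormedAddCommGroup Z] {f : ℝ → Z} {T : ℝ}
    (hT : 0 ≤ T) (hf : AEStronglyMeasurable f (volume.restrict (Set.Ici 0))) :
    AEStronglyMeasurable (fun t => f (Set.projIcc 0 T hT t)) volume := by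
  have hU : (Set.Iio 0 ∪ Set.Icc 0 T) ∪ Set.Ioi T = Set.univ := by
    ext t
    simp only [Set.mem_union, Set.mem_Iio, Set.mem_Icc, Set.mem_Ioi, Set.mem_univ, iff_true]
    rcases lt_or_ge t 0 with h | h
    · exact Or.inl (Or.inl h)
    · rcases le_or_gt t T with h' | h'
      · exact Or.inl (Or.inr ⟨h, h'⟩)
      · exact Or.inr h'
  rw [← Measure.restrict_univ (μ := (volume : Measure ℝ)), ← hU, aestronglyMeasurable_union_iff,
    aestronglyMeasurable_union_iff]
  refine ⟨⟨?_, ?_⟩, ?_⟩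
  · refine (aestronglyMeasurable_const (b := f 0)).congr ?_
    filter_upwards [ae_restrict_mem measurableSet_Iio] with t ht
    rw [Set.projIcc_of_le_left hT (le_of_lt ht)]
  · refine (hf.mono_measure (Measure.restrict_mono Set.Icc_subset_Ici_self le_rfl)).congr ?_
    filter_upwards [ae_restrict_mem measurableSet_Icc] with t ht
    rw [Set.projIcc_of_mem hT ht]
  · refine (aestronglyMeasurable_const (b := f T)).congr ?_
    filter_upwards [ae_restrict_mem measurableSet_Ioi] with t ht
    rw [Set.projIcc_of_right_le hT (le_of_lt ht)]

/-! ### From the hypotheses on `G` to a `KatoSystem` on `[0, T]`. -/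

section Construction

variable {X Y : Type*} [NormedAddCommGroup X] [NormedSpace ℂ X]
  [NormedAddCommGroup Y] [NormedSpace ℂ Y]

/-- The commutator relation in terms of resolvents: the perturbed resolvent equation for `w` is
mapped by the inverse of `Θ - μ` to the unperturbed one. -/
theorem intertwine_of_isCommutator {ι : Y →L[ℂ] X} {Θ A : X →ₗ.[ℂ] X} {C : Y →L[ℂ] X} {μ : ℂ}
    (hdom : (Θ.domain : Set X) = Set.range ι) (hC : IsCommutator ι Θ A C) {E : Y ≃L[ℂ] X}
    (hE : ∀ (y : Y) (h : ι y ∈ Θ.domain), E y = Θ ⟨ι y, h⟩ - μ • ι y) {l : ℝ} {w x : X}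
    (hw : w ∈ A.domain) (hA : ι (E.symm w) ∈ A.domain)
    (hx : (l : ℂ) • w + Complex.I • A ⟨w, hw⟩ = x - Complex.I • C (E.symm w)) :
    (l : ℂ) • ι (E.symm w) + Complex.I • A ⟨ι (E.symm w), hA⟩ = ι (E.symm x) := by
  have hmem : ∀ y, ι y ∈ Θ.domain := fun y => by
    have : ι y ∈ (Θ.domain : Set X) := hdom ▸ Set.mem_range_self y
    exact this
  have hS : ∀ z (hz : z ∈ Θ.domain), ι (E.symm (Θ ⟨z, hz⟩ - μ • z)) = z := by
    intro z hz
    obtain ⟨y, rfl⟩ : z ∈ Set.range ι := hdom ▸ hz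
    rw [← hE, E.symm_apply_apply]
  set y := E.symm w with hy
  have hEy : Θ ⟨ι y, hmem y⟩ = w + μ • ι y := by
    rw [← sub_eq_iff_eq_add, ← hE, hy, E.apply_symm_apply]
  -- The commutator relation applies because `Θ y` is a combination of `w` and `y`, both in the
  -- domain of `A`.
  have hAΘ : Θ ⟨ι y, hmem y⟩ ∈ A.domain := by
    rw [hEy]
    exact A.domain.add_mem hw (A.domain.smul_mem μ hA)
  obtain ⟨hΘA, hcomm⟩ := hC y (hmem y) hA hAΘ
  have e1 : A ⟨Θ ⟨ι y, hmem y⟩, hAΘ⟩ = A ⟨w, hw⟩ + μ • A ⟨ι y, hA⟩ := by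
    rw [← LinearPMap.map_smul, ← LinearPMap.map_add]
    congr 1
    exact Subtype.ext hEy
  have e2 : x = (l : ℂ) • w + Complex.I • (Θ ⟨A ⟨ι y, hA⟩, hΘA⟩ - μ • A ⟨ι y, hA⟩) := by
    rw [e1] at hcomm
    rw [eq_sub_iff_add_eq] at hx
    rw [← hx, ← hcomm]
    module
  rw [e2, map_add, map_smul, map_smul, map_add, map_smul, map_smul, hS]

variable [CompleteSpace X] [CompleteSpace Y]

/-- The closed graph theorem makes `Θ` bounded from `Y` to `X`; `Θ - μ` is then a bounded bijection
of Banach spaces, with bounded inverse. -/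
theorem exists_equiv_of_isClosed {ι : Y →L[ℂ] X} (hι : Function.Injective ι) {Θ : X →ₗ.[ℂ] X}
    (hΘ : Θ.IsClosed) (hdom : (Θ.domain : Set X) = Set.range ι) {μ : ℂ}
    (hμ : Function.Bijective fun x : Θ.domain => Θ x - μ • (x : X)) :
    ∃ E : Y ≃L[ℂ] X, ∀ (y : Y) (h : ι y ∈ Θ.domain), E y = Θ ⟨ι y, h⟩ - μ • ι y := by
  have hmem : ∀ y, ι y ∈ Θ.domain := fun y => by
    have : ι y ∈ (Θ.domain : Set X) := hdom ▸ Set.mem_range_self y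
    exact this
  let F : Y →ₗ[ℂ] X := Θ.toFun.comp ((ι : Y →ₗ[ℂ] X).codRestrict Θ.domain hmem)
  have hF : ∀ y, F y = Θ ⟨ι y, hmem y⟩ := fun y => rfl
  have hFc : Continuous F := by
    refine LinearMap.continuous_of_isClosed_graph F ?_
    have h1 : (F.graph : Set (Y × X)) = (fun p : Y × X => (ι p.1, p.2)) ⁻¹' Θ.graph := by
      ext ⟨y, x⟩
      simp only [SetLike.mem_coe, LinearMap.mem_graph_iff, Set.mem_preimage,
        LinearPMap.mem_graph_iff]
      constructor
      · intro h
        exact ⟨⟨ι y, hmem y⟩, rfl, h.symm⟩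
      · rintro ⟨z, hz, hz'⟩
        have : z = ⟨ι y, hmem y⟩ := Subtype.ext hz
        rw [← hz', this]
        rfl
    rw [h1]
    exact hΘ.preimage (by fun_prop)
  let F' : Y →L[ℂ] X := ⟨F, hFc⟩ - μ • ι
  have hF' : ∀ y, F' y = Θ ⟨ι y, hmem y⟩ - μ • ι y := fun y => rfl
  have hinj : Function.Injective F' := fun y y' h => by
    have := hμ.1 (a₁ := ⟨ι y, hmem y⟩) (a₂ := ⟨ι y', hmem y'⟩) h
    exact hι (congrArg Subtype.val this)
  have hsurj : Function.Surjective F' := fun x => by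
    obtain ⟨⟨z, hz⟩, hzx⟩ := hμ.2 x
    obtain ⟨y, rfl⟩ : z ∈ Set.range ι := hdom ▸ hz
    exact ⟨y, hzx⟩
  refine ⟨ContinuousLinearEquiv.ofBijective F' (LinearMap.ker_eq_bot.mpr hinj)
    (LinearMap.range_eq_top.mpr hsurj), fun y h => ?_⟩
  exact hF' y

theorem exists_katoSystem {ι : Y →L[ℂ] X} (hι : Function.Injective ι) (hdense : DenseRange ι)
    {G : ℝ → X →ₗ.[ℂ] X} (hB1 : KatoQuasiStable G) (hB2 : DomainsAndContinuity ι G)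
    (hB3 : Intertwining ι G) {T : ℝ} (hT : 0 ≤ T) :
    ∃ (Q : KatoSystem X) (E : Y ≃L[ℂ] X), (∀ y, Q.S (E y) = ι y) ∧
      (∀ l t, Q.L ≤ l → t ∈ Set.Icc 0 T → IsShiftedInverse (G t) l (Q.R l t)) ∧
      (∀ l t, t ∈ Set.Icc 0 T → Q.Y l t = yosida (G t) l) ∧
      ∀ t ∈ Set.Icc 0 T, ∀ x, ∃ h : Q.S x ∈ (G t).domain,
        Q.a t x = -(Complex.I • G t ⟨Q.S x, h⟩) := by
  obtain ⟨m, β₀, hm, -, hβ, hres, hstab⟩ := hB1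
  obtain ⟨g, hg, hgc⟩ := hB2
  obtain ⟨Θ, C, hΘ, hdom, ⟨μ, hμ⟩, hC, hCb, hCm⟩ := hB3
  obtain ⟨b, hb⟩ := hβ T
  obtain ⟨κ, hκ⟩ := hCb T
  obtain ⟨E, hE⟩ := exists_equiv_of_isClosed hι hΘ hdom hμ
  have hb0 : 0 ≤ b := (abs_nonneg _).trans (hb 0 ⟨le_rfl, hT⟩)
  have hκ0 : 0 ≤ κ := (norm_nonneg _).trans (hκ 0 ⟨le_rfl, hT⟩)
  have hm0 : 0 ≤ m := by linarith
  -- Times are clamped to `[0, T]`, so that local bounds become global and continuity becomes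
  -- uniform.
  set φ : ℝ → ℝ := fun t => (Set.projIcc 0 T hT t : ℝ) with hφ
  have hφT : ∀ t, φ t ∈ Set.Icc 0 T := fun t => (Set.projIcc 0 T hT t).2
  have hφ0 : ∀ t, 0 ≤ φ t := fun t => (hφT t).1
  have hφm : Monotone φ := fun t t' h => Set.monotone_projIcc hT h
  have hφe : ∀ t ∈ Set.Icc 0 T, φ t = t := fun t ht => by
    simp only [hφ]; rw [Set.projIcc_of_mem hT ht]
  have hgu : UniformContinuous fun t => g (φ t) := by
    have h1 : Continuous fun t : Set.Icc (0 : ℝ) T => g t :=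
      hgc.comp_continuous continuous_subtype_val fun t => t.2.1
    exact (CompactSpace.uniformContinuous_of_continuous h1).comp
      (LipschitzWith.projIcc hT).uniformContinuous
  obtain ⟨γ, hγ⟩ : ∃ γ, ∀ t, ‖g (φ t)‖ ≤ γ := by
    obtain ⟨γ, hγ⟩ := (isCompact_Icc (a := (0 : ℝ)) (b := T)).exists_bound_of_continuousOn
      (hgc.mono fun t ht => ht.1)
    exact ⟨γ, fun t => hγ _ (hφT t)⟩
  set Es : X →L[ℂ] Y := (E.symm : X →L[ℂ] Y) with hEs
  set S : X →L[ℂ] X := ι.comp Es with hS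
  set a : ℝ → X →L[ℂ] X := fun t => (-Complex.I) • (g (φ t)).comp Es with ha
  set B : ℝ → X →L[ℂ] X := fun t => (-Complex.I) • (C (φ t)).comp Es with hB
  set K := κ * ‖Es‖ with hK
  have hK0 : 0 ≤ K := by positivity
  have hBK : ∀ t, ‖B t‖ ≤ K := fun t => by
    simp only [hB]
    rw [norm_smul, norm_neg, Complex.norm_I, one_mul]
    exact ((C (φ t)).opNorm_comp_le Es).trans 
      (mul_le_mul_of_nonneg_right (hκ _ (hφT t)) (norm_nonneg _))
  set R : ℝ → ℝ → X →L[ℂ] X := fun l t => shiftedResolvent (G (φ t)) l with hR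
  have hspec : ∀ l t, b < l → IsShiftedInverse (G (φ t)) l (R l t) := fun l t hl =>
    shiftedResolvent_spec (hres _ _ (hφ0 t) ((le_abs_self _).trans (hb _ (hφT t)) |>.trans_lt hl))
  obtain ⟨N, hNa, hN1, hN2, hN3⟩ := exists_stable_seminorms
    (norm_weightedProd_le hm0 hstab (fun t ht => (le_abs_self _).trans (hb t ht)) hφm hφT)
  -- The term `2 * b` yields `‖R‖ ≤ 2 * m / l`; with `4 * m * K` this gives `‖R * B‖ ≤ 1 / 2`, so
  -- the Neumann series for `Rh` converges. The `1` gives positivity and `b < L`.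
  set L := 2 * b + 4 * m * K + 1 with hL
  have hLpos : 0 < L := by positivity
  have hLb : ∀ l, L ≤ l → b < l := fun l hl => by
    have : 0 ≤ m * K := by positivity
    linarith
  have hRn : ∀ l t, L ≤ l → ‖R l t‖ ≤ 2 * m / l := fun l t hl => by
    have hl0 : 0 < l := hLpos.trans_le hl
    refine ContinuousLinearMap.opNorm_le_bound _ (by positivity) fun x => ?_
    have h1 := hN3 t l x (hLb l hl)
    have h2 := (mul_le_mul_of_nonneg_left (hN1 t (R l t x)) (by linarith [hLb l hl])).trans
      (h1.trans (hN2 t x))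
    have h3 : l / 2 * ‖R l t x‖ ≤ (l - b) * ‖R l t x‖ := by
      have : 0 ≤ m * K := by positivity
      gcongr
      linarith
    rw [div_mul_eq_mul_div, le_div_iff₀ hl0]
    linarith
  have hRB : ∀ l t, L ≤ l → ‖R l t * B t‖ ≤ 1 / 2 := fun l t hl => by
    have hl0 : 0 < l := hLpos.trans_le hl
    refine (norm_mul_le _ _).trans ((mul_le_mul (hRn l t hl) (hBK t) (norm_nonneg _)
      (by positivity)).trans ?_)
    rw [div_mul_eq_mul_div, div_le_div_iff₀ hl0 (by norm_num)]
    linarith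
  have hRB1 : ∀ l t, L ≤ l → ‖R l t * B t‖ < 1 := fun l t hl =>
    (hRB l t hl).trans_lt (by norm_num)
  set Rh : ℝ → ℝ → X →L[ℂ] X := fun l t => perturbedResolvent (R l t) (B t) with hRh
  have hRhe : ∀ l t x, L ≤ l → Rh l t x = R l t x + R l t (B t (Rh l t x)) := fun l t x hl =>
    perturbedResolvent_eq (hRB1 l t hl) x
  have hRS : ∀ l t x, L ≤ l → R l t ((l : ℂ) • S x - a t x) = S x := fun l t x hl => by
    obtain ⟨h, e⟩ := hg (φ t) (hφ0 t) (Es x)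
    have h1 := (hspec l t (hLb l hl)).2 ⟨ι (Es x), h⟩
    rw [← e] at h1
    simpa [ha, hS] using h1
  have hSRh : ∀ l t x, L ≤ l → (l : ℂ) • S (Rh l t x) - a t (Rh l t x) = S x :=
    fun l t x hl => by
    -- The equation reads `Rh x = R (x + B (Rh x))`, so `Rh x` lies in the domain of `G` and solves
    -- the perturbed resolvent equation.
    have e1 := hRhe l t x hl
    rw [← map_add] at e1
    obtain ⟨hw, e2⟩ := (hspec l t (hLb l hl)).1 (x + B t (Rh l t x))
    simp only [← e1] at hw e2
    obtain ⟨h, e⟩ := hg (φ t) (hφ0 t) (Es (Rh l t x))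
    have h1 := intertwine_of_isCommutator hdom (hC (φ t) (hφ0 t)) hE hw h (x := x) (l := l) (by
      rw [e2]
      simp only [hB, neg_smul]
      rw [sub_eq_add_neg]
      rfl)
    rw [show (G (φ t)) ⟨ι (E.symm (Rh l t x)), h⟩ = g (φ t) (Es (Rh l t x)) from e.symm] at h1
    simpa [ha, hS, hEs] using h1
  have hRSe : ∀ l t x, L ≤ l → R l t (S x) = S (Rh l t x) := fun l t x hl => by
    rw [← hSRh l t x hl, hRS l t _ hl]
  have hac : UniformContinuous a := by
    have h1 : UniformContinuous fun t => (g (φ t)).comp Es := by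
      exact (((ContinuousLinearMap.compL ℂ X Y X).flip Es).uniformContinuous).comp hgu
    exact (uniformContinuous_const_smul (-Complex.I)).comp h1
  have hSd : DenseRange S := hdense.comp (E.symm.surjective.denseRange) ι.continuous
  have hBm : ∀ x, AEStronglyMeasurable (fun t => B t x) volume := fun x =>
    (aestronglyMeasurable_comp_projIcc hT (hCm (Es x))).const_smul (-Complex.I)
  have hRc : ∀ l x, L ≤ l → Continuous fun t => R l t x := fun l x hl =>
    continuous_resolvent_apply (fun t => hRn l t hl) hSd hac.continuous (Rh := Rh l)
      (fun t s x => by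
        have h1 := hRS l t (Rh l s x) hl
        have h2 := hSRh l s x hl
        calc R l t (S x) - R l s (S x) = R l t ((l : ℂ) • S (Rh l s x) - a s (Rh l s x)) -
              R l t ((l : ℂ) • S (Rh l s x) - a t (Rh l s x)) := by rw [h1, h2, hRSe l s x hl]
          _ = _ := by
            rw [← map_sub]
            congr 1
            abel) x
  let Q : KatoSystem X :=
    -- The constant `4 * m` serves both families: the Neumann series at most doubles the bound `2 *
    -- m / l` of `R`.
    { N := N, m := m, b := b, L := L, c := 4 * m, K := K, R := R, Rh := Rh, S := S, a := a, B := B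
      one_le_m := hm
      b_nonneg := hb0
      L_pos := hLpos
      two_b_le := by
        have : 0 ≤ m * K := by positivity
        linarith
      c_nonneg := by positivity
      N_anti := hNa
      norm_le_N := hN1
      N_le := hN2
      N_R := fun l t x hl => hN3 t l x (hLb l hl)
      norm_R := fun l t hl => (hRn l t hl).trans (by
        have hl0 : 0 < l := hLpos.trans_le hl
        gcongr
        norm_num)
      norm_Rh := fun l t hl => (norm_perturbedResolvent_le (hRB l t hl)).trans (by
        have := hRn l t hl
        calc 2 * ‖R l t‖ ≤ 2 * (2 * m / l) := by gcongr
          _ = 4 * m / l := by ring)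
      R_sub := fun l l' t x hl hl' =>
        resolvent_identity (hspec l t (hLb l hl)) (hspec l' t (hLb l' hl')) x
      denseRange_S := hSd
      a_cont := hac
      a_bdd := ⟨γ * ‖Es‖, fun t => by
        simp only [ha]
        rw [norm_smul, norm_neg, Complex.norm_I, one_mul]
        exact ((g (φ t)).opNorm_comp_le Es).trans 
          (mul_le_mul_of_nonneg_right (hγ t) (norm_nonneg _))⟩
      R_S_sub := hRS
      R_S := hRSe
      S_Rh_sub := hSRh
      Rh_eq := hRhe
      norm_B := hBK
      Rh_meas := fun l x hl => aestronglyMeasurable_perturbedResolvent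
        (fun x => (hRc l x hl).aestronglyMeasurable) hBm (fun t => hRB1 l t hl) x }
  refine ⟨Q, E, fun y => ?_, fun l t hl ht => ?_, fun l t ht => ?_, fun t ht x => ?_⟩
  · change ι (E.symm (E y)) = ι y
    rw [E.symm_apply_apply]
  · have := hspec l t (hLb l hl)
    rwa [hφe t ht] at this
  · change (-(Complex.I * (l : ℂ))) • (1 - (l : ℂ) • shiftedResolvent (G (φ t)) l) = _
    rw [hφe t ht]
    rfl
  · obtain ⟨h, e⟩ := hg t ht.1 (Es x)
    refine ⟨h, ?_⟩
    change (-Complex.I) • g (φ t) (Es x) = _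
    rw [hφe t ht, neg_smul, e]
    rfl

end Construction

/-! ### The evolution of `G` and its properties. -/

section MainTheorem

variable {X Y : Type*} [NormedAddCommGroup X] [NormedSpace ℂ X]
  [NormedAddCommGroup Y] [NormedSpace ℂ Y]

/-- The evolution generated by the Yosida approximants of `G`. -/
noncomputable def yosidaEvolution (G : ℝ → X →ₗ.[ℂ] X) (l t s : ℝ) : X →L[ℂ] X :=
  evo (fun τ => yosida (G τ) l) t s

/-- The evolution generated by `G`, as strong limit of the Yosida evolutions. -/
noncomputable def katoEvolution (G : ℝ → X →ₗ.[ℂ] X) (t s : ℝ) : X →L[ℂ] X :=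
  strongLimit fun l => yosidaEvolution G l t s

/-- On `[0, T]`, the system `Q` is made of the Yosida approximants and generators of `G`. -/
structure Represents (ι : Y →L[ℂ] X) (G : ℝ → X →ₗ.[ℂ] X) (T : ℝ) (Q : KatoSystem X)
    (E : Y ≃L[ℂ] X) : Prop where
  S_apply : ∀ y, Q.S (E y) = ι y
  resolvent : ∀ l t, Q.L ≤ l → t ∈ Set.Icc 0 T → IsShiftedInverse (G t) l (Q.R l t)
  Y_eq : ∀ l t, t ∈ Set.Icc 0 T → Q.Y l t = yosida (G t) l
  a_eq : ∀ t ∈ Set.Icc 0 T, ∀ x, ∃ h : Q.S x ∈ (G t).domain,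
    Q.a t x = -(Complex.I • G t ⟨Q.S x, h⟩)

namespace Represents

variable {ι : Y →L[ℂ] X} {G : ℝ → X →ₗ.[ℂ] X} {T l s t : ℝ} {Q : KatoSystem X} {E : Y ≃L[ℂ] X}
  (hQ : Represents ι G T Q E)
include hQ

theorem yosidaEvolution_eq (hs : 0 ≤ s) (hst : s ≤ t) (htT : t ≤ T) (l : ℝ) :
    yosidaEvolution G l t s = Q.U l t s :=
  evo_congr hst fun τ hτ => (hQ.Y_eq l τ ⟨hs.trans hτ.1, hτ.2.trans htT⟩).symm

theorem S_eq (x : X) : Q.S x = ι (E.symm x) := by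
  rw [← hQ.S_apply, E.apply_symm_apply]

theorem continuousOn_yosida (hl : Q.L ≤ l) (x : X) :
    ContinuousOn (fun t => yosida (G t) l x) (Set.Icc 0 T) :=
  (Q.Y_continuous hl x).continuousOn.congr fun t ht => by simp only [hQ.Y_eq l t ht]

variable [CompleteSpace X]

theorem katoEvolution_eq (hs : 0 ≤ s) (hst : s ≤ t) (htT : t ≤ T) :
    katoEvolution G t s = Q.V t s := by
  unfold katoEvolution
  refine strongLimit_eq fun x => ?_
  simpa only [hQ.yosidaEvolution_eq hs hst htT] using Q.V_tendsto hst x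

theorem katoEvolution_apply (hs : 0 ≤ s) (hst : s ≤ t) (htT : t ≤ T) (y : Y) :
    katoEvolution G t s (ι y) = Q.S (Q.Vh t s (E y)) := by
  rw [hQ.katoEvolution_eq hs hst htT, ← hQ.S_apply, Q.S_Vh hst]

/-- Strictness of `t < T` leaves room to the right of `t`, where the evolution must still be
represented by `Q`. -/
theorem hasDerivWithinAt_left (hs : 0 ≤ s) (hst : s ≤ t) (htT : t < T) (y : Y) :
    ∃ h : katoEvolution G t s (ι y) ∈ (G t).domain,
      HasDerivWithinAt (fun r => katoEvolution G r s (ι y))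
        (-(Complex.I • G t ⟨katoEvolution G t s (ι y), h⟩)) (Set.Ici s) t := by
  obtain ⟨h, e⟩ := hQ.a_eq t ⟨hs.trans hst, htT.le⟩ (Q.Vh t s (E y))
  have hd := Q.V_hasDerivWithinAt_left hst (E y)
  rw [e] at hd
  simp only [hQ.katoEvolution_apply hs hst htT.le]
  refine ⟨h, hd.congr_of_eventuallyEq_of_mem ?_ hst⟩
  filter_upwards [self_mem_nhdsWithin, nhdsWithin_le_nhds (Iio_mem_nhds htT)] with r hr hrT
  rw [hQ.katoEvolution_eq hs hr (le_of_lt hrT), hQ.S_apply]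

theorem hasDerivWithinAt_right (hs : 0 ≤ s) (hst : s ≤ t) (htT : t ≤ T) (y : Y) :
    ∃ h : ι y ∈ (G s).domain, HasDerivWithinAt (fun r => katoEvolution G t r (ι y))
      (Complex.I • katoEvolution G t s (G s ⟨ι y, h⟩)) (Set.Icc 0 t) s := by
  obtain ⟨h, e⟩ := hQ.a_eq s ⟨hs, hst.trans htT⟩ (E y)
  have hd := (Q.V_hasDerivWithinAt_right hst (E y)).mono (Set.Icc_subset_Iic_self (a := 0))
  rw [e, map_neg, neg_neg, map_smul] at hd
  simp only [hQ.S_apply] at h hd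
  refine ⟨h, ?_⟩
  rw [hQ.katoEvolution_eq hs hst htT]
  exact hd.congr_of_mem (fun r hr => by rw [hQ.katoEvolution_eq hr.1 hr.2 htT]) ⟨hs, hst⟩

/-- A competing solution takes values in the domains but perhaps not in `Y`, so it cannot be
inserted into the backward equation. Instead the difference of the two solutions solves the forward
equation with values in the domains, and dissipativity forces it to vanish. -/
theorem eq_katoEvolution (hdense : DenseRange ι) {V : ℝ → ℝ → X →L[ℂ] X}
    (hV : IsForwardSolution ι G V) (hs : 0 ≤ s) (hst : s ≤ t) (htT : t < T) :
    V t s = katoEvolution G t s := by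
  refine ContinuousLinearMap.ext fun x => ?_
  refine hdense.induction_on (p := fun x => V t s x = katoEvolution G t s x) x
    (isClosed_eq (V t s).continuous (katoEvolution G t s).continuous) fun y => ?_
  have hG : ∀ r, ∃ z : X, s ≤ r → r ≤ t → ∃ h : V r s (ι y) - katoEvolution G r s (ι y) ∈
      (G r).domain, z = -(Complex.I • G r ⟨V r s (ι y) - katoEvolution G r s (ι y), h⟩) ∧
      HasDerivWithinAt (fun r => V r s (ι y) - katoEvolution G r s (ι y)) z (Set.Icc s t) r := by
    intro r
    by_cases hr : s ≤ r ∧ r ≤ t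
    · obtain ⟨h1, d1⟩ := hV.2 s r hs hr.1 y
      obtain ⟨h2, d2⟩ := hQ.hasDerivWithinAt_left hs hr.1 (hr.2.trans_lt htT) y
      refine ⟨_, fun _ _ => ⟨(G r).domain.sub_mem h1 h2, rfl, ?_⟩⟩
      have e : G r ⟨_, (G r).domain.sub_mem h1 h2⟩ = G r ⟨_, h1⟩ - G r ⟨_, h2⟩ :=
        (G r).map_sub ⟨_, h1⟩ ⟨_, h2⟩
      rw [e, smul_sub, neg_sub']
      exact (d1.sub d2).mono Set.Icc_subset_Ici_self
    · exact ⟨0, fun h1 h2 => (hr ⟨h1, h2⟩).elim⟩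
  choose v' hv' using hG
  refine sub_eq_zero.mp (Q.eq_zero_of_hasDerivWithinAt
    (v := fun r => V r s (ι y) - katoEvolution G r s (ι y)) (v' := v') hst
    (fun r hr => (hv' r hr.1 hr.2).2.2) (fun r hr l hl => ?_) ?_)
  · obtain ⟨h, e, -⟩ := hv' r hr.1 hr.2
    rw [e, sub_neg_eq_add]
    exact (hQ.resolvent l r hl ⟨hs.trans hr.1, hr.2.trans htT.le⟩).2 ⟨_, h⟩
  · rw [hV.1 s hs, hQ.katoEvolution_eq hs le_rfl (hst.trans htT.le), Q.V_self, sub_self]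

theorem continuousWithinAt {p : ℝ × ℝ} (hp : 0 ≤ p.2 ∧ p.2 ≤ p.1) (hpT : p.1 < T) (x : X) :
    ContinuousWithinAt (fun p : ℝ × ℝ => katoEvolution G p.1 p.2 x) {p | 0 ≤ p.2 ∧ p.2 ≤ p.1}
      p := by
  have hc : ContinuousWithinAt (fun p : ℝ × ℝ => Q.V p.1 p.2 x) {p | 0 ≤ p.2 ∧ p.2 ≤ p.1} p :=
    (Q.V_continuousOn x p hp.2).mono fun q hq => hq.2
  refine hc.congr_of_eventuallyEq_of_mem ?_ hp
  filter_upwards [self_mem_nhdsWithin, nhdsWithin_le_nhds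
    ((isOpen_Iio.preimage continuous_fst).mem_nhds hpT)] with q hq hqT
  rw [hQ.katoEvolution_eq hq.1 hq.2 (le_of_lt hqT)]

theorem isDysonSum (hl : Q.L ≤ l) (hs : 0 ≤ s) (hst : s ≤ t) (htT : t ≤ T) :
    IsDysonSum (fun τ => yosida (G τ) l) s t (yosidaEvolution G l t s) := by
  rw [hQ.yosidaEvolution_eq hs hst htT]
  exact isDysonSum_congr hst (fun τ hτ => hQ.Y_eq l τ ⟨hs.trans hτ.1, hτ.2.trans htT⟩)
    (isDysonSum_evo (Q.Y_meas hl) (Q.norm_Y_le hl) t s)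

theorem tendsto_yosidaEvolution (hs : 0 ≤ s) (hst : s ≤ t) (htT : t ≤ T) (x : X) :
    Tendsto (fun l => yosidaEvolution G l t s x) atTop (𝓝 (katoEvolution G t s x)) := by
  rw [hQ.katoEvolution_eq hs hst htT]
  simpa only [hQ.yosidaEvolution_eq hs hst htT] using Q.V_tendsto hst x

/-- As `ι = S ∘ E` with `E` bounded, the Cauchy estimate on the range of `S`, uniform in the
preimage, is convergence in the norm of operators from `Y` to `X`. -/
theorem tendsto_norm_yosidaEvolution_sub (hs : 0 ≤ s) (hst : s ≤ t) (htT : t ≤ T) :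
    Tendsto (fun l => ‖(yosidaEvolution G l t s - katoEvolution G t s).comp ι‖) atTop (𝓝 0) := by
  simp only [hQ.katoEvolution_eq hs hst htT, hQ.yosidaEvolution_eq hs hst htT]
  rw [Metric.tendsto_atTop]
  intro ε hε
  have hE : 0 < ‖(E : Y →L[ℂ] X)‖ + 1 := by positivity
  obtain ⟨Λ, -, hΛ⟩ := Q.V_rate (t - s) (div_pos (half_pos hε) hE)
  refine ⟨Λ, fun l hl => ?_⟩
  rw [Real.dist_0_eq_abs, abs_norm]
  refine lt_of_le_of_lt ?_ (half_lt_self hε)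
  refine ContinuousLinearMap.opNorm_le_bound _ (by positivity) fun y => ?_
  have h1 := hΛ l hl s t hst le_rfl (E y)
  rw [hQ.S_apply] at h1
  have h2 : ‖E y‖ ≤ (‖(E : Y →L[ℂ] X)‖ + 1) * ‖y‖ :=
    ((E : Y →L[ℂ] X).le_opNorm y).trans (by gcongr; linarith)
  calc _ ≤ ε / 2 / (‖(E : Y →L[ℂ] X)‖ + 1) * ‖E y‖ := h1
    _ ≤ ε / 2 / (‖(E : Y →L[ℂ] X)‖ + 1) * ((‖(E : Y →L[ℂ] X)‖ + 1) * ‖y‖) := by gcongr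
    _ = ε / 2 * ‖y‖ := by field_simp

end Represents

end MainTheorem

theorem mainTheorem8 {X Y : Type*}
    [NormedAddCommGroup X] [NormedSpace ℂ X] [CompleteSpace X]
    [NormedAddCommGroup Y] [NormedSpace ℂ Y] [CompleteSpace Y]
    (ι : Y →L[ℂ] X) (hι : Function.Injective ι) (hdense : DenseRange ι)
    (G : ℝ → X →ₗ.[ℂ] X)
    (hB1 : KatoQuasiStable G)
    (hB2 : DomainsAndContinuity ι G)
    (hB3 : Intertwining ι G) :
    ∃ U : ℝ → ℝ → X →L[ℂ] X,
      IsForwardSolution ι G U ∧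
      IsBackwardSolution ι G U ∧
      (∀ V : ℝ → ℝ → X →L[ℂ] X, IsForwardSolution ι G V →
        ∀ s t : ℝ, 0 ≤ s → s ≤ t → V t s = U t s) ∧
      (∀ s t : ℝ, 0 ≤ s → s ≤ t → ∀ y : Y, U t s (ι y) ∈ Set.range ι) ∧
      IsEvolutionOperator U ∧
      ∃ W : ℝ → ℝ → ℝ → X →L[ℂ] X,
        (∀ T : ℝ, 0 ≤ T → ∃ L : ℝ, ∀ l : ℝ, L < l →
          (∀ x : X, ContinuousOn (fun t => yosida (G t) l x) (Set.Icc 0 T)) ∧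
          ∀ s t : ℝ, 0 ≤ s → s ≤ t → t ≤ T →
            IsDysonSum (fun τ => yosida (G τ) l) s t (W l t s)) ∧
        (∀ s t : ℝ, 0 ≤ s → s ≤ t →
          (∀ x : X, Tendsto (fun l => W l t s x) atTop (𝓝 (U t s x))) ∧
          Tendsto (fun l => ‖(W l t s - U t s).comp ι‖) atTop (𝓝 0)) := by
  -- The system depends on `T`, but `katoEvolution` does not, so each claim may be proved with any
  -- `T` beyond the times involved.
  have hrep : ∀ T, 0 ≤ T → ∃ Q E, Represents ι G T Q E := fun T hT => by
    obtain ⟨Q, E, h1, h2, h3, h4⟩ := exists_katoSystem hι hdense hB1 hB2 hB3 hT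
    exact ⟨Q, E, h1, h2, h3, h4⟩
  have hself : ∀ s, 0 ≤ s → katoEvolution G s s = 1 := fun s hs => by
    obtain ⟨Q, E, hQ⟩ := hrep s hs
    rw [hQ.katoEvolution_eq hs le_rfl le_rfl, Q.V_self]
  refine ⟨katoEvolution G, ⟨hself, fun s t hs hst y => ?_⟩, ⟨hself, fun s t hs hst y => ?_⟩,
    fun V hV s t hs hst => ?_, fun s t hs hst y => ?_,
    ⟨hself, fun s r t hs hsr hrt => ?_, fun x p hp => ?_⟩,
    yosidaEvolution G, fun T hT => ?_, fun s t hs hst => ?_⟩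
  · obtain ⟨Q, E, hQ⟩ := hrep (t + 1) (by linarith)
    exact hQ.hasDerivWithinAt_left hs hst (lt_add_one t) y
  · obtain ⟨Q, E, hQ⟩ := hrep t (hs.trans hst)
    exact hQ.hasDerivWithinAt_right hs hst le_rfl y
  · obtain ⟨Q, E, hQ⟩ := hrep (t + 1) (by linarith)
    exact hQ.eq_katoEvolution hdense hV hs hst (lt_add_one t)
  · obtain ⟨Q, E, hQ⟩ := hrep t (hs.trans hst)
    rw [hQ.katoEvolution_apply hs hst le_rfl, hQ.S_eq]
    exact Set.mem_range_self _
  · obtain ⟨Q, E, hQ⟩ := hrep t (by linarith)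
    rw [hQ.katoEvolution_eq hs (hsr.trans hrt) le_rfl, hQ.katoEvolution_eq hs hsr hrt,
      hQ.katoEvolution_eq (hs.trans hsr) hrt le_rfl, Q.V_comp hsr hrt]
  · obtain ⟨Q, E, hQ⟩ := hrep (p.1 + 1) (by linarith [hp.1, hp.2])
    exact hQ.continuousWithinAt hp (lt_add_one p.1) x
  · obtain ⟨Q, E, hQ⟩ := hrep T hT
    exact ⟨Q.L, fun l hl => ⟨hQ.continuousOn_yosida hl.le,
      fun s t hs hst htT => hQ.isDysonSum hl.le hs hst htT⟩⟩
  · obtain ⟨Q, E, hQ⟩ := hrep t (hs.trans hst)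
    exact ⟨hQ.tendsto_yosidaEvolution hs hst le_rfl,
      hQ.tendsto_norm_yosidaEvolution_sub hs hst le_rfl⟩
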